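/- Let $(\overline M,\langle\cdot,\cdot\rangle)$ be a smooth seven-dimensional Riemannian manifold with a $G_2$-structure, i.e. a smooth three-form $\varphi$ which at each point can be written as $\varphi=\sum_{i\in\mathbb Z_7}e_i\wedge e_{i+1}\wedge e_{i+3}$ in an orthonormal (Cayley) coframe $e_0,\dots,e_6$. Let $*\varphi=-\sum_{i\in\mathbb Z_7}e_{i+2}\wedge e_{i+4}\wedge e_{i+5}\wedge e_{i+6}$ be its Hodge dual, let $P$ be given by $\langle P(x,y),z\rangle=\varphi(x,y,z)$, let $\overline\nabla$ be the Levi-Civita connection, and put $$\overline r(\varphi)(x,y)=\tfrac14\langle x\lrcorner\overline\nabla\varphi,\;y\lrcorner *\varphi\rangle .$$ The space $\mathcal X=T^*\overline M\otimes\{v\lrcorner *\varphi\}$ containing $\overline\nabla\varphi$ is the sum of four irreducible $G_2$-modules $\mathcal X_1,\mathcal X_2,\mathcal X_3,\mathcal X_4$ of dimensions $1,14,27,7$. Assume that the $G_2$-structure is of type $\mathcal X_3$, i.e. $\overline\nabla\varphi\in\mathcal X_3$ at every point. Let $\iota:M\to\overline M$ be an orientable hypersurface with smooth unit normal vector field $n$,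 let $II$ be its shape tensor ($II(x,y)$ is the normal part of $\overline\nabla_xy$), $B(x,y)=\langle II(x,y),n\rangle$, $H=\frac16\operatorname{Tr}II$ and $h=\langle H,n\rangle$. Let $\theta$ be a smooth function on $M$, and consider on $M$ the $SU(3)$-structure consisting of the induced metric, the almost complex structure $Ix=P(n,x)$ and the complex volume form $\Psi=\psi_++i\psi_-$ with $$\psi_+=\cos\theta\,\iota^*\varphi-\sin\theta\,\iota^*(n\lrcorner *\varphi),\qquad \psi_-=\sin\theta\,\iota^*\varphi+\cos\theta\,\iota^*(n\lrcorner *\varphi).$$ Put $\omega(x,y)=\langle x,Iy\rangle$, let $\nabla$ be the Levi-Civita connection of $M$, and let $\eta+\xi$ be the intrinsic $SU(3)$-torsion: $\xi_xy=-\frac12I(\nabla_xI)y$, $\eta_xy=(I\eta)(x)Iy$ with $\eta$ a one-form and $(I\eta)(x)=-\eta(Ix)$, and $\nabla+\eta+\xi$ annihilates $\psi_+$ and $\psi_-$. Then $\nabla\omega=-\xi\omega$ lies in $\mathcal W_1+\mathcal W_2+\mathcal W_3+\mathcal W_4$ (the Gray–Hervella modules), and $\mathcal W_i=\mathcal W_i^++\mathcal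 W_i^-$ for $i=1,2$, where $\mathcal W_i^+$ (resp. $\mathcal W_i^-$) consists of the $a\in\mathcal W_i$ for which $r(a)(x,y)=\frac12\langle x\lrcorner a,y\lrcorner\psi_+\rangle$ is symmetric (resp. skew-symmetric). The structure is said to be of a type given by a sum of some of the modules $\mathcal W_1^\pm,\mathcal W_2^\pm,\mathcal W_3,\mathcal W_4,\mathcal W_5$ if, at every point, $\nabla\omega$ lies in the sum of those among $\mathcal W_1^\pm,\mathcal W_2^\pm,\mathcal W_3,\mathcal W_4$ that occur in it and, in case $\mathcal W_5$ does not occur, $\eta=0$. For a bilinear form $b$ on $TM$ write $I_{(1)}b(x,y)=-b(Ix,y)$, $I_{(2)}b(x,y)=-b(x,Iy)$, $Ib(x,y)=b(Ix,Iy)$. Then the $SU(3)$-structure on $M$ is of type $\mathcal W_1^++\mathcal W_1^-+\mathcal W_2^++\mathcal W_2^-+\mathcal W_3+\mathcal W_5$. Moreover it is of type 1. $\mathcal W_1^++\mathcal W_1^-+\mathcal W_2^++\mathcal W_2^-+\mathcal W_3$ if and only if $d\theta=\overline r(\varphi)(\iota_*\cdot,n)$; 2. $\mathcal W_1^++\mathcal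 W_1^-+\mathcal W_2^++\mathcal W_2^-+\mathcal W_5$ if and only if $(I_{(1)}+I_{(2)})\iota^*\overline r(\varphi)=(1-I)B$; 3. $\mathcal W_1^++\mathcal W_1^-+\mathcal W_2^++\mathcal W_3+\mathcal W_5$ if and only if $3\cos\theta\,(1+I)\iota^*\overline r(\varphi)+3\sin\theta\,(1+I)B=(6h\sin\theta-\cos\theta\,\overline r(\varphi)(n,n))\langle\cdot,\cdot\rangle$; 4. $\mathcal W_1^++\mathcal W_1^-+\mathcal W_2^-+\mathcal W_3+\mathcal W_5$ if and only if $-3\sin\theta\,(1+I)\iota^*\overline r(\varphi)+3\cos\theta\,(1+I)B=(6h\cos\theta+\sin\theta\,\overline r(\varphi)(n,n))\langle\cdot,\cdot\rangle$; 5. $\mathcal W_1^++\mathcal W_2^++\mathcal W_2^-+\mathcal W_3+\mathcal W_5$ if and only if $\cos\theta\,\overline r(\varphi)(n,n)=6h\sin\theta$; 6. $\mathcal W_1^-+\mathcal W_2^++\mathcal W_2^-+\mathcal W_3+\mathcal W_5$ if and only if $\sin\theta\,\overline r(\varphi)(n,n)=-6h\cos\theta$; 7. $\mathcal W_1^++\mathcal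 W_1^-+\mathcal W_3+\mathcal W_5$ if and only if $3(1+I)\iota^*\overline r(\varphi)=-\overline r(\varphi)(n,n)\langle\cdot,\cdot\rangle$ and $(1+I)B=2h\langle\cdot,\cdot\rangle$; 8. $\mathcal W_2^++\mathcal W_2^-+\mathcal W_3+\mathcal W_5$ if and only if $\overline r(\varphi)(n,n)=0$ and $M$ is a minimal variety ($H=0$). -/

import Mathlib

open scoped Manifold ContDiff Topology
open Bundle

noncomputable section

/-! ### Linear algebra of a Euclidean vector space -/

section Algebra

variable {V : Type*} [AddCommGroup V] [Module ℝ V]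

/-- `e` is an orthonormal family for the bilinear form `g`. -/
def IsOrthonormalFrame {k : ℕ} (g : V → V → ℝ) (e : Fin k → V) : Prop :=
  ∀ i j, g (e i) (e j) = if i = j then 1 else 0

/-- An orthonormal frame of length `k`, chosen once and for all.  It is used only for scalar
products `g` on spaces of dimension `k` (where such a frame exists), and only in expressions that
do not depend on the choice. -/
def orthonormalFrame (k : ℕ) (g : V → V → ℝ) : Fin k → V :=
  Classical.epsilon (IsOrthonormalFrame g)

/-- The vector dual to the linear form `l` with respect to the scalar product `g`:
`g (sharp k g l) w = l w`. -/
def sharp (k : ℕ) (g : V → V → ℝ) (l : V → ℝ) : V :=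
  ∑ i, l (orthonormalFrame k g i) • orthonormalFrame k g i

/-- The scalar product `⟨a, b⟩ = (1/2!) ∑ a(e_i, e_j) b(e_i, e_j)` of two-forms. -/
def formInner₂ (k : ℕ) (g : V → V → ℝ) (a b : V → V → ℝ) : ℝ :=
  (1 / 2) * ∑ i, ∑ j, a (orthonormalFrame k g i) (orthonormalFrame k g j) *
    b (orthonormalFrame k g i) (orthonormalFrame k g j)

/-- The scalar product `⟨a, b⟩ = (1/3!) ∑ a(e_i, e_j, e_l) b(e_i, e_j, e_l)` of three-forms. -/
def formInner₃ (k : ℕ) (g : V → V → ℝ) (a b : V → V → V → ℝ) : ℝ :=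
  (1 / 6) * ∑ i, ∑ j, ∑ l,
    a (orthonormalFrame k g i) (orthonormalFrame k g j) (orthonormalFrame k g l) *
    b (orthonormalFrame k g i) (orthonormalFrame k g j) (orthonormalFrame k g l)

/-- `I₍₁₎ b (x, y) = - b (I x, y)`. -/
def actFst (I : V → V) (b : V → V → ℝ) (x y : V) : ℝ := -b (I x) y

/-- `I₍₂₎ b (x, y) = - b (x, I y)`. -/
def actSnd (I : V → V) (b : V → V → ℝ) (x y : V) : ℝ := -b x (I y)

/-- `I b (x, y) = b (I x, I y)`. -/
def actBoth (I : V → V) (b : V → V → ℝ) (x y : V) : ℝ := b (I x) (I y)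

/-- The derivation action of an endomorphism on a covariant three-tensor. -/
def derivationAction (A : V → V) (t : V → V → V → ℝ) (x y z : V) : ℝ :=
  -t (A x) y z - t x (A y) z - t x y (A z)

end Algebra

/-! ### The Gray-Hervella modules of a six-dimensional special Hermitian vector space -/

section Modules

variable {V : Type*} [AddCommGroup V] [Module ℝ V]

/-- Covariant three-tensors. -/
abbrev Tensor₃ (V : Type*) [AddCommGroup V] [Module ℝ V] := V →ₗ[ℝ] V →ₗ[ℝ] V →ₗ[ℝ] ℝ

/-- Covariant four-tensors. -/
abbrev Tensor₄ (V : Type*) [AddCommGroup V] [Module ℝ V] := V →ₗ[ℝ] V →ₗ[ℝ] V →ₗ[ℝ] V →ₗ[ℝ] ℝ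

/-- The space `T* ⊗ 𝔲(3)^⊥` of tensors with the symmetries of `∇ω`. -/
def spaceW (I : V → V) : Submodule ℝ (Tensor₃ V) where
  carrier := {α | ∀ x y z, α x y z = -α x z y ∧ α x (I y) (I z) = -α x y z}
  add_mem' {a b} ha hb x y z := by
    obtain ⟨h₁, h₂⟩ := ha x y z
    obtain ⟨h₃, h₄⟩ := hb x y z
    simp only [LinearMap.add_apply]
    constructor <;> linarith
  zero_mem' x y z := by simp
  smul_mem' c a ha x y z := by
    obtain ⟨h₁, h₂⟩ := ha x y z
    simp only [LinearMap.smul_apply, smul_eq_mul]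
    exact ⟨by rw [h₁]; ring, by rw [h₂]; ring⟩

/-- The contraction `z ↦ ∑ α (e_i, e_i, z)`. -/
def traceForm (g : V → V → ℝ) (α : Tensor₃ V) (z : V) : ℝ :=
  ∑ i, α (orthonormalFrame 6 g i) (orthonormalFrame 6 g i) z

lemma traceForm_add (g : V → V → ℝ) (α β : Tensor₃ V) (z : V) :
    traceForm g (α + β) z = traceForm g α z + traceForm g β z := by
  simp [traceForm, Finset.sum_add_distrib]

lemma traceForm_smul (g : V → V → ℝ) (c : ℝ) (α : Tensor₃ V) (z : V) :
    traceForm g (c • α) z = c * traceForm g α z := by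
  simp [traceForm, Finset.mul_sum]

/-- `𝒲₁`: the tensors of `spaceW` with `α (x, x, z) = 0`. -/
def spaceW₁ (I : V → V) : Submodule ℝ (Tensor₃ V) where
  carrier := {α | α ∈ spaceW I ∧ ∀ x z, α x x z = 0}
  add_mem' {a b} ha hb := ⟨add_mem ha.1 hb.1, fun x z => by
    simp [ha.2 x z, hb.2 x z]⟩
  zero_mem' := ⟨zero_mem _, fun x z => by simp⟩
  smul_mem' c a ha := ⟨Submodule.smul_mem _ c ha.1, fun x z => by simp [ha.2 x z]⟩

/-- `𝒲₂`: the tensors of `spaceW` whose cyclic sum vanishes. -/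
def spaceW₂ (I : V → V) : Submodule ℝ (Tensor₃ V) where
  carrier := {α | α ∈ spaceW I ∧ ∀ x y z, α x y z + α y z x + α z x y = 0}
  add_mem' {a b} ha hb := ⟨add_mem ha.1 hb.1, fun x y z => by
    have h₁ := ha.2 x y z
    have h₂ := hb.2 x y z
    simp only [LinearMap.add_apply]
    linarith⟩
  zero_mem' := ⟨zero_mem _, fun x y z => by simp⟩
  smul_mem' c a ha := ⟨Submodule.smul_mem _ c ha.1, fun x y z => by
    have h₁ := ha.2 x y z
    simp only [LinearMap.smul_apply, smul_eq_mul]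
    rw [← mul_add, ← mul_add, h₁, mul_zero]⟩

/-- `𝒲₃`: the tensors of `spaceW` with `α (I x, I y, z) = α (x, y, z)` and zero contraction. -/
def spaceW₃ (g : V → V → ℝ) (I : V → V) : Submodule ℝ (Tensor₃ V) where
  carrier := {α | α ∈ spaceW I ∧ (∀ x y z, α (I x) (I y) z = α x y z) ∧
    ∀ z, traceForm g α z = 0}
  add_mem' {a b} ha hb := ⟨add_mem ha.1 hb.1, fun x y z => by
    simp [ha.2.1 x y z, hb.2.1 x y z], fun z => by
    rw [traceForm_add, ha.2.2, hb.2.2, add_zero]⟩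
  zero_mem' := ⟨zero_mem _, fun x y z => by simp, fun z => by simp [traceForm]⟩
  smul_mem' c a ha := ⟨Submodule.smul_mem _ c ha.1, fun x y z => by simp [ha.2.1 x y z],
    fun z => by rw [traceForm_smul, ha.2.2, mul_zero]⟩

/-- `𝒲₄`: the tensors of `spaceW` that are determined by their contraction; the constant is
`1 / (2 (n - 1))` in real dimension `2 n = 6`. -/
def spaceW₄ (g : V → V → ℝ) (I : V → V) : Submodule ℝ (Tensor₃ V) where
  carrier := {α | α ∈ spaceW I ∧ ∀ x y z, α x y z = (1 / 4) *
    (g x y * traceForm g α z - g x z * traceForm g α y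
      - g x (I y) * traceForm g α (I z) + g x (I z) * traceForm g α (I y))}
  add_mem' {a b} ha hb := ⟨add_mem ha.1 hb.1, fun x y z => by
    have h₁ := ha.2 x y z
    have h₂ := hb.2 x y z
    simp only [LinearMap.add_apply, traceForm_add]
    linarith⟩
  zero_mem' := ⟨zero_mem _, fun x y z => by simp [traceForm]⟩
  smul_mem' c a ha := ⟨Submodule.smul_mem _ c ha.1, fun x y z => by
    have h₁ := ha.2 x y z
    simp only [LinearMap.smul_apply, smul_eq_mul, traceForm_smul]
    rw [h₁]; ring⟩

/-- The bilinear form `r(α)(x, y) = ½ ⟨x ⌟ α, y ⌟ ψ₊⟩`. -/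
def rForm (g : V → V → ℝ) (ψp : V → V → V → ℝ) (α : V → V → V → ℝ) (x y : V) : ℝ :=
  (1 / 2) * formInner₂ 6 g (α x) (ψp y)

lemma rForm_add (g : V → V → ℝ) (ψp : V → V → V → ℝ) (a b : Tensor₃ V) (x y : V) :
    rForm g ψp (fun x y z => (a + b) x y z) x y =
      rForm g ψp (fun x y z => a x y z) x y + rForm g ψp (fun x y z => b x y z) x y := by
  simp only [rForm, formInner₂, LinearMap.add_apply, add_mul, Finset.sum_add_distrib, mul_add]

lemma rForm_smul (g : V → V → ℝ) (ψp : V → V → V → ℝ) (c : ℝ) (a : Tensor₃ V) (x y : V) :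
    rForm g ψp (fun x y z => (c • a) x y z) x y = c * rForm g ψp (fun x y z => a x y z) x y := by
  simp only [rForm, formInner₂, LinearMap.smul_apply, smul_eq_mul, mul_assoc, ← Finset.mul_sum]
  ring

/-- The elements `α` of `W` for which `r(α)` is symmetric (`ε = 1`) or skew-symmetric
(`ε = -1`). -/
def signPart (g : V → V → ℝ) (ψp : V → V → V → ℝ) (ε : ℝ) (W : Submodule ℝ (Tensor₃ V)) :
    Submodule ℝ (Tensor₃ V) where
  carrier := {α | α ∈ W ∧ ∀ x y, rForm g ψp (fun x y z => α x y z) x y =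
    ε * rForm g ψp (fun x y z => α x y z) y x}
  add_mem' {a b} ha hb := ⟨add_mem ha.1 hb.1, fun x y => by
    rw [rForm_add, rForm_add, ha.2 x y, hb.2 x y, mul_add]⟩
  zero_mem' := ⟨zero_mem _, fun x y => by simp [rForm, formInner₂]⟩
  smul_mem' c a ha := ⟨Submodule.smul_mem _ c ha.1, fun x y => by
    rw [rForm_smul, rForm_smul, ha.2 x y]; ring⟩

/-- Labels of the irreducible `SU(3)`-modules of intrinsic torsion. -/
inductive TorsionClass
  | W1plus | W1minus | W2plus | W2minus | W3 | W4 | W5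

/-- The irreducible summands of the space of intrinsic `SU(3)`-torsion tensors.  An intrinsic
torsion tensor `η + ξ` is encoded as the pair consisting of `-ξω` (which equals `∇ω`) in
`T* ⊗ 𝔲(3)^⊥` and of the one-form `η`. -/
def torsionModule (g : V → V → ℝ) (I : V → V) (ψp : V → V → V → ℝ) :
    TorsionClass → Submodule ℝ (Tensor₃ V × (V →ₗ[ℝ] ℝ))
  | .W1plus => (signPart g ψp 1 (spaceW₁ I)).prod ⊥
  | .W1minus => (signPart g ψp (-1) (spaceW₁ I)).prod ⊥
  | .W2plus => (signPart g ψp 1 (spaceW₂ I)).prod ⊥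
  | .W2minus => (signPart g ψp (-1) (spaceW₂ I)).prod ⊥
  | .W3 => (spaceW₃ g I).prod ⊥
  | .W4 => (spaceW₄ g I).prod ⊥
  | .W5 => (⊥ : Submodule ℝ (Tensor₃ V)).prod ⊤

end Modules

/-! ### Levi-Civita derivatives in charts -/

section LeviCivita

variable {k : ℕ} {M : Type*} [TopologicalSpace M] [ChartedSpace (EuclideanSpace ℝ (Fin k)) M]

/-- The coordinate frame of the preferred chart at `m`, as the isomorphism from the model space
onto the tangent space at the point with coordinates `x`.  At `m` itself it is the identification
of `T_m M` with the model space that is built into `TangentSpace`. -/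
def coordFrame (m : M) (x : EuclideanSpace ℝ (Fin k)) :
    EuclideanSpace ℝ (Fin k) →L[ℝ] TangentSpace (𝓡 k) ((extChartAt (𝓡 k) m).symm x) :=
  mfderiv 𝓘(ℝ, EuclideanSpace ℝ (Fin k)) (𝓡 k) (extChartAt (𝓡 k) m).symm x

/-- The derivative at `m`, in the direction `u`, of the components of a covariant two-tensor field
in the preferred chart at `m`. -/
def partial₂ (T : ∀ m : M, TangentSpace (𝓡 k) m → TangentSpace (𝓡 k) m → ℝ) (m : M)
    (u v w : TangentSpace (𝓡 k) m) : ℝ :=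
  fderiv ℝ (fun x : EuclideanSpace ℝ (Fin k) =>
    T ((extChartAt (𝓡 k) m).symm x) (coordFrame m x v) (coordFrame m x w))
    (extChartAt (𝓡 k) m m) u

/-- The derivative at `m`, in the direction `u`, of the components of a covariant three-tensor
field in the preferred chart at `m`. -/
def partial₃ (T : ∀ m : M, TangentSpace (𝓡 k) m → TangentSpace (𝓡 k) m →
    TangentSpace (𝓡 k) m → ℝ) (m : M) (u v w z : TangentSpace (𝓡 k) m) : ℝ :=
  fderiv ℝ (fun x : EuclideanSpace ℝ (Fin k) =>
    T ((extChartAt (𝓡 k) m).symm x) (coordFrame m x v) (coordFrame m x w) (coordFrame m x z))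
    (extChartAt (𝓡 k) m m) u

/-- The derivative at `m`, in the direction `u`, of the components of a field of endomorphisms in
the preferred chart at `m`. -/
def partialEnd (A : ∀ m : M, TangentSpace (𝓡 k) m → TangentSpace (𝓡 k) m) (m : M)
    (u v : TangentSpace (𝓡 k) m) : TangentSpace (𝓡 k) m :=
  fderiv ℝ (fun x : EuclideanSpace ℝ (Fin k) =>
    (coordFrame m x).inverse (A ((extChartAt (𝓡 k) m).symm x) (coordFrame m x v)))
    (extChartAt (𝓡 k) m m) u

/-- The Christoffel symbols `Γ(u, v)` at `m` of the metric `g` in the preferred chart at `m`. -/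
def christoffel (g : ∀ m : M, TangentSpace (𝓡 k) m → TangentSpace (𝓡 k) m → ℝ) (m : M)
    (u v : TangentSpace (𝓡 k) m) : TangentSpace (𝓡 k) m :=
  sharp k (g m) fun w => (1 / 2) *
    (partial₂ g m u v w + partial₂ g m v u w - partial₂ g m w u v)

/-- The Levi-Civita derivative `(∇_u T)(v, w)` of a covariant two-tensor field. -/
def nabla₂ (g : ∀ m : M, TangentSpace (𝓡 k) m → TangentSpace (𝓡 k) m → ℝ)
    (T : ∀ m : M, TangentSpace (𝓡 k) m → TangentSpace (𝓡 k) m → ℝ) (m : M)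
    (u v w : TangentSpace (𝓡 k) m) : ℝ :=
  partial₂ T m u v w - T m (christoffel g m u v) w - T m v (christoffel g m u w)

/-- The Levi-Civita derivative `(∇_u T)(v, w, z)` of a covariant three-tensor field. -/
def nabla₃ (g : ∀ m : M, TangentSpace (𝓡 k) m → TangentSpace (𝓡 k) m → ℝ)
    (T : ∀ m : M, TangentSpace (𝓡 k) m → TangentSpace (𝓡 k) m → TangentSpace (𝓡 k) m → ℝ) (m : M)
    (u v w z : TangentSpace (𝓡 k) m) : ℝ :=
  partial₃ T m u v w z - T m (christoffel g m u v) w z - T m v (christoffel g m u w) z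
    - T m v w (christoffel g m u z)

/-- The Levi-Civita derivative `(∇_u A) v` of a field of endomorphisms. -/
def nablaEnd (g : ∀ m : M, TangentSpace (𝓡 k) m → TangentSpace (𝓡 k) m → ℝ)
    (A : ∀ m : M, TangentSpace (𝓡 k) m → TangentSpace (𝓡 k) m) (m : M)
    (u v : TangentSpace (𝓡 k) m) : TangentSpace (𝓡 k) m :=
  partialEnd A m u v + christoffel g m u (A m v) - A m (christoffel g m u v)

end LeviCivita

/-! ### Special almost Hermitian six-manifolds -/

/-- The tensors of a special almost Hermitian six-manifold: the metric, the almost complex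
structure and the real and imaginary parts of the complex volume form. -/
structure SU3Tensors (M : Type*) [TopologicalSpace M]
    [ChartedSpace (EuclideanSpace ℝ (Fin 6)) M] where
  /-- the metric -/
  g : ∀ m : M, TangentSpace (𝓡 6) m → TangentSpace (𝓡 6) m → ℝ
  /-- the almost complex structure -/
  I : ∀ m : M, TangentSpace (𝓡 6) m → TangentSpace (𝓡 6) m
  /-- the real part of the complex volume form -/
  ψp : ∀ m : M, TangentSpace (𝓡 6) m → TangentSpace (𝓡 6) m → TangentSpace (𝓡 6) m → ℝ
  /-- the imaginary part of the complex volume form -/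
  ψm : ∀ m : M, TangentSpace (𝓡 6) m → TangentSpace (𝓡 6) m → TangentSpace (𝓡 6) m → ℝ

namespace SU3Tensors

variable {M : Type*} [TopologicalSpace M] [ChartedSpace (EuclideanSpace ℝ (Fin 6)) M]
  (S : SU3Tensors M)

/-- The Kähler form `ω(x, y) = ⟨x, I y⟩`. -/
def kaehlerForm (m : M) (x y : TangentSpace (𝓡 6) m) : ℝ := S.g m x (S.I m y)

/-- The tensor `∇ω`. -/
def nablaω (m : M) (x y z : TangentSpace (𝓡 6) m) : ℝ := nabla₂ S.g S.kaehlerForm m x y z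

/-- The `𝔲(3)^⊥`-part of the intrinsic torsion, `ξ_x y = -½ I (∇_x I) y`. -/
def ξ (m : M) (x y : TangentSpace (𝓡 6) m) : TangentSpace (𝓡 6) m :=
  (-(1 / 2 : ℝ)) • S.I m (nablaEnd S.g S.I m x y)

/-- The endomorphism `η_x y = (Iη)(x) I y` given by a one-form `η`, where `(Iη)(x) = -η(I x)`. -/
def etaEnd (m : M) (η : TangentSpace (𝓡 6) m →ₗ[ℝ] ℝ) (x y : TangentSpace (𝓡 6) m) :
    TangentSpace (𝓡 6) m :=
  (-η (S.I m x)) • S.I m y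

/-- The one-form `η` is the `𝒲₅`-part of the intrinsic torsion at `m`: the connection
`∇ + η + ξ` annihilates `ψ₊` and `ψ₋`. -/
def IsEta (m : M) (η : TangentSpace (𝓡 6) m →ₗ[ℝ] ℝ) : Prop :=
  ∀ x y z w : TangentSpace (𝓡 6) m,
    nabla₃ S.g S.ψp m x y z w + derivationAction (S.etaEnd m η x) (S.ψp m) y z w
      + derivationAction (S.ξ m x) (S.ψp m) y z w = 0 ∧
    nabla₃ S.g S.ψm m x y z w + derivationAction (S.etaEnd m η x) (S.ψm m) y z w
      + derivationAction (S.ξ m x) (S.ψm m) y z w = 0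

/-- The structure is of type `∑ 𝒲_c`, `c ∈ C`: at each point its intrinsic torsion lies in the sum
of the modules with labels in `C`. -/
def IsOfType (C : Set TorsionClass) : Prop :=
  ∀ m : M, ∃ τ ∈ ⨆ c ∈ C, torsionModule (S.g m) (S.I m) (S.ψp m) c,
    (∀ x y z, τ.1 x y z = S.nablaω m x y z) ∧ S.IsEta m τ.2

end SU3Tensors

/-! ### `G₂`-structures -/

/-- `e` is a Cayley frame: it is orthonormal and `φ = ∑ e_i ∧ e_{i+1} ∧ e_{i+3}`, indices mod 7. -/
def IsCayleyFrame {V : Type*} (g : V → V → ℝ) (φ : V → V → V → ℝ) (e : Fin 7 → V) : Prop :=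
  (∀ i j, g (e i) (e j) = if i = j then 1 else 0) ∧
  ∀ x y z, φ x y z = ∑ i : Fin 7,
    Matrix.det (Matrix.of fun a b : Fin 3 => g (e (i + ![0, 1, 3] a)) (![x, y, z] b))

/-- A `G₂`-structure: a Riemannian metric together with a smooth three-form that has a Cayley frame
at each point (that `φ p` is trilinear and alternating follows from `exists_cayleyFrame`). -/
structure G2Structure (N : Type*) [TopologicalSpace N]
    [ChartedSpace (EuclideanSpace ℝ (Fin 7)) N] [IsManifold (𝓡 7) ∞ N] where
  /-- the Riemannian metric -/
  metric : ContMDiffRiemannianMetric (𝓡 7) ∞ (EuclideanSpace ℝ (Fin 7))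
    (fun p : N => TangentSpace (𝓡 7) p)
  /-- the fundamental three-form -/
  φ : ∀ p : N, TangentSpace (𝓡 7) p → TangentSpace (𝓡 7) p → TangentSpace (𝓡 7) p → ℝ
  /-- the components of `φ` in the charts are smooth -/
  φ_smooth : ∀ (p : N) (u v w : EuclideanSpace ℝ (Fin 7)), ContDiffOn ℝ ∞
    (fun x => φ ((extChartAt (𝓡 7) p).symm x) (coordFrame p x u) (coordFrame p x v)
      (coordFrame p x w)) (extChartAt (𝓡 7) p).target
  exists_cayleyFrame : ∀ p, ∃ e : Fin 7 → TangentSpace (𝓡 7) p,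
    IsCayleyFrame (fun x y => metric.inner p x y) (φ p) e

namespace G2Structure

variable {N : Type*} [TopologicalSpace N] [ChartedSpace (EuclideanSpace ℝ (Fin 7)) N]
  [IsManifold (𝓡 7) ∞ N] (G : G2Structure N)

/-- The metric. -/
def g (p : N) (x y : TangentSpace (𝓡 7) p) : ℝ := G.metric.inner p x y

/-- A Cayley frame at `p`. -/
def cayleyFrame (p : N) : Fin 7 → TangentSpace (𝓡 7) p := (G.exists_cayleyFrame p).choose

/-- The four-form `*φ = -∑ e_{i+2} ∧ e_{i+4} ∧ e_{i+5} ∧ e_{i+6}` (in any Cayley frame): the Hodge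
dual of `φ` for the volume form `e_0 ∧ … ∧ e_6`. -/
def starφ (p : N) (x y z u : TangentSpace (𝓡 7) p) : ℝ :=
  -∑ i : Fin 7, Matrix.det (Matrix.of fun a b : Fin 4 =>
    G.g p (G.cayleyFrame p (i + ![2, 4, 5, 6] a)) (![x, y, z, u] b))

/-- The Levi-Civita derivative of `φ`. -/
def nablaφ (p : N) (w x y z : TangentSpace (𝓡 7) p) : ℝ :=
  nabla₃ G.g G.φ p w x y z

/-- The bilinear form `r̄(φ)(x, y) = ¼ ⟨x ⌟ ∇φ, y ⌟ *φ⟩`. -/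
def rbar (p : N) (x y : TangentSpace (𝓡 7) p) : ℝ :=
  (1 / 4) * formInner₃ 7 (G.g p) (G.nablaφ p x) (G.starφ p y)

/-- The elements of the group `G₂` of the tangent space at `p`: the elements of the special
orthogonal group that preserve `φ`. -/
def IsG2Element (p : N) (A : TangentSpace (𝓡 7) p ≃ₗ[ℝ] TangentSpace (𝓡 7) p) : Prop :=
  (∀ x y, G.g p (A x) (A y) = G.g p x y) ∧
  LinearMap.det (A : TangentSpace (𝓡 7) p →ₗ[ℝ] TangentSpace (𝓡 7) p) = 1 ∧
  ∀ x y z, G.φ p (A x) (A y) (A z) = G.φ p x y z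

/-- The space `𝒳 = T* ⊗ 𝔤₂^⊥` of covariant derivatives of the fundamental form, where
`𝔤₂^⊥ = {v ⌟ *φ}`. -/
def spaceX (p : N) : Set (Tensor₄ (TangentSpace (𝓡 7) p)) :=
  {α | ∃ L : TangentSpace (𝓡 7) p →ₗ[ℝ] TangentSpace (𝓡 7) p,
    ∀ w x y z, α w x y z = G.starφ p (L w) x y z}

/-- A space of four-tensors is invariant under the action of `G₂`. -/
def IsG2Invariant (p : N) (W : Submodule ℝ (Tensor₄ (TangentSpace (𝓡 7) p))) : Prop :=
  ∀ A, G.IsG2Element p A → ∀ α ∈ W, ∀ β : Tensor₄ (TangentSpace (𝓡 7) p),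
    (∀ w x y z, β w x y z = α (A w) (A x) (A y) (A z)) → β ∈ W

/-- `W` is an irreducible `G₂`-module. -/
def IsG2Irreducible (p : N) (W : Submodule ℝ (Tensor₄ (TangentSpace (𝓡 7) p))) : Prop :=
  G.IsG2Invariant p W ∧ W ≠ ⊥ ∧ ∀ W' ≤ W, G.IsG2Invariant p W' → W' = ⊥ ∨ W' = W

/-- `𝒳₃`: the `27`-dimensional irreducible `G₂`-submodule of `𝒳`.  The four irreducible summands
of `𝒳` have dimensions `1`, `14`, `27` and `7`, so there is exactly one such submodule. -/
def spaceX₃ (p : N) : Submodule ℝ (Tensor₄ (TangentSpace (𝓡 7) p)) :=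
  sSup {W | (∀ α ∈ W, α ∈ G.spaceX p) ∧ G.IsG2Irreducible p W ∧ Module.finrank ℝ W = 27}

/-- The `G₂`-structure is of type `𝒳₃`. -/
def IsTypeX₃ : Prop :=
  ∀ p : N, ∃ α ∈ G.spaceX₃ p, ∀ w x y z, α w x y z = G.nablaφ p w x y z

end G2Structure

/-! ### Orientable hypersurfaces -/

/-- A hypersurface `ι : M → N` with a unit normal vector field `n`. -/
structure Hypersurface {N : Type*} [TopologicalSpace N]
    [ChartedSpace (EuclideanSpace ℝ (Fin 7)) N] [IsManifold (𝓡 7) ∞ N] (G : G2Structure N)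
    (M : Type*) [TopologicalSpace M] [ChartedSpace (EuclideanSpace ℝ (Fin 6)) M]
    [IsManifold (𝓡 6) ∞ M] where
  /-- the immersion of the hypersurface -/
  ι : M → N
  ι_smooth : ContMDiff (𝓡 6) (𝓡 7) ∞ ι
  ι_immersion : ∀ m, Function.Injective (mfderiv (𝓡 6) (𝓡 7) ι m)
  /-- the unit normal vector field -/
  n : ∀ m : M, TangentSpace (𝓡 7) (ι m)
  n_smooth : ContMDiff (𝓡 6) (𝓡 7).tangent ∞ (fun m => (⟨ι m, n m⟩ : TangentBundle (𝓡 7) N))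
  n_unit : ∀ m, G.g (ι m) (n m) (n m) = 1
  n_normal : ∀ m (x : TangentSpace (𝓡 6) m), G.g (ι m) (n m) (mfderiv (𝓡 6) (𝓡 7) ι m x) = 0

namespace Hypersurface

variable {N : Type*} [TopologicalSpace N] [ChartedSpace (EuclideanSpace ℝ (Fin 7)) N]
  [IsManifold (𝓡 7) ∞ N] {G : G2Structure N} {M : Type*} [TopologicalSpace M]
  [ChartedSpace (EuclideanSpace ℝ (Fin 6)) M] [IsManifold (𝓡 6) ∞ M] (X : Hypersurface G M)

/-- The push-forward `ι_*`. -/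
def push (m : M) (x : TangentSpace (𝓡 6) m) : TangentSpace (𝓡 7) (X.ι m) :=
  mfderiv (𝓡 6) (𝓡 7) X.ι m x

/-- The induced metric. -/
def g (m : M) (x y : TangentSpace (𝓡 6) m) : ℝ := G.g (X.ι m) (X.push m x) (X.push m y)

/-- The induced almost complex structure: `I x = P(n, x)`, i.e. `⟨I x, y⟩ = φ(n, x, y)`. -/
def I (m : M) (x : TangentSpace (𝓡 6) m) : TangentSpace (𝓡 6) m :=
  sharp 6 (X.g m) fun y => G.φ (X.ι m) (X.n m) (X.push m x) (X.push m y)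

/-- The three-form `ι^*φ`. -/
def pullφ (m : M) (x y z : TangentSpace (𝓡 6) m) : ℝ :=
  G.φ (X.ι m) (X.push m x) (X.push m y) (X.push m z)

/-- The three-form `ι^*(n ⌟ *φ)`. -/
def pullStarφ (m : M) (x y z : TangentSpace (𝓡 6) m) : ℝ :=
  G.starφ (X.ι m) (X.n m) (X.push m x) (X.push m y) (X.push m z)

/-- The special almost Hermitian structure induced on the hypersurface by the function `θ`. -/
def su3 (θ : M → ℝ) : SU3Tensors M where
  g := X.g
  I := X.I
  ψp m x y z := Real.cos (θ m) * X.pullφ m x y z - Real.sin (θ m) * X.pullStarφ m x y z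
  ψm m x y z := Real.sin (θ m) * X.pullφ m x y z + Real.cos (θ m) * X.pullStarφ m x y z

/-- The second derivative of `ι` in the preferred charts at `m` and `ι m`. -/
def hessian (m : M) (x y : TangentSpace (𝓡 6) m) : TangentSpace (𝓡 7) (X.ι m) :=
  fderiv ℝ (fderiv ℝ (writtenInExtChartAt (𝓡 6) (𝓡 7) m X.ι)) (extChartAt (𝓡 6) m m) x y

/-- The shape tensor `II(x, y)`, the difference between the Levi-Civita derivatives of `N` and of
`M`. -/
def shapeTensor (m : M) (x y : TangentSpace (𝓡 6) m) : TangentSpace (𝓡 7) (X.ι m) :=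
  X.hessian m x y + christoffel G.g (X.ι m) (X.push m x) (X.push m y)
    - X.push m (christoffel X.g m x y)

/-- The second fundamental form `B(x, y) = ⟨II(x, y), n⟩`. -/
def B (m : M) (x y : TangentSpace (𝓡 6) m) : ℝ :=
  G.g (X.ι m) (X.shapeTensor m x y) (X.n m)

/-- The mean curvature vector `H = (1/6) ∑ II(e_i, e_i)`. -/
def meanCurvature (m : M) : TangentSpace (𝓡 7) (X.ι m) :=
  (1 / 6 : ℝ) • ∑ i, X.shapeTensor m (orthonormalFrame 6 (X.g m) i) (orthonormalFrame 6 (X.g m) i)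

/-- `h = ⟨H, n⟩`. -/
def h (m : M) : ℝ := G.g (X.ι m) (X.meanCurvature m) (X.n m)

/-- The hypersurface is a minimal variety. -/
def IsMinimal : Prop := ∀ m, X.meanCurvature m = 0

/-- The bilinear form `ι^* r̄(φ)`. -/
def pullRbar (m : M) (x y : TangentSpace (𝓡 6) m) : ℝ :=
  G.rbar (X.ι m) (X.push m x) (X.push m y)

/-- The function `r̄(φ)(n, n)`. -/
def rbarNormal (m : M) : ℝ := G.rbar (X.ι m) (X.n m) (X.n m)

end Hypersurface

end

/-! The type of the `G₂`-structure is first turned into linear algebra. At each point `∇̄φ` has the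
form `x ↦ L x ⌟ *φ` for an endomorphism `L`, and because `⟨v ⌟ *φ, w ⌟ *φ⟩ = 4 ⟨v, w⟩`
(`IsG2.formInner₃_σ`) one has `r̄(φ)(x, y) = ⟨L x, y⟩`. On a `27`-dimensional irreducible submodule
of `𝒳` the equivariant maps to the skew part of `L` (dimension `21`) and to its trace (dimension
`1`) have nonzero kernels, which are everything by irreducibility. So `L` is symmetric and
trace-free for type `𝒳₃` (`IsTypeX₃.exists_endomorphism`).

On the hypersurface put `ψ₀ = ι^*φ`. Then `ι^*(n ⌟ *φ) = -ψ₀(I ·, ·, ·)`, so `ψ₊` and `ψ₋` arise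
from `ψ₀` by a change of phase, and `ω = -ι^*(n ⌟ φ)`. The Gauss and Weingarten formulas, obtained
by differentiating in charts, give `∇_u ω = (S - I Λ) u ⌟ ψ₀` with `S` the shape operator and `Λ`
the tangential part of `L` (`nabla₂_pullNormalφ_eq`). Written with `ψ₊` this is `∇_u ω = R u ⌟ ψ₊`,
and `r(∇ω)(x, y) = ⟨R x, y⟩` is the explicit form `torsionForm` in `B` and `ι^* r̄(φ)`. The
derivative of `ψ₀` under `∇ + ξ` only sees the normal part of `L` (`nabla₃_pullφ_add`); with the
derivative of the phase this gives `3 η(I x) = r̄(φ)(x, n) - dθ(x)` (`isEta_iff`).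

Tensors with the symmetries of `∇ω` correspond to endomorphisms `R`: `𝒲₁⁺` and `𝒲₁⁻` to multiples of
the identity and of `I`; `𝒲₂⁺` and `𝒲₂⁻` to symmetric and skew `R` commuting with `I`, with `R` and
`I R` trace-free; `𝒲₃` to symmetric `R` anticommuting with `I`. The skew anticommuting `R` belong to
`𝒲₄`; they are absent here because `B` and `r̄(φ)` are symmetric. Membership in a sum of the
remaining modules is the vanishing of the missing components (`mem_iSup_torsion_iff`), which
`formComponent_eq_zero_iff` evaluates, using that `B` has trace `6 h` and `ι^* r̄(φ)` has trace
`-r̄(φ)(n, n)`. Where both signs of a module are missing, the two conditions are a rotation through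
`θ` of a pair of equations free of `θ`. -/

noncomputable section

/-! ### Scalar products, orthonormal frames and multilinear forms. -/

section Frames

variable {V : Type*} [AddCommGroup V] [Module ℝ V]

/-- `g` is a scalar product on a real vector space of dimension `k`. -/
structure IsScalarProduct (k : ℕ) (g : V →ₗ[ℝ] V →ₗ[ℝ] ℝ) : Prop where
  finrank : Module.finrank ℝ V = k
  finite : FiniteDimensional ℝ V
  symm : ∀ x y, g x y = g y x
  pos : ∀ x, x ≠ 0 → 0 < g x x

/-- The orthonormality of a frame, for a bundled bilinear form. -/
abbrev IsONFrame {k : ℕ} (g : V →ₗ[ℝ] V →ₗ[ℝ] ℝ) (e : Fin k → V) : Prop :=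
  IsOrthonormalFrame (fun x y => g x y) e

variable {k : ℕ} {g : V →ₗ[ℝ] V →ₗ[ℝ] ℝ}

namespace IsScalarProduct

theorem eq_of_inner_left (hg : IsScalarProduct k g) {x y : V} (h : ∀ z, g x z = g y z) :
    x = y := by
  by_contra hne
  have h₁ := hg.pos (x - y) (sub_ne_zero.2 hne)
  rw [map_sub g, LinearMap.sub_apply, h, sub_self] at h₁
  exact lt_irrefl _ h₁

theorem exists_frame (hg : IsScalarProduct k g) : ∃ e : Fin k → V, IsONFrame g e := by
  have := hg.finite
  -- `g` becomes a local inner product, so that `stdOrthonormalBasis` provides the frame.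
  let c : InnerProductSpace.Core ℝ V :=
    { inner := fun x y => g x y
      conj_inner_symm := fun x y => by simpa using hg.symm y x
      re_inner_nonneg := fun x => by
        by_cases hx : x = 0
        · simp [hx]
        · simpa using (hg.pos x hx).le
      add_left := fun x y z => by simp
      smul_left := fun x y r => by simp
      definite := fun x hx => by
        by_contra hne
        exact (hg.pos x hne).ne' hx }
  let _ : NormedAddCommGroup V := c.toNormedAddCommGroup
  let _ : InnerProductSpace ℝ V := InnerProductSpace.ofCore c.toCore
  refine ⟨(stdOrthonormalBasis ℝ V).reindex (finCongr hg.finrank), fun i j => ?_⟩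
  have := orthonormal_iff_ite.1
    ((stdOrthonormalBasis ℝ V).reindex (finCongr hg.finrank)).orthonormal i j
  exact this

theorem orthonormalFrame_spec (hg : IsScalarProduct k g) :
    IsONFrame g (orthonormalFrame k fun x y => g x y) :=
  Classical.epsilon_spec hg.exists_frame

theorem sum_frame (hg : IsScalarProduct k g) {e : Fin k → V} (he : IsONFrame g e) (x : V) :
    ∑ i, g (e i) x • e i = x := by
  have := hg.finite
  have hli : LinearIndependent ℝ e := by
    rw [Fintype.linearIndependent_iff]
    intro c hc j
    have h := congrArg (g (e j)) hc
    simpa [he j, map_sum] using h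
  have hspan := hli.span_eq_top_of_card_eq_finrank' (by simp [hg.finrank])
  have hx : x ∈ Submodule.span ℝ (Set.range e) := hspan ▸ Submodule.mem_top
  obtain ⟨c, rfl⟩ := (Submodule.mem_span_range_iff_exists_fun ℝ).1 hx
  refine Finset.sum_congr rfl fun i _ => ?_
  congr 1
  rw [map_sum]
  simp [he i]

/-- The rule by which contractions are evaluated below: an index that occurs once in a linear form
and once in a scalar product disappears. -/
theorem sum_inner_mul (hg : IsScalarProduct k g) {e : Fin k → V} (he : IsONFrame g e)
    (l : V →ₗ[ℝ] ℝ) (x : V) : ∑ i, l (e i) * g x (e i) = l x := by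
  conv_rhs => rw [← hg.sum_frame he x, map_sum]
  exact Finset.sum_congr rfl fun i _ => by rw [map_smul, smul_eq_mul, mul_comm, hg.symm]

theorem inner_eq_sum (hg : IsScalarProduct k g) {e : Fin k → V} (he : IsONFrame g e)
    (x y : V) : g x y = ∑ i, g (e i) x * g (e i) y := by
  rw [← hg.sum_inner_mul he (g x) y]
  exact Finset.sum_congr rfl fun i _ => by rw [hg.symm x, hg.symm y]

/-- The contraction of a bilinear form does not depend on the orthonormal frame. -/
theorem sum_diag_eq (hg : IsScalarProduct k g) {e f : Fin k → V} (he : IsONFrame g e)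
    (hf : IsONFrame g f) (b : V →ₗ[ℝ] V →ₗ[ℝ] ℝ) : ∑ i, b (e i) (e i) = ∑ i, b (f i) (f i) := by
  have h₁ : ∀ i, b (e i) (e i) = ∑ j, b (f j) (e i) * g (e i) (f j) := fun i =>
    (hg.sum_inner_mul hf (b.flip (e i)) (e i)).symm
  have h₂ : ∀ j, b (f j) (f j) = ∑ i, b (f j) (e i) * g (f j) (e i) := fun j =>
    (hg.sum_inner_mul he (b (f j)) (f j)).symm
  simp only [h₁, h₂]
  rw [Finset.sum_comm]
  exact Finset.sum_congr rfl fun j _ => Finset.sum_congr rfl fun i _ => by rw [hg.symm]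

theorem sharp_spec (hg : IsScalarProduct k g) (l : V →ₗ[ℝ] ℝ) (w : V) :
    g (sharp k (fun x y => g x y) fun x => l x) w = l w := by
  rw [← hg.sum_inner_mul hg.orthonormalFrame_spec l w, sharp]
  simp [map_sum, hg.symm w]

theorem inner_sum_frame (hg : IsScalarProduct k g) {e : Fin k → V} (he : IsONFrame g e)
    (l : V →ₗ[ℝ] ℝ) (w : V) : g (∑ i, l (e i) • e i) w = l w := by
  rw [← hg.sum_inner_mul he l w]
  simp [map_sum, hg.symm w]

theorem sum_diag_self (_hg : IsScalarProduct k g) {e : Fin k → V} (he : IsONFrame g e) :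
    ∑ i, g (e i) (e i) = k := by
  simp [he _ _]

/-- An isometry maps orthonormal frames to orthonormal frames. -/
theorem _root_.IsOrthonormalFrame.map {e : Fin k → V} (he : IsONFrame g e) (A : V →ₗ[ℝ] V)
    (hA : ∀ x y, g (A x) (A y) = g x y) : IsONFrame g fun i => A (e i) := fun i j => by
  simpa [hA] using he i j

end IsScalarProduct

/-- A trilinear form from a function that is linear in each variable. -/
def Tensor₃.mk (f : V → V → V → ℝ) (h₁ : ∀ y z, IsLinearMap ℝ fun x => f x y z)
    (h₂ : ∀ x z, IsLinearMap ℝ fun y => f x y z) (h₃ : ∀ x y, IsLinearMap ℝ fun z => f x y z) :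
    Tensor₃ V where
  toFun x :=
    { toFun := fun y => (h₃ x y).mk'
      map_add' := fun a b => by ext z; exact (h₂ x z).1 a b
      map_smul' := fun c a => by ext z; exact (h₂ x z).2 c a }
  map_add' a b := by ext y z; exact (h₁ y z).1 a b
  map_smul' c a := by ext y z; exact (h₁ y z).2 c a

@[simp] theorem Tensor₃.mk_apply (f : V → V → V → ℝ) (h₁ h₂ h₃) (x y z : V) :
    Tensor₃.mk f h₁ h₂ h₃ x y z = f x y z := rfl

/-- A four-linear form from a function that is linear in each variable. -/
def Tensor₄.mk (f : V → V → V → V → ℝ) (h₁ : ∀ y z w, IsLinearMap ℝ fun x => f x y z w)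
    (h₂ : ∀ x z w, IsLinearMap ℝ fun y => f x y z w)
    (h₃ : ∀ x y w, IsLinearMap ℝ fun z => f x y z w)
    (h₄ : ∀ x y z, IsLinearMap ℝ fun w => f x y z w) : Tensor₄ V where
  toFun x := Tensor₃.mk (f x) (h₂ x) (h₃ x) (h₄ x)
  map_add' a b := by ext y z w; exact (h₁ y z w).1 a b
  map_smul' c a := by ext y z w; exact (h₁ y z w).2 c a

@[simp] theorem Tensor₄.mk_apply (f : V → V → V → V → ℝ) (h₁ h₂ h₃ h₄) (x y z w : V) :
    Tensor₄.mk f h₁ h₂ h₃ h₄ x y z w = f x y z w := rfl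

end Frames

/-! ### The linear algebra of a `G₂`-structure. -/

section G2Algebra

variable {V : Type*} [AddCommGroup V] [Module ℝ V]

/-- The pointwise algebraic data of a `G₂`-structure: a scalar product, the fundamental three-form
and its Hodge dual. -/
structure IsG2 (g : V →ₗ[ℝ] V →ₗ[ℝ] ℝ) (φ : Tensor₃ V) (σ : Tensor₄ V) : Prop
    extends IsScalarProduct 7 g where
  φ_swap₁₂ : ∀ x y z, φ x y z = -φ y x z
  φ_swap₂₃ : ∀ x y z, φ x y z = -φ x z y
  σ_swap₁₂ : ∀ x y z w, σ x y z w = -σ y x z w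
  σ_swap₂₃ : ∀ x y z w, σ x y z w = -σ x z y w
  σ_swap₃₄ : ∀ x y z w, σ x y z w = -σ x y w z
  -- All identities of `G₂`- and `SU(3)`-algebra below follow from this contraction, which also
  -- shows that `σ` is determined by `g` and `φ`.
  contraction : ∀ e : Fin 7 → V, IsONFrame g e → ∀ x y z w,
    ∑ i, φ (e i) x y * φ (e i) z w = g x z * g y w - g x w * g y z - σ x y z w

/-- The three-form with Cayley frame `e`. -/
def cayleyForm (g : V →ₗ[ℝ] V →ₗ[ℝ] ℝ) (e : Fin 7 → V) : Tensor₃ V :=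
  Tensor₃.mk (fun x y z => ∑ i : Fin 7,
      Matrix.det (Matrix.of fun a b : Fin 3 => g (e (i + ![0, 1, 3] a)) (![x, y, z] b)))
    (fun y z => by
      constructor <;> intros <;>
        simp only [← Finset.sum_add_distrib, Finset.smul_sum] <;>
        refine Finset.sum_congr rfl fun i _ => ?_ <;>
        simp [Matrix.det_fin_three] <;> ring)
    (fun y z => by
      constructor <;> intros <;>
        simp only [← Finset.sum_add_distrib, Finset.smul_sum] <;>
        refine Finset.sum_congr rfl fun i _ => ?_ <;>
        simp [Matrix.det_fin_three] <;> ring)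
    (fun y z => by
      constructor <;> intros <;>
        simp only [← Finset.sum_add_distrib, Finset.smul_sum] <;>
        refine Finset.sum_congr rfl fun i _ => ?_ <;>
        simp [Matrix.det_fin_three] <;> ring)

theorem det_fin_four (A : Matrix (Fin 4) (Fin 4) ℝ) : A.det =
    A 0 0 * (A 1 1 * (A 2 2 * A 3 3 - A 2 3 * A 3 2) - A 1 2 * (A 2 1 * A 3 3 - A 2 3 * A 3 1)
      + A 1 3 * (A 2 1 * A 3 2 - A 2 2 * A 3 1))
    - A 0 1 * (A 1 0 * (A 2 2 * A 3 3 - A 2 3 * A 3 2) - A 1 2 * (A 2 0 * A 3 3 - A 2 3 * A 3 0)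
      + A 1 3 * (A 2 0 * A 3 2 - A 2 2 * A 3 0))
    + A 0 2 * (A 1 0 * (A 2 1 * A 3 3 - A 2 3 * A 3 1) - A 1 1 * (A 2 0 * A 3 3 - A 2 3 * A 3 0)
      + A 1 3 * (A 2 0 * A 3 1 - A 2 1 * A 3 0))
    - A 0 3 * (A 1 0 * (A 2 1 * A 3 2 - A 2 2 * A 3 1) - A 1 1 * (A 2 0 * A 3 2 - A 2 2 * A 3 0)
      + A 1 2 * (A 2 0 * A 3 1 - A 2 1 * A 3 0)) := by
  rw [Matrix.det_succ_row_zero]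
  simp [Fin.sum_univ_four, Matrix.det_fin_three, Fin.succAbove]
  ring

/-- The four-form with Cayley frame `e`. -/
def cayleyStar (g : V →ₗ[ℝ] V →ₗ[ℝ] ℝ) (e : Fin 7 → V) : Tensor₄ V :=
  Tensor₄.mk (fun x y z u => -∑ i : Fin 7,
      Matrix.det (Matrix.of fun a b : Fin 4 => g (e (i + ![2, 4, 5, 6] a)) (![x, y, z, u] b)))
    (fun y z u => by
      constructor <;> intros <;>
        simp only [← Finset.sum_add_distrib, Finset.smul_sum, ← Finset.sum_neg_distrib] <;>
        refine Finset.sum_congr rfl fun i _ => ?_ <;>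
        simp [det_fin_four] <;> ring)
    (fun y z u => by
      constructor <;> intros <;>
        simp only [← Finset.sum_add_distrib, Finset.smul_sum, ← Finset.sum_neg_distrib] <;>
        refine Finset.sum_congr rfl fun i _ => ?_ <;>
        simp [det_fin_four] <;> ring)
    (fun y z u => by
      constructor <;> intros <;>
        simp only [← Finset.sum_add_distrib, Finset.smul_sum, ← Finset.sum_neg_distrib] <;>
        refine Finset.sum_congr rfl fun i _ => ?_ <;>
        simp [det_fin_four] <;> ring)
    (fun y z u => by
      constructor <;> intros <;>
        simp only [← Finset.sum_add_distrib, Finset.smul_sum, ← Finset.sum_neg_distrib] <;>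
        refine Finset.sum_congr rfl fun i _ => ?_ <;>
        simp [det_fin_four] <;> ring)

/-- In coordinates of a Cayley frame, with `X`, `Y`, `Z`, `W` the coordinate vectors and `c` the
identity matrix, the contraction is a polynomial identity, checked by expanding the determinants. -/
theorem cayley_contraction (c : Fin 7 → Fin 7 → ℝ) (hc : ∀ i j, c i j = if i = j then 1 else 0)
    (X Y Z W : Fin 7 → ℝ) :
    ∑ j : Fin 7,
      (∑ i : Fin 7, Matrix.det (Matrix.of fun a b : Fin 3 =>
        ![fun i => c i j, X, Y] b (i + ![0, 1, 3] a))) *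
      (∑ i : Fin 7, Matrix.det (Matrix.of fun a b : Fin 3 =>
        ![fun i => c i j, Z, W] b (i + ![0, 1, 3] a))) =
    (∑ i, X i * Z i) * (∑ i, Y i * W i) - (∑ i, X i * W i) * (∑ i, Y i * Z i) -
      -∑ i : Fin 7, Matrix.det (Matrix.of fun a b : Fin 4 =>
        ![X, Y, Z, W] b (i + ![2, 4, 5, 6] a)) := by
  simp only [Matrix.det_fin_three, det_fin_four, Matrix.of_apply, Matrix.cons_val, hc]
  simp only [Fin.sum_univ_seven, Fin.isValue, Fin.reduceAdd, Fin.reduceEq, if_true, if_false]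
  ring

theorem isG2_of_frame {g : V →ₗ[ℝ] V →ₗ[ℝ] ℝ} (hg : IsScalarProduct 7 g) {e : Fin 7 → V}
    (he : IsONFrame g e) : IsG2 g (cayleyForm g e) (cayleyStar g e) where
  toIsScalarProduct := hg
  φ_swap₁₂ x y z := by
    simp only [cayleyForm, Tensor₃.mk_apply, ← Finset.sum_neg_distrib]
    refine Finset.sum_congr rfl fun i _ => ?_
    simp [Matrix.det_fin_three]; ring
  φ_swap₂₃ x y z := by
    simp only [cayleyForm, Tensor₃.mk_apply, ← Finset.sum_neg_distrib]
    refine Finset.sum_congr rfl fun i _ => ?_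
    simp [Matrix.det_fin_three]; ring
  σ_swap₁₂ x y z w := by
    simp only [cayleyStar, Tensor₄.mk_apply, ← Finset.sum_neg_distrib]
    refine Finset.sum_congr rfl fun i _ => ?_
    simp [det_fin_four]; ring
  σ_swap₂₃ x y z w := by
    simp only [cayleyStar, Tensor₄.mk_apply, ← Finset.sum_neg_distrib]
    refine Finset.sum_congr rfl fun i _ => ?_
    simp [det_fin_four]; ring
  σ_swap₃₄ x y z w := by
    simp only [cayleyStar, Tensor₄.mk_apply, ← Finset.sum_neg_distrib]
    refine Finset.sum_congr rfl fun i _ => ?_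
    simp [det_fin_four]; ring
  contraction f hf x y z w := by
    -- The contraction over any frame `f` is the trace of `(u, v) ↦ φ(u, x, y) φ(v, z, w)`, so it
    -- may be computed in the Cayley frame.
    have hb := hg.sum_diag_eq hf he
      (((LinearMap.mul ℝ ℝ).compl₁₂ (((cayleyForm g e).flip x).flip y)
        (((cayleyForm g e).flip z).flip w)))
    simp only [LinearMap.compl₁₂_apply, LinearMap.flip_apply, LinearMap.mul_apply'] at hb
    rw [hb]
    have := cayley_contraction (fun i j => g (e i) (e j)) he (fun i => g (e i) x)
      (fun i => g (e i) y) (fun i => g (e i) z) (fun i => g (e i) w)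
    rw [hg.inner_eq_sum he x z, hg.inner_eq_sum he y w, hg.inner_eq_sum he x w,
      hg.inner_eq_sum he y z]
    simp only [cayleyForm, cayleyStar, Tensor₃.mk_apply, Tensor₄.mk_apply]
    have h₃ : ∀ (a b c : V) (i : Fin 7), (Matrix.of fun j k : Fin 3 =>
        g (e (i + ![0, 1, 3] j)) (![a, b, c] k)) = Matrix.of fun j k : Fin 3 =>
        ![fun i => g (e i) a, fun i => g (e i) b, fun i => g (e i) c] k (i + ![0, 1, 3] j) := by
      intro a b c i; ext j k; fin_cases k <;> rfl
    have h₄ : ∀ (a b c d : V) (i : Fin 7), (Matrix.of fun j k : Fin 4 =>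
        g (e (i + ![2, 4, 5, 6] j)) (![a, b, c, d] k)) = Matrix.of fun j k : Fin 4 =>
        ![fun i => g (e i) a, fun i => g (e i) b, fun i => g (e i) c, fun i => g (e i) d] k
          (i + ![2, 4, 5, 6] j) := by
      intro a b c d i; ext j k; fin_cases k <;> rfl
    simp only [h₃, h₄]
    exact this

end G2Algebra

section Comap

variable {V W : Type*} [AddCommGroup V] [Module ℝ V] [AddCommGroup W] [Module ℝ W]

/-- The pull-back of a trilinear form. -/
def Tensor₃.comap (φ : Tensor₃ V) (j : W →ₗ[ℝ] V) : Tensor₃ W :=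
  Tensor₃.mk (fun x y z => φ (j x) (j y) (j z)) (fun _ _ => ⟨by simp, by simp⟩)
    (fun _ _ => ⟨by simp, by simp⟩) (fun _ _ => ⟨by simp, by simp⟩)

@[simp] theorem Tensor₃.comap_apply (φ : Tensor₃ V) (j : W →ₗ[ℝ] V) (x y z : W) :
    φ.comap j x y z = φ (j x) (j y) (j z) := rfl

end Comap

/-! ### Contractions of `φ` with `*φ` and the norm of `v ⌟ *φ`. -/

section StarNorm

variable {V : Type*} [AddCommGroup V] [Module ℝ V] {g : V →ₗ[ℝ] V →ₗ[ℝ] ℝ} {φ : Tensor₃ V}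
  {σ : Tensor₄ V}

namespace IsG2

theorem φ_self₁₂ (h : IsG2 g φ σ) (x y : V) : φ x x y = 0 := by
  linarith [h.φ_swap₁₂ x x y]

theorem φ_cycle (h : IsG2 g φ σ) (x y z : V) : φ x y z = φ y z x := by
  rw [h.φ_swap₁₂, h.φ_swap₂₃ y x z, neg_neg]

theorem σ_self₁₂ (h : IsG2 g φ σ) (x y z : V) : σ x x y z = 0 := by
  linarith [h.σ_swap₁₂ x x y z]

theorem σ_self₁₃ (h : IsG2 g φ σ) (x y z : V) : σ x y x z = 0 := by
  rw [h.σ_swap₂₃, h.σ_self₁₂, neg_zero]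

theorem σ_self₂₃ (h : IsG2 g φ σ) (x y z : V) : σ x y y z = 0 := by
  linarith [h.σ_swap₂₃ x y y z]

theorem σ_self₂₄ (h : IsG2 g φ σ) (x y z : V) : σ x y z y = 0 := by
  rw [h.σ_swap₃₄, h.σ_self₂₃, neg_zero]

variable {e : Fin 7 → V}

/-- Trace of the contraction identity: the metric terms give `7 - 1`, and `σ` has a repeated
argument. -/
theorem sum_φ_mul_φ (h : IsG2 g φ σ) (he : IsONFrame g e) (x y : V) :
    ∑ b, ∑ c, φ (e c) x (e b) * φ (e c) y (e b) = 6 * g x y := by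
  have h₁ : ∀ b, ∑ c, φ (e c) x (e b) * φ (e c) y (e b) =
      g x y * g (e b) (e b) - g x (e b) * g y (e b) := fun b => by
    rw [h.contraction e he, h.σ_self₂₄, h.symm (e b) y, sub_zero]
  simp only [h₁, Finset.sum_sub_distrib, ← Finset.mul_sum, h.sum_diag_self he,
    h.sum_inner_mul he (g x) y]
  push_cast; ring

/-- When `σ` is eliminated by the contraction identity, two metric terms each give `φ(d, w, a)` and
the quadratic term gives `-6 φ(d, w, a)` by `sum_φ_mul_φ`. -/
theorem sum_φ_mul_σ (h : IsG2 g φ σ) (he : IsONFrame g e) (d w a : V) :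
    ∑ b, ∑ c, φ (e b) (e c) d * σ w a (e b) (e c) = -4 * φ d w a := by
  have h₁ : ∀ b c, φ (e b) (e c) d * σ w a (e b) (e c) =
      φ (e b) (e c) d * g a (e c) * g w (e b) - φ (e b) (e c) d * g w (e c) * g a (e b) -
        ∑ i, φ (e i) w a * (φ (e c) (e i) (e b) * φ (e c) d (e b)) := fun b c => by
    have h₂ := h.contraction e he w a (e b) (e c)
    have h₃ : ∑ i, φ (e i) w a * (φ (e c) (e i) (e b) * φ (e c) d (e b)) =
        φ (e b) (e c) d * ∑ i, φ (e i) w a * φ (e i) (e b) (e c) := by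
      rw [Finset.mul_sum]
      refine Finset.sum_congr rfl fun i _ => ?_
      rw [h.φ_cycle (e c), h.φ_cycle (e b)]; ring
    rw [h₃, h₂]; ring
  have h₄ : ∀ w a, ∑ b, ∑ c, φ (e b) (e c) d * g a (e c) * g w (e b) = φ w a d := fun w a => by
    simp only [← Finset.sum_mul]
    have h₅ : ∀ b, ∑ c, φ (e b) (e c) d * g a (e c) = φ (e b) a d := fun b =>
      h.sum_inner_mul he ((φ (e b)).flip d) a
    simp only [h₅]
    exact h.sum_inner_mul he ((φ.flip a).flip d) w
  have h₆ : ∑ b, ∑ c, ∑ i, φ (e i) w a * (φ (e c) (e i) (e b) * φ (e c) d (e b)) =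
      6 * φ d w a := by
    have h₇ : ∀ b, ∑ c, ∑ i, φ (e i) w a * (φ (e c) (e i) (e b) * φ (e c) d (e b)) =
        ∑ i, φ (e i) w a * ∑ c, (φ (e c) (e i) (e b) * φ (e c) d (e b)) := fun b => by
      rw [Finset.sum_comm]; simp only [Finset.mul_sum]
    simp only [h₇]
    rw [Finset.sum_comm]
    simp only [← Finset.mul_sum, h.sum_φ_mul_φ he]
    have := h.sum_inner_mul he ((φ.flip w).flip a) d
    simp only [LinearMap.flip_apply] at this
    rw [← this, Finset.mul_sum]
    exact Finset.sum_congr rfl fun i _ => by rw [h.symm (e i)]; ring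
  simp only [h₁, Finset.sum_sub_distrib, h₄, h₆]
  rw [h.φ_swap₁₂ a w d, h.φ_cycle d w a]; ring

/-- One factor is expanded by the contraction identity. Its metric terms repeat an argument of the
other factor and vanish; the rest is `-(-4)` times the sum in `sum_φ_mul_φ`, whence `4 · 6`. -/
theorem sum_σ_mul_σ (h : IsG2 g φ σ) (he : IsONFrame g e) (v w : V) :
    ∑ a, ∑ b, ∑ c, σ v (e a) (e b) (e c) * σ w (e a) (e b) (e c) = 24 * g v w := by
  have h₁ : ∀ a b c, σ v (e a) (e b) (e c) * σ w (e a) (e b) (e c) =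
      σ w (e a) (e b) (e c) * g (e a) (e c) * g v (e b) -
        σ w (e a) (e b) (e c) * g (e a) (e b) * g v (e c) -
        ∑ i, φ (e i) v (e a) * (φ (e b) (e c) (e i) * σ w (e a) (e b) (e c)) := fun a b c => by
    have h₂ := h.contraction e he v (e a) (e b) (e c)
    have h₃ : ∑ i, φ (e i) v (e a) * (φ (e b) (e c) (e i) * σ w (e a) (e b) (e c)) =
        σ w (e a) (e b) (e c) * ∑ i, φ (e i) v (e a) * φ (e i) (e b) (e c) := by
      rw [Finset.mul_sum]
      refine Finset.sum_congr rfl fun i _ => ?_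
      rw [h.φ_cycle (e i) (e b)]; ring
    rw [h₃, h₂]; ring
  have h₄ : ∀ a, ∑ b, ∑ c, σ w (e a) (e b) (e c) * g (e a) (e c) * g v (e b) = 0 := fun a => by
    refine Finset.sum_eq_zero fun b _ => ?_
    rw [← Finset.sum_mul, h.sum_inner_mul he (σ w (e a) (e b)) (e a), h.σ_self₂₄, zero_mul]
  have h₅ : ∀ a, ∑ b, ∑ c, σ w (e a) (e b) (e c) * g (e a) (e b) * g v (e c) = 0 := fun a => by
    rw [Finset.sum_comm]
    refine Finset.sum_eq_zero fun c _ => ?_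
    have := h.sum_inner_mul he ((σ w (e a)).flip (e c)) (e a)
    simp only [LinearMap.flip_apply] at this
    rw [← Finset.sum_mul, this, h.σ_self₂₃, zero_mul]
  have h₆ : ∀ a, ∑ b, ∑ c, ∑ i, φ (e i) v (e a) * (φ (e b) (e c) (e i) * σ w (e a) (e b) (e c)) =
      ∑ i, φ (e i) v (e a) * (-4 * φ (e i) w (e a)) := fun a => by
    simp only [← h.sum_φ_mul_σ he]
    rw [Finset.sum_congr rfl fun b _ => Finset.sum_comm, Finset.sum_comm]
    refine Finset.sum_congr rfl fun i _ => ?_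
    rw [Finset.mul_sum]
    exact Finset.sum_congr rfl fun b _ => (Finset.mul_sum ..).symm
  simp only [h₁, Finset.sum_sub_distrib, h₄, h₅, h₆]
  have h₇ := h.sum_φ_mul_φ he v w
  have h₈ : ∑ a, ∑ i, φ (e i) v (e a) * (-4 * φ (e i) w (e a)) =
      -4 * ∑ a, ∑ i, φ (e i) v (e a) * φ (e i) w (e a) := by
    simp only [Finset.mul_sum]
    exact Finset.sum_congr rfl fun a _ => Finset.sum_congr rfl fun i _ => by ring
  rw [h₈, h₇]; simp; ring

/-- The factor `4` is cancelled by the `¼` in `r̄(φ)`; this is why `r̄(φ)` returns the endomorphism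
behind `∇̄φ`. -/
theorem formInner₃_σ (h : IsG2 g φ σ) (v w : V) :
    formInner₃ 7 (fun x y => g x y) (fun x y z => σ v x y z) (fun x y z => σ w x y z) =
      4 * g v w := by
  rw [formInner₃, h.sum_σ_mul_σ h.orthonormalFrame_spec]; ring

end IsG2

end StarNorm

/-! ### The `SU(3)`-structure of a hyperplane in a `G₂`-space. -/

section SU3Algebra

variable {V : Type*} [AddCommGroup V] [Module ℝ V]

/-- The pointwise algebraic data of an `SU(3)`-structure: a scalar product, an orthogonal complex
structure and the real part of the complex volume form. -/
structure IsSU3 (g : V →ₗ[ℝ] V →ₗ[ℝ] ℝ) (I : V →ₗ[ℝ] V) (ψ : Tensor₃ V) : Prop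
    extends IsScalarProduct 6 g where
  I_sq : ∀ x, I (I x) = -x
  I_isom : ∀ x y, g (I x) (I y) = g x y
  swap₁₂ : ∀ x y z, ψ x y z = -ψ y x z
  swap₂₃ : ∀ x y z, ψ x y z = -ψ x z y
  I_slide : ∀ x y z, ψ (I x) y z = ψ x (I y) z
  -- The real part of the contraction identity for the complex volume form of a three-dimensional
  -- Hermitian space.
  contraction : ∀ e : Fin 6 → V, IsONFrame g e → ∀ x y z w,
    ∑ i, ψ (e i) x y * ψ (e i) z w =
      g x z * g y w - g x w * g y z - g (I x) z * g (I y) w + g (I x) w * g (I y) z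

namespace IsSU3

variable {g : V →ₗ[ℝ] V →ₗ[ℝ] ℝ} {I : V →ₗ[ℝ] V} {ψ : Tensor₃ V}

theorem I_skew (h : IsSU3 g I ψ) (x y : V) : g x (I y) = -g (I x) y := by
  rw [← h.I_isom x (I y), h.I_sq, map_neg]

/-- The real part of the complex volume form after a change of phase. -/
theorem rotate (h : IsSU3 g I ψ) {c s : ℝ} (hcs : c ^ 2 + s ^ 2 = 1) :
    IsSU3 g I (c • ψ + s • ψ.comp I) where
  toIsScalarProduct := h.toIsScalarProduct
  I_sq := h.I_sq
  I_isom := h.I_isom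
  swap₁₂ x y z := by
    simp only [LinearMap.add_apply, LinearMap.smul_apply, LinearMap.comp_apply, smul_eq_mul]
    rw [h.swap₁₂ x y z, h.swap₁₂ (I x), ← h.I_slide]; ring
  swap₂₃ x y z := by
    simp only [LinearMap.add_apply, LinearMap.smul_apply, LinearMap.comp_apply, smul_eq_mul]
    rw [h.swap₂₃ x y z, h.swap₂₃ (I x)]; ring
  I_slide x y z := by
    simp only [LinearMap.add_apply, LinearMap.smul_apply, LinearMap.comp_apply, smul_eq_mul]
    rw [h.I_slide x, h.I_slide (I x)]
  contraction e he x y z w := by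
    simp only [LinearMap.add_apply, LinearMap.smul_apply, LinearMap.comp_apply, smul_eq_mul,
      h.I_slide (e _)]
    have h₁ : ∀ i, (c * ψ (e i) x y + s * ψ (e i) (I x) y) *
        (c * ψ (e i) z w + s * ψ (e i) (I z) w) =
        c ^ 2 * (ψ (e i) x y * ψ (e i) z w) + c * s * (ψ (e i) (I x) y * ψ (e i) z w)
        + c * s * (ψ (e i) x y * ψ (e i) (I z) w)
        + s ^ 2 * (ψ (e i) (I x) y * ψ (e i) (I z) w) := fun i => by ring
    simp only [h₁, Finset.sum_add_distrib, ← Finset.mul_sum, h.contraction e he, h.I_isom, h.I_sq,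
      h.I_skew, map_neg, LinearMap.neg_apply]
    -- The `c²` and `s²` terms have the same contraction, and the two mixed terms cancel.
    linear_combination (g x z * g y w - g x w * g y z - g (I x) z * g (I y) w +
      g (I x) w * g (I y) z) * hcs

end IsSU3

/-- The linear algebra of the tangent space of an oriented hypersurface in a space with a
`G₂`-structure. -/
structure IsG2Hyperplane {V₇ V₆ : Type*} [AddCommGroup V₇] [Module ℝ V₇] [AddCommGroup V₆]
    [Module ℝ V₆] (g₇ : V₇ →ₗ[ℝ] V₇ →ₗ[ℝ] ℝ) (φ : Tensor₃ V₇) (σ : Tensor₄ V₇)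
    (g : V₆ →ₗ[ℝ] V₆ →ₗ[ℝ] ℝ) (j : V₆ →ₗ[ℝ] V₇) (n : V₇) (I : V₆ →ₗ[ℝ] V₆) : Prop where
  g2 : IsG2 g₇ φ σ
  scalarProduct : IsScalarProduct 6 g
  g_eq : ∀ x y, g x y = g₇ (j x) (j y)
  unit : g₇ n n = 1
  normal : ∀ x, g₇ n (j x) = 0
  I_spec : ∀ x y, g (I x) y = φ n (j x) (j y)

namespace IsG2Hyperplane

variable {V₇ V₆ : Type*} [AddCommGroup V₇] [Module ℝ V₇] [AddCommGroup V₆]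
    [Module ℝ V₆] {g₇ : V₇ →ₗ[ℝ] V₇ →ₗ[ℝ] ℝ} {φ : Tensor₃ V₇} {σ : Tensor₄ V₇}
    {g : V₆ →ₗ[ℝ] V₆ →ₗ[ℝ] ℝ} {j : V₆ →ₗ[ℝ] V₇} {n : V₇} {I : V₆ →ₗ[ℝ] V₆}

theorem frame_cons (h : IsG2Hyperplane g₇ φ σ g j n I) {e : Fin 6 → V₆} (he : IsONFrame g e) :
    IsONFrame g₇ (Fin.cons n fun i => j (e i) : Fin 7 → V₇) := by
  intro a b
  refine Fin.cases ?_ (fun a => ?_) a <;> refine Fin.cases ?_ (fun b => ?_) b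
  · simp [h.unit]
  · simp [h.normal, (Fin.succ_ne_zero b).symm]
  · simp [h.g2.symm _ n, h.normal, Fin.succ_ne_zero a]
  · simpa [h.g_eq] using he a b

theorem sum_φ_mul_φ (h : IsG2Hyperplane g₇ φ σ g j n I) {e : Fin 6 → V₆} (he : IsONFrame g e)
    (x y z w : V₇) : φ n x y * φ n z w + ∑ i, φ (j (e i)) x y * φ (j (e i)) z w =
      g₇ x z * g₇ y w - g₇ x w * g₇ y z - σ x y z w := by
  rw [← h.g2.contraction _ (h.frame_cons he) x y z w, Fin.sum_univ_succ]
  rfl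

theorem I_skew (h : IsG2Hyperplane g₇ φ σ g j n I) (x y : V₆) : g x (I y) = -g (I x) y := by
  rw [h.scalarProduct.symm, h.I_spec, h.I_spec, h.g2.φ_swap₂₃]

/-- Since `φ(e_i, n, x) = ⟨I x, e_i⟩`, the sum inserts `I x` into the first slot. -/
theorem sum_φ_I (h : IsG2Hyperplane g₇ φ σ g j n I) {e : Fin 6 → V₆} (he : IsONFrame g e)
    (x : V₆) (y z : V₇) :
    ∑ i, φ (j (e i)) n (j x) * φ (j (e i)) y z = φ (j (I x)) y z := by
  have := h.scalarProduct.sum_inner_mul he (((φ.comp j).flip y).flip z) (I x)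
  simp only [LinearMap.flip_apply, LinearMap.comp_apply] at this
  rw [← this]
  refine Finset.sum_congr rfl fun i _ => ?_
  rw [h.I_spec, h.g2.φ_cycle]; ring

/-- The contraction identity at `(n, x, y, z)`, where the normal summand and the metric terms
vanish. It makes `ι^*(n ⌟ *φ)` an insertion of `I` into `ι^*φ`, hence `θ` a phase. -/
theorem σ_normal (h : IsG2Hyperplane g₇ φ σ g j n I) (x y z : V₆) :
    σ n (j x) (j y) (j z) = -φ (j (I x)) (j y) (j z) := by
  have he := h.scalarProduct.orthonormalFrame_spec
  have h₁ := h.sum_φ_mul_φ he n (j x) (j y) (j z)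
  rw [h.sum_φ_I he, h.g2.φ_self₁₂, h.normal, h.normal] at h₁
  linarith

/-- By `σ_normal` both sides are components of the alternating form `n ⌟ σ`. -/
theorem I_slide (h : IsG2Hyperplane g₇ φ σ g j n I) (x y z : V₆) :
    φ (j (I x)) (j y) (j z) = φ (j x) (j (I y)) (j z) := by
  have h₁ := h.σ_normal x y z
  have h₂ := h.σ_normal y x z
  have h₃ := h.g2.σ_swap₂₃ n (j x) (j y) (j z)
  have h₄ := h.g2.φ_swap₁₂ (j x) (j (I y)) (j z)
  linarith

/-- The contraction identity at `(n, x, n, y)`, where `σ` vanishes. -/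
theorem I_isom (h : IsG2Hyperplane g₇ φ σ g j n I) (x y : V₆) : g (I x) (I y) = g x y := by
  have he := h.scalarProduct.orthonormalFrame_spec
  have h₁ := h.sum_φ_mul_φ he n (j x) n (j y)
  rw [h.sum_φ_I he, h.g2.φ_self₁₂, h.normal, h.g2.σ_self₁₃, h.unit, ← h.g_eq,
    h.g2.φ_cycle (j (I x)), ← h.I_spec, h.scalarProduct.symm] at h₁
  linarith

theorem I_sq (h : IsG2Hyperplane g₇ φ σ g j n I) (x : V₆) : I (I x) = -x :=
  h.scalarProduct.eq_of_inner_left fun z => by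
    rw [map_neg, LinearMap.neg_apply, ← h.I_isom x z, h.I_skew, neg_neg]

theorem sum_tangent (h : IsG2Hyperplane g₇ φ σ g j n I) {e : Fin 6 → V₆} (he : IsONFrame g e)
    (x y z w : V₆) : ∑ i, φ (j (e i)) (j x) (j y) * φ (j (e i)) (j z) (j w) =
      g x z * g y w - g x w * g y z - g (I x) y * g (I z) w - σ (j x) (j y) (j z) (j w) := by
  have := h.sum_φ_mul_φ he (j x) (j y) (j z) (j w)
  simp only [h.I_spec, h.g_eq] at this ⊢
  linarith

/-- The contraction over the rotated frame `I e_i` is also, after sliding `I`, the contraction over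
`e_i` with `I x` and `I z` inserted; the two evaluations are compared. -/
theorem σ_I (h : IsG2Hyperplane g₇ φ σ g j n I) (x y z w : V₆) :
    σ (j (I x)) (j y) (j (I z)) (j w) = σ (j x) (j y) (j z) (j w) + g (I x) y * g (I z) w
      + g (I x) w * g (I y) z + g x w * g y z - g x y * g z w := by
  have he := h.scalarProduct.orthonormalFrame_spec
  have h₁ := h.sum_tangent (he.map I h.I_isom) x y z w
  have h₂ := h.sum_tangent he (I x) y (I z) w
  simp only [h.I_slide] at h₁
  rw [h₂] at h₁
  simp only [h.I_isom, h.I_sq, h.I_skew, map_neg, LinearMap.neg_apply] at h₁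
  linear_combination -h₁

/-- On the hyperplane `σ` is `-½ ω ∧ ω`. Moving `I` between pairs of slots by three instances of
`σ_I` returns to `σ(x, y, z, w)` with the opposite sign, so that `2 σ` is a sum of metric terms. -/
theorem σ_tangent (h : IsG2Hyperplane g₇ φ σ g j n I) (x y z w : V₆) :
    σ (j x) (j y) (j z) (j w) = -(g (I x) y * g (I z) w + g (I x) z * g (I w) y
      + g (I x) w * g (I y) z) := by
  have h₁ := h.σ_I x y z w
  have h₂ := h.σ_I x z y w
  have h₃ := h.σ_I (I y) (I x) z w
  simp only [h.I_sq, h.I_isom, h.I_skew, LinearMap.map_neg, LinearMap.neg_apply] at h₃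
  have h₄ := h.g2.σ_swap₂₃ (j (I x)) (j z) (j (I y)) (j w)
  have h₅ := h.g2.σ_swap₂₃ (j x) (j z) (j y) (j w)
  have h₆ := h.g2.σ_swap₁₂ (j (I x)) (j y) (j (I z)) (j w)
  have h₇ := h.g2.σ_swap₁₂ (j (I x)) (j (I y)) (j z) (j w)
  have hk : ∀ a b, g (I a) b = -g (I b) a := fun a b => by
    rw [← h.I_skew, h.scalarProduct.symm]
  have hs := h.scalarProduct.symm
  have h₈ : ∀ a b c d, σ (-a) b c d = -σ a b c d := fun a b c d => by
    rw [← neg_one_smul ℝ a, map_smul]; simp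
  rw [h₈] at h₃
  simp only [hk z y, hk w y, hk y x, hs z y, hs y x] at h₁ h₂ h₃ ⊢
  linarith

theorem isSU3 (h : IsG2Hyperplane g₇ φ σ g j n I) :
    IsSU3 g I (φ.comap j) where
  toIsScalarProduct := h.scalarProduct
  I_sq := h.I_sq
  I_isom := h.I_isom
  swap₁₂ x y z := h.g2.φ_swap₁₂ _ _ _
  swap₂₃ x y z := h.g2.φ_swap₂₃ _ _ _
  I_slide := h.I_slide
  contraction e he x y z w := by
    simp only [Tensor₃.comap_apply]
    rw [h.sum_tangent he, h.σ_tangent]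
    have h₁ : ∀ a b, g (I a) b = -g (I b) a := fun a b => by
      rw [← h.I_skew, h.scalarProduct.symm]
    rw [h₁ w y]; ring

end IsG2Hyperplane

end SU3Algebra

/-! ### Torsion tensors as endomorphisms, and the modules `𝒲₁`, `𝒲₂`, `𝒲₃`. -/

section TorsionModules

variable {V : Type*} [AddCommGroup V] [Module ℝ V]

theorem IsScalarProduct.exists_raise {k : ℕ} {g : V →ₗ[ℝ] V →ₗ[ℝ] ℝ} (hg : IsScalarProduct k g)
    (b : V →ₗ[ℝ] V →ₗ[ℝ] ℝ) : ∃ R : V →ₗ[ℝ] V, ∀ x y, g (R x) y = b x y := by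
  have he := hg.orthonormalFrame_spec
  refine ⟨∑ i, (b.flip (orthonormalFrame k (fun x y => g x y) i)).smulRight
    (orthonormalFrame k (fun x y => g x y) i), fun x y => ?_⟩
  rw [← hg.inner_sum_frame he (b x) y]
  simp

/-- The components of a bilinear form that correspond to the modules of torsion tensors under
`r`; the component for `𝒲₃` also contains the one for `𝒲₄`. -/
def formComponent (g : V → V → ℝ) (I : V → V) : TorsionClass → (V → V → ℝ) →ₗ[ℝ] (V → V → ℝ)
  | .W1plus =>
    { toFun := fun b _ _ => ∑ i, b (orthonormalFrame 6 g i) (orthonormalFrame 6 g i)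
      map_add' := fun a b => by ext; simp [Finset.sum_add_distrib]
      map_smul' := fun c b => by ext; simp [Finset.mul_sum] }
  | .W1minus =>
    { toFun := fun b _ _ => ∑ i, b (orthonormalFrame 6 g i) (I (orthonormalFrame 6 g i))
      map_add' := fun a b => by ext; simp [Finset.sum_add_distrib]
      map_smul' := fun c b => by ext; simp [Finset.mul_sum] }
  | .W2plus =>
    -- Four times the symmetric `I`-invariant part, made trace-free: it has four times the trace of
    -- `b`, and `4 / 6 = 2 / 3`.
    { toFun := fun b x y => b x y + b (I x) (I y) + (b y x + b (I y) (I x)) -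
        2 / 3 * g x y * ∑ i, b (orthonormalFrame 6 g i) (orthonormalFrame 6 g i)
      map_add' := fun a b => by ext; simp [Finset.sum_add_distrib]; ring
      map_smul' := fun c b => by ext; simp [← Finset.mul_sum]; ring }
  | .W2minus =>
    -- The skew `I`-invariant part in the same normalisation, without its multiple of `⟨I ·, ·⟩`.
    { toFun := fun b x y => b x y + b (I x) (I y) - (b y x + b (I y) (I x)) -
        2 / 3 * g (I x) y * ∑ i, b (orthonormalFrame 6 g i) (I (orthonormalFrame 6 g i))
      map_add' := fun a b => by ext; simp [Finset.sum_add_distrib]; ring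
      map_smul' := fun c b => by ext; simp [← Finset.mul_sum]; ring }
  | .W3 =>
    { toFun := fun b x y => b x y - b (I x) (I y)
      map_add' := fun a b => by ext; simp; ring
      map_smul' := fun c b => by ext; simp; ring }
  -- `𝒲₄` needs no component: the criterion below concerns tensors without `𝒲₄`-part and sets of
  -- labels that omit `𝒲₄`.
  | .W4 => 0
  | .W5 => 0

/-- The map `r` from tensors to bilinear forms. -/
def rLin (g : V → V → ℝ) (ψ : V → V → V → ℝ) : Tensor₃ V →ₗ[ℝ] (V → V → ℝ) where
  toFun α x y := rForm g ψ (fun x y z => α x y z) x y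
  map_add' a b := by ext x y; exact rForm_add g ψ a b x y
  map_smul' c a := by ext x y; exact rForm_smul g ψ c a x y

/-- The component of a torsion tensor in one of the modules, as a bilinear form. -/
def torsionComponent (g : V → V → ℝ) (I : V → V) (ψ : V → V → V → ℝ) :
    TorsionClass → Tensor₃ V × (V →ₗ[ℝ] ℝ) →ₗ[ℝ] (V → V → ℝ)
  | .W5 =>
    { toFun := fun τ x _ => τ.2 x
      map_add' := fun a b => by ext; simp
      map_smul' := fun c b => by ext; simp }
  | c => (formComponent g I c).comp ((rLin g ψ).comp (LinearMap.fst ℝ _ _))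

namespace IsSU3

variable {g : V →ₗ[ℝ] V →ₗ[ℝ] ℝ} {I : V →ₗ[ℝ] V} {ψ : Tensor₃ V}

theorem cycle (h : IsSU3 g I ψ) (x y z : V) : ψ x y z = ψ y z x := by
  rw [h.swap₁₂, h.swap₂₃ y x z, neg_neg]

theorem I_slide₂ (h : IsSU3 g I ψ) (x y z : V) : ψ x (I y) z = ψ x y (I z) := by
  rw [h.cycle, h.I_slide, ← h.cycle]

theorem self₁₂ (h : IsSU3 g I ψ) (x y : V) : ψ x x y = 0 := by linarith [h.swap₁₂ x x y]

theorem self₂₃ (h : IsSU3 g I ψ) (x y : V) : ψ x y y = 0 := by linarith [h.swap₂₃ x y y]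

theorem inner_I_self (h : IsSU3 g I ψ) (x : V) : g (I x) x = 0 := by
  linarith [h.I_skew x x, h.symm x (I x)]

/-- Trace of the contraction identity: `6 - 1 - 1`, the last `1` coming from the terms with `I`. -/
theorem sum_ψ_mul_ψ (h : IsSU3 g I ψ) {e : Fin 6 → V} (he : IsONFrame g e) (a b : V) :
    ∑ i, ∑ j, ψ a (e i) (e j) * ψ b (e i) (e j) = 4 * g a b := by
  rw [Finset.sum_comm]
  have h₁ : ∀ j, ∑ i, ψ a (e i) (e j) * ψ b (e i) (e j) =
      g (e j) (e j) * g a b - g a (e j) * g b (e j) - g (I a) (e j) * g (I b) (e j) := fun j => by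
    simp only [h.cycle a, h.cycle b]
    rw [h.contraction e he, h.inner_I_self, h.symm (e j) b,
      h.symm (I (e j)) b, h.I_skew b]
    ring
  simp only [h₁, Finset.sum_sub_distrib, ← Finset.sum_mul, h.sum_diag_self he,
    h.sum_inner_mul he (g a), h.sum_inner_mul he (g (I a)), h.I_isom]
  push_cast; ring

/-- The `½` of `r`, the `½` of `formInner₂` and the `4` of `sum_ψ_mul_ψ` cancel, so `r` lowers an
index of the endomorphism. Conditions on torsion tensors thereby become conditions on `R`. -/
theorem rForm_comp (h : IsSU3 g I ψ) {α : Tensor₃ V} {R : V → V}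
    (hα : ∀ x y z, α x y z = ψ (R x) y z) (x y : V) :
    rForm (fun x y => g x y) (fun x y z => ψ x y z) (fun x y z => α x y z) x y = g (R x) y := by
  simp only [rForm, formInner₂, hα, h.sum_ψ_mul_ψ h.orthonormalFrame_spec]
  ring

theorem eq_of_ψ_eq (h : IsSU3 g I ψ) {a b : V} (hab : ∀ y z, ψ a y z = ψ b y z) : a = b :=
  h.eq_of_inner_left fun w => by
    have h₁ := h.sum_ψ_mul_ψ h.orthonormalFrame_spec a w
    have h₂ := h.sum_ψ_mul_ψ h.orthonormalFrame_spec b w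
    simp only [hab] at h₁
    linarith

/-- Every tensor with the symmetries of `∇ω` is given by an endomorphism. -/
theorem exists_endomorphism (h : IsSU3 g I ψ) {α : Tensor₃ V}
    (hα : α ∈ spaceW fun x => I x) : ∃ R : V →ₗ[ℝ] V, ∀ x y z, α x y z = ψ (R x) y z := by
  have he := h.orthonormalFrame_spec
  set e := orthonormalFrame 6 fun x y => g x y
  -- `R x = ¼ ∑ ψ(e_i, e_j, e_k) α(x, e_j, e_k) e_i`. Inserted into `ψ`, it is evaluated by the
  -- contraction identity, whose four terms all equal `α(x, y, z)` by the symmetries of `spaceW`.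
  refine ⟨∑ i, ((1 / 4 : ℝ) • ∑ j, ∑ k, ψ (e i) (e j) (e k) •
    ((α.flip (e j)).flip (e k))).smulRight (e i), fun x y z => ?_⟩
  have h₁ : ∀ y z, ∑ j, ∑ k, α x (e j) (e k) * g y (e j) * g z (e k) = α x y z := fun y z => by
    have h₂ : ∀ j, ∑ k, α x (e j) (e k) * g y (e j) * g z (e k) = α x (e j) z * g y (e j) :=
      fun j => by
        rw [← h.sum_inner_mul he (α x (e j)) z, Finset.sum_mul]
        exact Finset.sum_congr rfl fun k _ => by ring
    simp only [h₂]
    exact h.sum_inner_mul he ((α x).flip z) y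
  have h₃ : ∀ j k, ∑ i, ψ (e i) y z * ψ (e i) (e j) (e k) * α x (e j) (e k) =
      α x (e j) (e k) * g y (e j) * g z (e k) - α x (e j) (e k) * g z (e j) * g y (e k)
      - α x (e j) (e k) * g (I y) (e j) * g (I z) (e k)
      + α x (e j) (e k) * g (I z) (e j) * g (I y) (e k) := fun j k => by
    rw [← Finset.sum_mul, h.contraction e he]; ring
  have h₄ : ∑ i, ∑ j, ∑ k, ψ (e i) y z * ψ (e i) (e j) (e k) * α x (e j) (e k) = 4 * α x y z := by
    rw [Finset.sum_comm, Finset.sum_congr rfl fun j _ => Finset.sum_comm]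
    simp only [h₃, Finset.sum_add_distrib, Finset.sum_sub_distrib, h₁]
    linarith [(hα x y z).1, (hα x y z).2, (hα x z y).2]
  have h₅ : ψ ((∑ i, ((1 / 4 : ℝ) • ∑ j, ∑ k, ψ (e i) (e j) (e k) •
      ((α.flip (e j)).flip (e k))).smulRight (e i)) x) y z =
      1 / 4 * ∑ i, ∑ j, ∑ k, ψ (e i) y z * ψ (e i) (e j) (e k) * α x (e j) (e k) := by
    simp only [map_sum, LinearMap.sum_apply, LinearMap.smulRight_apply, LinearMap.smul_apply,
      map_smul, smul_eq_mul, LinearMap.flip_apply, Finset.mul_sum, Finset.sum_mul]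
    exact Finset.sum_congr rfl fun i _ => Finset.sum_congr rfl fun j _ =>
      Finset.sum_congr rfl fun k _ => by ring
  rw [h₅, h₄]; ring

theorem comp_mem_spaceW (h : IsSU3 g I ψ) {α : Tensor₃ V} {R : V → V}
    (hα : ∀ x y z, α x y z = ψ (R x) y z) : α ∈ spaceW fun x => I x := fun x y z => by
  simp only [hα]
  refine ⟨h.swap₂₃ _ _ _, ?_⟩
  rw [h.I_slide₂, h.I_sq]; simp

/-- As `I` slides between the slots of `ψ`, the behaviour of `α` under `I` in its first two slots is
a commutation relation for `R`. -/
theorem comm_of_comp (h : IsSU3 g I ψ) {α : Tensor₃ V} {R : V → V}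
    (hα : ∀ x y z, α x y z = ψ (R x) y z) (hI : ∀ x y z, α (I x) (I y) z = -α x y z) (x : V) :
    R (I x) = I (R x) := by
  refine h.eq_of_ψ_eq fun y z => ?_
  have := hI x (I y) z
  rw [h.I_sq, hα, hα, ← h.I_slide] at this
  simpa using this

theorem anticomm_of_comp (h : IsSU3 g I ψ) {α : Tensor₃ V} {R : V → V}
    (hα : ∀ x y z, α x y z = ψ (R x) y z) (hI : ∀ x y z, α (I x) (I y) z = α x y z) (x : V) :
    R (I x) = -I (R x) := by
  refine h.eq_of_ψ_eq fun y z => ?_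
  have := hI x (I y) z
  rw [h.I_sq, hα, hα, ← h.I_slide] at this
  have h₁ : ψ (-I (R x)) y z = -ψ (I (R x)) y z := by
    rw [← neg_one_smul ℝ, map_smul]; simp
  rw [h₁]
  have h₂ : ψ (R (I x)) (-y) z = -ψ (R (I x)) y z := by simp
  linarith

/-- Such an `α` is totally skew, so `ψ(R x, e_i, ·) = -ψ(R e_i, x, ·)`. The contraction identity
then expresses `g(R x, y)` by the traces of `R` and `I R`. -/
theorem endomorphism_of_mem_spaceW₁ (h : IsSU3 g I ψ) {α : Tensor₃ V} {R : V →ₗ[ℝ] V}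
    (hα : ∀ x y z, α x y z = ψ (R x) y z) (h₁ : α ∈ spaceW₁ fun x => I x) :
    ∃ a b : ℝ, ∀ x y, g (R x) y = a * g x y + b * g (I x) y := by
  have hs : ∀ x y z, α x y z = -α y x z := fun x y z => by
    have := h₁.2 (x + y) z
    simp only [map_add, LinearMap.add_apply, h₁.2] at this
    linarith
  have hc : ∀ x y z, α x y z = α z x y := fun x y z => by rw [(h₁.1 x y z).1, hs]; simp
  have hI := h.comm_of_comp hα fun x y z => by rw [hc, (h₁.1 z x y).2, hc x y z]
  have he := h.orthonormalFrame_spec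
  set e := orthonormalFrame 6 fun x y => g x y
  -- The contraction equates `4 g(R x, y)` with `-2 g(R x, y)` plus the two trace terms.
  refine ⟨1 / 6 * ∑ i, g (R (e i)) (e i), -(1 / 6) * ∑ i, g (I (R (e i))) (e i), fun x y => ?_⟩
  have h₂ := h.sum_ψ_mul_ψ he (R x) y
  have h₃ : ∀ i, ∑ j, ψ (R x) (e i) (e j) * ψ y (e i) (e j) =
      -(g (R (e i)) y * g x (e i)) + g (R (e i)) (e i) * g x y + g (I (R (e i))) y * g (I x) (e i)
        - g (I (R (e i))) (e i) * g (I x) y := fun i => by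
    have h₄ := h.contraction e he (R (e i)) x y (e i)
    have h₅ : ∀ j, ψ (R x) (e i) (e j) * ψ y (e i) (e j) =
        -(ψ (e j) (R (e i)) x * ψ (e j) y (e i)) := fun j => by
      rw [← hα, hs, hα, h.cycle (e j), h.cycle (e j), ]; ring
    simp only [h₅, Finset.sum_neg_distrib, h₄]
    ring
  have h₆ := h.sum_inner_mul he ((g.flip y).comp R) x
  have h₇ := h.sum_inner_mul he ((g.flip y).comp (I.comp R)) (I x)
  simp only [LinearMap.comp_apply, LinearMap.flip_apply] at h₆ h₇
  rw [hI, h.I_sq] at h₇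
  simp only [h₃, Finset.sum_add_distrib, Finset.sum_sub_distrib, Finset.sum_neg_distrib, h₆, h₇,
    ← Finset.sum_mul, map_neg, LinearMap.neg_apply] at h₂
  linarith

theorem sum_cycle (f : Fin 6 → Fin 6 → Fin 6 → ℝ) :
    ∑ i, ∑ j, ∑ k, f j k i = ∑ i, ∑ j, ∑ k, f i j k := by
  rw [Finset.sum_comm, Finset.sum_congr rfl fun j _ => Finset.sum_comm]

/-- The cyclic identity at `(I x, I y, z)` and its rotations is a linear system for `α(I x, I y, z)`
with solution `-α(x, y, z)`, so `R` commutes with `I`. The traces vanish because they are pairings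
of `α` with the cyclic tensors `ψ` and `ψ(I ·, ·, ·)`. -/
theorem endomorphism_of_mem_spaceW₂ (h : IsSU3 g I ψ) {α : Tensor₃ V} {R : V →ₗ[ℝ] V}
    (hα : ∀ x y z, α x y z = ψ (R x) y z) (h₂ : α ∈ spaceW₂ fun x => I x) :
    (∀ x, R (I x) = I (R x)) ∧ ∀ e : Fin 6 → V, IsONFrame g e →
      ∑ i, g (R (e i)) (e i) = 0 ∧ ∑ i, g (R (e i)) (I (e i)) = 0 := by
  refine ⟨h.comm_of_comp hα fun x y z => ?_, fun e he => ?_⟩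
  · have hs : ∀ x y z, α (I x) y (I z) = α (I x) (I y) z := fun x y z => by
      have := (h₂.1 (I x) (I y) z).2
      simp only [h.I_sq] at this
      simpa using this
    have k₁ := h₂.2 (I x) (I y) z
    have k₂ := h₂.2 (I y) (I z) x
    have k₃ := h₂.2 (I z) (I x) y
    have k₄ := h₂.2 x y z
    rw [hs, (h₂.1 _ _ _).2] at k₁ k₂ k₃
    linarith
  -- Against a cyclic tensor, `α` pairs like a third of its cyclic sum, which is zero.
  · have key : ∀ c : V → V → V → ℝ, (∀ x y z, c x y z = c y z x) →
        ∑ i, ∑ j, ∑ k, α (e i) (e j) (e k) * c (e i) (e j) (e k) = 0 := fun c hc => by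
      have k₁ := sum_cycle fun i j k => α (e i) (e j) (e k) * c (e i) (e j) (e k)
      have k₂ := sum_cycle fun i j k => α (e j) (e k) (e i) * c (e j) (e k) (e i)
      have k₃ : ∑ i, ∑ j, ∑ k, (α (e i) (e j) (e k) * c (e i) (e j) (e k) +
          α (e j) (e k) (e i) * c (e j) (e k) (e i) + α (e k) (e i) (e j) * c (e k) (e i) (e j))
          = 0 := by
        refine Finset.sum_eq_zero fun i _ => Finset.sum_eq_zero fun j _ =>
          Finset.sum_eq_zero fun k _ => ?_
        rw [← hc (e i), ← hc (e k) (e i), ← add_mul, ← add_mul, h₂.2, zero_mul]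
      simp only [Finset.sum_add_distrib] at k₃
      linarith
    have k₁ := key (fun x y z => ψ x y z) h.cycle
    have k₂ := key (fun x y z => ψ (I x) y z) fun x y z => by rw [h.cycle, ← h.I_slide₂, ← h.I_slide]
    simp only [hα, h.sum_ψ_mul_ψ he, ← Finset.mul_sum] at k₁ k₂
    exact ⟨by linarith, by linarith⟩

/-- Pairing the vanishing trace `∑ ψ(R e_i, e_i, ·)` with `ψ(·, y, x)` gives, by the contraction
identity and anticommutation, twice `g(R x, y) - g(R y, x)`. -/
theorem endomorphism_of_mem_spaceW₃ (h : IsSU3 g I ψ) {α : Tensor₃ V} {R : V →ₗ[ℝ] V}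
    (hα : ∀ x y z, α x y z = ψ (R x) y z) (h₃ : α ∈ spaceW₃ (fun x y => g x y) fun x => I x) :
    (∀ x, R (I x) = -I (R x)) ∧ ∀ x y, g (R x) y = g (R y) x := by
  have hI := h.anticomm_of_comp hα h₃.2.1
  refine ⟨hI, fun x y => ?_⟩
  have he := h.orthonormalFrame_spec
  have ht := h₃.2.2
  simp only [traceForm, hα] at ht
  set e := orthonormalFrame 6 fun x y => g x y
  have h₁ : ∑ i, ∑ k, ψ (e k) (R (e i)) (e i) * ψ (e k) y x = 0 := by
    rw [Finset.sum_comm]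
    refine Finset.sum_eq_zero fun k _ => ?_
    simp only [h.cycle (e k) (R _)]
    rw [← Finset.sum_mul, ht, zero_mul]
  have h₂ : ∀ i, ∑ k, ψ (e k) (R (e i)) (e i) * ψ (e k) y x =
      g (R (e i)) y * g x (e i) - g (R (e i)) x * g y (e i)
      + g (I (R (e i))) y * g (I x) (e i) - g (I (R (e i))) x * g (I y) (e i) := fun i => by
    rw [h.contraction e he, h.symm (e i), h.symm (e i), h.symm (I (e i)), h.symm (I (e i)),
      h.I_skew, h.I_skew]
    ring
  have k₁ : ∀ x y, ∑ i, g (R (e i)) y * g x (e i) = g (R x) y := fun x y =>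
    h.sum_inner_mul he ((g.flip y).comp R) x
  have k₂ : ∀ x y, ∑ i, g (I (R (e i))) y * g (I x) (e i) = g (R x) y := fun x y => by
    rw [show g (R x) y = g (I (R (I x))) y by rw [hI]; simp [h.I_sq]]
    exact h.sum_inner_mul he ((g.flip y).comp (I.comp R)) (I x)
  simp only [h₂, Finset.sum_add_distrib, Finset.sum_sub_distrib, k₁, k₂] at h₁
  linarith

end IsSU3

end TorsionModules

/-! ### Decomposition of torsion tensors and the membership criterion. -/

section TorsionDecomposition

variable {V : Type*} [AddCommGroup V] [Module ℝ V]

namespace IsSU3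

variable {g : V →ₗ[ℝ] V →ₗ[ℝ] ℝ} {I : V →ₗ[ℝ] V} {ψ : Tensor₃ V}

/-- The module of intrinsic torsion tensors with a given label. -/
abbrev torsion (_h : IsSU3 g I ψ) (c : TorsionClass) : Submodule ℝ (Tensor₃ V × (V →ₗ[ℝ] ℝ)) :=
  torsionModule (fun x y => g x y) (fun x => I x) (fun x y z => ψ x y z) c

/-- The component of an intrinsic torsion tensor with a given label. -/
abbrev component (_h : IsSU3 g I ψ) (c : TorsionClass) :
    Tensor₃ V × (V →ₗ[ℝ] ℝ) →ₗ[ℝ] (V → V → ℝ) :=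
  torsionComponent (fun x y => g x y) (fun x => I x) (fun x y z => ψ x y z) c

theorem component_comp (h : IsSU3 g I ψ) {α : Tensor₃ V} {R : V → V}
    (hα : ∀ x y z, α x y z = ψ (R x) y z) (η : V →ₗ[ℝ] ℝ) {c : TorsionClass} (hc : c ≠ .W5) :
    h.component c (α, η) =
      formComponent (fun x y => g x y) (fun x => I x) c fun x y => g (R x) y := by
  have h₁ : rLin (fun x y => g x y) (fun x y z => ψ x y z) α = fun x y => g (R x) y := by
    ext x y; exact h.rForm_comp hα x y
  have h₂ := congrArg (formComponent (fun x y => g x y) (fun x => I x) c) h₁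
  cases c <;> first | exact absurd rfl hc | exact h₂

/-- In each module `R` is known: a multiple of the identity or of `I`, commuting with `I` and
without the two traces, or symmetric and anticommuting; the foreign components can be read off. `𝒲₄`
is excluded because its tensors contribute to the component of `𝒲₃`. -/
theorem component_eq_zero (h : IsSU3 g I ψ) {c d : TorsionClass} (hcd : c ≠ d) (hc : c ≠ .W4)
    {τ : Tensor₃ V × (V →ₗ[ℝ] ℝ)} (hτ : τ ∈ h.torsion c) : h.component d τ = 0 := by
  obtain ⟨α, η⟩ := τ
  have he := h.orthonormalFrame_spec
  have hn := h.sum_diag_self he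
  have hsum : ∀ a : ℝ, ∑ i, a * g (orthonormalFrame 6 (fun x y => g x y) i)
      (orthonormalFrame 6 (fun x y => g x y) i) = a * 6 := fun a => by
    rw [← Finset.mul_sum, hn]; norm_num
  have hsym : ∀ x y, g (I x) y = -g (I y) x := fun x y => by rw [← h.I_skew, h.symm]
  cases c
  case W1plus =>
    obtain ⟨⟨h₁, h₂⟩, h₃ : η = 0⟩ := hτ
    obtain ⟨R, hα⟩ := h.exists_endomorphism h₁.1
    obtain ⟨a, b, hab⟩ := h.endomorphism_of_mem_spaceW₁ hα h₁
    simp only [h.rForm_comp hα] at h₂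
    -- Symmetry of `r(α)` removes the multiple of `I`.
    have hR : ∀ x y, g (R x) y = a * g x y := fun x y => by
      have := h₂ x y
      rw [hab x y, hab y x, hsym y x, h.symm y x] at this
      rw [hab]; linarith
    cases d
    case W5 => ext x y; simp [torsionComponent, h₃]
    all_goals
      rw [h.component_comp hα _ (by simp)]
      ext x y
      simp [formComponent, hR, hsum, h.I_isom, h.I_skew, h.inner_I_self, h.symm y x] at hcd ⊢
      try ring
  case W1minus =>
    obtain ⟨⟨h₁, h₂⟩, h₃ : η = 0⟩ := hτ
    obtain ⟨R, hα⟩ := h.exists_endomorphism h₁.1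
    obtain ⟨a, b, hab⟩ := h.endomorphism_of_mem_spaceW₁ hα h₁
    simp only [h.rForm_comp hα] at h₂
    have hR : ∀ x y, g (R x) y = b * g (I x) y := fun x y => by
      have := h₂ x y
      rw [hab x y, hab y x, hsym y x, h.symm y x] at this
      rw [hab]; linarith
    cases d
    case W5 => ext x y; simp [torsionComponent, h₃]
    all_goals
      rw [h.component_comp hα _ (by simp)]
      ext x y
      simp [formComponent, hR, hsum, h.I_isom, h.inner_I_self, hsym y x] at hcd ⊢
      try ring
  case W2plus =>
    obtain ⟨⟨h₁, h₂⟩, h₃ : η = 0⟩ := hτ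
    obtain ⟨R, hα⟩ := h.exists_endomorphism h₁.1
    obtain ⟨hI, ht⟩ := h.endomorphism_of_mem_spaceW₂ hα h₁
    simp only [h.rForm_comp hα] at h₂
    cases d
    case W5 => ext x y; simp [torsionComponent, h₃]
    all_goals
      rw [h.component_comp hα _ (by simp)]
      ext x y
      have hxy := h₂ x y
      simp [formComponent, hI, ht _ he, h.I_isom] at hcd ⊢
      try linarith
  case W2minus =>
    obtain ⟨⟨h₁, h₂⟩, h₃ : η = 0⟩ := hτ
    obtain ⟨R, hα⟩ := h.exists_endomorphism h₁.1
    obtain ⟨hI, ht⟩ := h.endomorphism_of_mem_spaceW₂ hα h₁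
    simp only [h.rForm_comp hα] at h₂
    cases d
    case W5 => ext x y; simp [torsionComponent, h₃]
    all_goals
      rw [h.component_comp hα _ (by simp)]
      ext x y
      have hxy := h₂ x y
      simp [formComponent, hI, ht _ he, h.I_isom] at hcd ⊢
      try linarith
  case W3 =>
    obtain ⟨h₁, h₃ : η = 0⟩ := hτ
    obtain ⟨R, hα⟩ := h.exists_endomorphism h₁.1
    obtain ⟨hI, hs⟩ := h.endomorphism_of_mem_spaceW₃ hα h₁
    have ht : ∑ i, g (R (orthonormalFrame 6 (fun x y => g x y) i))
        (orthonormalFrame 6 (fun x y => g x y) i) = 0 := by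
      have := h.sum_diag_eq (he.map I h.I_isom) he (g.comp R)
      simp [hI, h.I_isom] at this
      linarith
    have ht' : ∑ i, g (R (orthonormalFrame 6 (fun x y => g x y) i))
        (I (orthonormalFrame 6 (fun x y => g x y) i)) = 0 := by
      have := h.sum_diag_eq (he.map I h.I_isom) he ((g.comp R).compl₂ I)
      simp only [LinearMap.compl₂_apply, LinearMap.comp_apply, hI, h.I_sq, map_neg,
        LinearMap.neg_apply, neg_neg, h.I_skew, Finset.sum_neg_distrib] at this ⊢
      linarith
    cases d
    case W5 => ext x y; simp [torsionComponent, h₃]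
    all_goals
      rw [h.component_comp hα _ (by simp)]
      ext x y
      simp [formComponent, hI, ht, ht', h.I_isom] at hcd ⊢
  case W4 => exact absurd rfl hc
  case W5 =>
    obtain ⟨h₁ : α = 0, -⟩ := hτ
    cases d
    case W5 => exact absurd rfl hcd
    all_goals
      rw [h.component_comp (R := fun _ => 0) (by simp [h₁]) _ (by simp)]
      ext x y
      simp [formComponent]

/-- A torsion tensor with endomorphism `A`. -/
theorem comp_mem_signPart (h : IsSU3 g I ψ) {A : V →ₗ[ℝ] V} {ε : ℝ} {W : Submodule ℝ (Tensor₃ V)}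
    (hW : ψ.comp A ∈ W) (hA : ∀ x y, g (A x) y = ε * g (A y) x) :
    ψ.comp A ∈ signPart (fun x y => g x y) (fun x y z => ψ x y z) ε W :=
  ⟨hW, fun x y => by
    rw [h.rForm_comp (R := A) (fun _ _ _ => rfl), h.rForm_comp (R := A) (fun _ _ _ => rfl), hA]⟩

/-- A complex trilinear form transforms under a complex linear endomorphism by its trace. -/
theorem sum_cyclic_eq_zero (h : IsSU3 g I ψ) {A : V →ₗ[ℝ] V} (hI : ∀ x, A (I x) = I (A x))
    {e : Fin 6 → V} (he : IsONFrame g e) (h₁ : ∑ i, g (A (e i)) (e i) = 0)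
    (h₂ : ∑ i, g (A (e i)) (I (e i)) = 0) (x y z : V) :
    ψ (A x) y z + ψ (A y) z x + ψ (A z) x y = 0 := by
  -- `T` is, up to sign, the derivation action of `A` on `ψ`. It lies in `𝒲₁`, so its endomorphism
  -- is `a + b I`; pairing with `ψ` and `ψ(I ·, ·, ·)` shows that `a` and `b` are proportional to
  -- the two traces of `A`, hence zero.
  let T : Tensor₃ V := Tensor₃.mk (fun x y z => ψ (A x) y z + ψ (A y) z x + ψ (A z) x y)
    (fun y z => ⟨fun a b => by simp; ring, fun c a => by simp; ring⟩)
    (fun y z => ⟨fun a b => by simp; ring, fun c a => by simp; ring⟩)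
    (fun y z => ⟨fun a b => by simp; ring, fun c a => by simp; ring⟩)
  have hT : T ∈ spaceW₁ fun x => I x := by
    refine ⟨fun x y z => ?_, fun x z => ?_⟩
    · simp only [T, Tensor₃.mk_apply, hI]
      constructor
      · rw [h.swap₂₃ (A x), h.swap₂₃ (A y), h.swap₂₃ (A z)]; ring
      · have h₃ : ∀ a b c, ψ a (I b) (I c) = -ψ a b c := fun a b c => by
          rw [h.I_slide₂, h.I_sq, map_neg]
        have h₄ : ∀ a b c, ψ (I a) (I b) c = -ψ a b c := fun a b c => by
          rw [h.I_slide, h.I_sq]; simp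
        rw [h₃, h₄, ← h.I_slide₂ (I (A z)), h₄]; ring
    · simp only [T, Tensor₃.mk_apply, h.self₂₃]
      rw [h.swap₂₃ (A x) z]; simp
  obtain ⟨R, hR⟩ := h.exists_endomorphism hT.1
  obtain ⟨a, b, hab⟩ := h.endomorphism_of_mem_spaceW₁ hR hT
  have key : ∀ c : V → V → V → ℝ, (∀ x y z, c x y z = c y z x) →
      ∑ i, ∑ j, ∑ k, T (e i) (e j) (e k) * c (e i) (e j) (e k) =
        3 * ∑ i, ∑ j, ∑ k, ψ (A (e i)) (e j) (e k) * c (e i) (e j) (e k) := fun c hc => by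
    have k₁ := sum_cycle fun i j k => ψ (A (e i)) (e j) (e k) * c (e i) (e j) (e k)
    have k₂ := sum_cycle fun i j k => ψ (A (e j)) (e k) (e i) * c (e j) (e k) (e i)
    have k₃ : ∀ i j k, T (e i) (e j) (e k) * c (e i) (e j) (e k) =
        ψ (A (e i)) (e j) (e k) * c (e i) (e j) (e k) +
        ψ (A (e j)) (e k) (e i) * c (e j) (e k) (e i) +
        ψ (A (e k)) (e i) (e j) * c (e k) (e i) (e j) := fun i j k => by
      simp only [T, Tensor₃.mk_apply]
      rw [← hc (e i), ← hc (e k) (e i)]; ring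
    simp only [k₃, Finset.sum_add_distrib]
    linarith
  have k₁ := key (fun x y z => ψ x y z) h.cycle
  have k₂ := key (fun x y z => ψ (I x) y z) fun x y z => by
    rw [h.cycle, ← h.I_slide₂, ← h.I_slide]
  have hn := h.sum_diag_self he
  have hz : ∀ x, g x (I x) = 0 := fun x => by rw [h.I_skew, h.inner_I_self, neg_zero]
  simp only [hR, h.sum_ψ_mul_ψ he, ← Finset.mul_sum, h₁, h₂, hab, h.I_isom, h.inner_I_self,
    hz, Finset.sum_add_distrib, hn] at k₁ k₂
  have ha : a = 0 := by simpa using k₁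
  have hb : b = 0 := by simpa using k₂
  have hR₀ : R x = 0 := h.eq_of_inner_left fun w => by simp [hab, ha, hb]
  have h₃ := hR x y z
  rw [hR₀] at h₃
  simpa [T] using h₃

theorem exists_adjoint (h : IsSU3 g I ψ) (R : V →ₗ[ℝ] V) :
    ∃ R' : V →ₗ[ℝ] V, ∀ x y, g (R' x) y = g (R y) x := by
  obtain ⟨R', hR'⟩ := h.exists_raise (g.comp R).flip
  exact ⟨R', hR'⟩

/-- The components of the torsion tensor given by an endomorphism whose part that anticommutes
with the complex structure is symmetric. -/
theorem exists_decomposition (h : IsSU3 g I ψ) (R : V →ₗ[ℝ] V) (η : V →ₗ[ℝ] ℝ)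
    (hR : ∀ x y, g (R x) y - g (R (I x)) (I y) = g (R y) x - g (R (I y)) (I x)) :
    ∃ p : TorsionClass → Tensor₃ V × (V →ₗ[ℝ] ℝ), (∀ c, p c ∈ h.torsion c) ∧
      (∀ c, h.component c (ψ.comp R, η) = 0 → p c = 0) ∧
      (ψ.comp R, η) = p .W1plus + p .W1minus + p .W2plus + p .W2minus + p .W3 + p .W5 := by
  obtain ⟨R', hR'⟩ := h.exists_adjoint R
  have he := h.orthonormalFrame_spec
  set e := orthonormalFrame 6 fun x y => g x y with hedef
  have hn := h.sum_diag_self he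
  have hsym : ∀ x y, g (I x) y = -g (I y) x := fun x y => by rw [← h.I_skew, h.symm]
  have hz : ∀ x, g x (I x) = 0 := fun x => by rw [h.I_skew, h.inner_I_self, neg_zero]
  set t := ∑ i, g (R (e i)) (e i) with ht
  set s := ∑ i, g (R (e i)) (I (e i)) with hs
  have ht' : ∑ i, g (R (I (e i))) (I (e i)) = t :=
    h.sum_diag_eq (he.map I h.I_isom) he (g.comp R)
  have hs' : ∑ i, g (R (I (e i))) (e i) = -s := by
    have := h.sum_diag_eq (he.map I h.I_isom) he ((g.comp R).compl₂ I)
    simp only [LinearMap.compl₂_apply, LinearMap.comp_apply, h.I_sq, map_neg,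
      Finset.sum_neg_distrib] at this
    linarith
  -- The multiples of the identity and of `I`; then the symmetric and skew remainders of the part
  -- commuting with `I`, to which `S ↦ ½ (S - I S I)` projects; then the anticommuting part.
  let A₁ : V →ₗ[ℝ] V := (t / 6) • LinearMap.id
  let B₁ : V →ₗ[ℝ] V := (s / 6) • I
  let A₂ : V →ₗ[ℝ] V := (1 / 4 : ℝ) • (R + R' - I.comp ((R + R').comp I)) - A₁
  let B₂ : V →ₗ[ℝ] V := (1 / 4 : ℝ) • (R - R' - I.comp ((R - R').comp I)) - B₁
  let A₃ : V →ₗ[ℝ] V := (1 / 2 : ℝ) • (R + I.comp (R.comp I))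
  have hA₁ : ∀ x y, g (A₁ x) y = t / 6 * g x y := fun x y => by simp [A₁]
  have hB₁ : ∀ x y, g (B₁ x) y = s / 6 * g (I x) y := fun x y => by simp [B₁]
  have hII : ∀ x y, g (I x) y = -g x (I y) := fun x y => by rw [h.I_skew, neg_neg]
  have hA₂ : ∀ x y, g (A₂ x) y = 1 / 4 * (g (R x) y + g (R (I x)) (I y) +
      (g (R y) x + g (R (I y)) (I x))) - t / 6 * g x y := fun x y => by
    simp only [A₂, LinearMap.sub_apply, LinearMap.smul_apply, LinearMap.add_apply,
      LinearMap.comp_apply, map_sub, map_smul, map_add, smul_eq_mul, hA₁, hR', hII (R _),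
      hII (R' _)]
    ring
  have hB₂ : ∀ x y, g (B₂ x) y = 1 / 4 * (g (R x) y + g (R (I x)) (I y) -
      (g (R y) x + g (R (I y)) (I x))) - s / 6 * g (I x) y := fun x y => by
    simp only [B₂, LinearMap.sub_apply, LinearMap.smul_apply,
      LinearMap.comp_apply, map_sub, map_smul, smul_eq_mul, hB₁, hR', hII (R _),
      hII (R' _)]
    ring
  have hA₃ : ∀ x y, g (A₃ x) y = 1 / 2 * (g (R x) y - g (R (I x)) (I y)) := fun x y => by
    simp only [A₃, LinearMap.smul_apply, LinearMap.add_apply,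
      LinearMap.comp_apply, map_smul, map_add, smul_eq_mul, hII (R _)]
    ring
  have hW₂ : ∀ A : V →ₗ[ℝ] V, (∀ x, A (I x) = I (A x)) → ∑ i, g (A (e i)) (e i) = 0 →
      ∑ i, g (A (e i)) (I (e i)) = 0 → ψ.comp A ∈ spaceW₂ fun x => I x := fun A hA h₁ h₂ =>
    ⟨h.comp_mem_spaceW (R := A) fun _ _ _ => rfl, h.sum_cyclic_eq_zero hA he h₁ h₂⟩
  have hsum : ∑ i, g (R (e i)) (e i) = t := rfl
  have hsum' : ∑ i, g (R (e i)) (I (e i)) = s := rfl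
  let p : TorsionClass → Tensor₃ V × (V →ₗ[ℝ] ℝ)
    | .W1plus => (ψ.comp A₁, 0)
    | .W1minus => (ψ.comp B₁, 0)
    | .W2plus => (ψ.comp A₂, 0)
    | .W2minus => (ψ.comp B₂, 0)
    | .W3 => (ψ.comp A₃, 0)
    | .W4 => 0
    | .W5 => (0, η)
  have hzero : ∀ A : V →ₗ[ℝ] V, (∀ x y, g (A x) y = 0) → (ψ.comp A, (0 : V →ₗ[ℝ] ℝ)) = 0 :=
    fun A hA => by
      have : A = 0 := by
        ext x; exact h.eq_of_inner_left fun z => by simp [hA]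
      rw [this, LinearMap.comp_zero]; rfl
  refine ⟨p, fun c => ?_, fun c hc => ?_, ?_⟩
  · cases c
    case W1plus =>
      refine ⟨h.comp_mem_signPart ⟨h.comp_mem_spaceW (R := A₁) fun _ _ _ => rfl, fun x z => ?_⟩
        fun x y => ?_, rfl⟩
      · simp [A₁, h.self₁₂]
      · rw [hA₁, hA₁, h.symm]; ring
    case W1minus =>
      refine ⟨h.comp_mem_signPart ⟨h.comp_mem_spaceW (R := B₁) fun _ _ _ => rfl, fun x z => ?_⟩
        fun x y => ?_, rfl⟩
      · have : ψ (I x) x z = 0 := by linarith [h.I_slide x x z, h.swap₁₂ x (I x) z]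
        simp [B₁, this]
      · rw [hB₁, hB₁, hsym]; ring
    case W2plus =>
      refine ⟨h.comp_mem_signPart (hW₂ A₂ (fun x => h.eq_of_inner_left fun z => ?_) ?_ ?_)
        fun x y => ?_, rfl⟩
      · rw [hII (A₂ x), hA₂, hA₂]
        simp only [h.I_sq, map_neg, LinearMap.neg_apply, hII x z]; ring
      · simp only [hA₂, Finset.sum_sub_distrib, ← Finset.mul_sum, Finset.sum_add_distrib, hn, ht',
          hsum]
        push_cast; ring
      · simp only [hA₂, Finset.sum_sub_distrib, ← Finset.mul_sum, Finset.sum_add_distrib, hz, h.I_sq,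
          map_neg, LinearMap.neg_apply, Finset.sum_neg_distrib, hs', hsum']
        ring
      · rw [hA₂, hA₂, h.symm y x]; ring
    case W2minus =>
      refine ⟨h.comp_mem_signPart (hW₂ B₂ (fun x => h.eq_of_inner_left fun z => ?_) ?_ ?_)
        fun x y => ?_, rfl⟩
      · rw [hII (B₂ x), hB₂, hB₂]
        simp only [h.I_sq, map_neg, LinearMap.neg_apply, h.I_isom]; ring
      · simp only [hB₂, Finset.sum_sub_distrib, ← Finset.mul_sum, Finset.sum_add_distrib,
          h.inner_I_self, ht', hsum]
        ring
      · simp only [hB₂, Finset.sum_sub_distrib, ← Finset.mul_sum, Finset.sum_add_distrib, h.I_isom,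
          hn, h.I_sq, map_neg, LinearMap.neg_apply, Finset.sum_neg_distrib, hs', hsum']
        push_cast; ring
      · rw [hB₂, hB₂, hsym y x]; ring
    case W3 =>
      refine ⟨⟨h.comp_mem_spaceW (R := A₃) fun _ _ _ => rfl, fun x y z => ?_, fun z => ?_⟩, rfl⟩
      · have hI : A₃ (I x) = -I (A₃ x) := h.eq_of_inner_left fun z => by
          rw [map_neg, LinearMap.neg_apply, hII (A₃ x), hA₃, hA₃]
          simp only [h.I_sq, map_neg, LinearMap.neg_apply]; ring
        change ψ (A₃ (I x)) (I y) z = ψ (A₃ x) y z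
        rw [← h.I_slide, hI, map_neg I, h.I_sq, neg_neg]
      -- The contraction vanishes because `A₃` is symmetric and `ψ` is skew. Here `hR` keeps `𝒲₄`
      -- out of the decomposition.
      · have hs₃ : ∀ x y, g (A₃ x) y = g (A₃ y) x := fun x y => by rw [hA₃, hA₃, hR]
        have h₁ : ∀ i, ψ (A₃ (e i)) (e i) z =
            ∑ j, ψ (e j) (e i) z * g (A₃ (e i)) (e j) := fun i =>
          (h.sum_inner_mul he ((ψ.flip (e i)).flip z) (A₃ (e i))).symm
        have h₂ : ∑ i, ∑ j, ψ (e j) (e i) z * g (A₃ (e i)) (e j) =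
            -∑ i, ∑ j, ψ (e j) (e i) z * g (A₃ (e i)) (e j) := by
          conv_rhs => rw [Finset.sum_comm]
          simp only [← Finset.sum_neg_distrib]
          exact Finset.sum_congr rfl fun i _ => Finset.sum_congr rfl fun j _ => by
            rw [h.swap₁₂, hs₃]; ring
        change ∑ i, ψ (A₃ (e i)) (e i) z = 0
        simp only [h₁]
        linarith
    case W4 => exact zero_mem _
    case W5 => exact ⟨rfl, trivial⟩
  · have hcomp : ∀ c ≠ .W5, h.component c (ψ.comp R, η) =
        formComponent (fun x y => g x y) (fun x => I x) c fun x y => g (R x) y := fun c hc =>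
      h.component_comp (R := R) (fun _ _ _ => rfl) η hc
    cases c
    case W5 =>
      have : η = 0 := by ext x; exact congrFun (congrFun hc x) x
      simp [p, this]
    case W4 => rfl
    all_goals
      rw [hcomp _ (by simp)] at hc
      refine hzero _ fun x y => ?_
      have := congrFun (congrFun hc x) y
      simp only [formComponent, LinearMap.coe_mk, AddHom.coe_mk, Pi.zero_apply, ← hedef, hsum,
        hsum'] at this
      simp only [hA₁, hB₁, hA₂, hB₂, hA₃]
      first | linarith | (rw [this]; ring)
  · refine Prod.ext ?_ (by simp [p])
    ext x y z
    simp [p, A₁, B₁, A₂, B₂, A₃]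
    ring

/-- Membership in a sum of torsion modules that does not involve `𝒲₄`. -/
theorem mem_iSup_torsion_iff (h : IsSU3 g I ψ) (R : V →ₗ[ℝ] V) (η : V →ₗ[ℝ] ℝ)
    (hR : ∀ x y, g (R x) y - g (R (I x)) (I y) = g (R y) x - g (R (I y)) (I x))
    {C : Set TorsionClass} (hC : .W4 ∉ C) :
    (ψ.comp R, η) ∈ ⨆ c ∈ C, h.torsion c ↔ ∀ d ∉ C, h.component d (ψ.comp R, η) = 0 := by
  constructor
  · intro hτ d hd
    have : ⨆ c ∈ C, h.torsion c ≤ LinearMap.ker (h.component d) :=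
      iSup₂_le fun c hc τ hτ => h.component_eq_zero (fun hcd : c = d => hd (hcd ▸ hc))
        (fun hc₄ : c = .W4 => hC (hc₄ ▸ hc)) hτ
    exact this hτ
  · intro hd
    obtain ⟨p, hp, hp₀, hsum⟩ := h.exists_decomposition R η hR
    -- A summand with label outside `C` is zero because its component is.
    have hmem : ∀ c, p c ∈ ⨆ c ∈ C, h.torsion c := fun c => by
      by_cases hc : c ∈ C
      · exact (le_iSup₂ (f := fun c (_ : c ∈ C) => h.torsion c) c hc) (hp c)
      · rw [hp₀ c (hd c hc)]; exact zero_mem _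
    rw [hsum]
    exact add_mem (add_mem (add_mem (add_mem (add_mem (hmem _) (hmem _)) (hmem _)) (hmem _))
      (hmem _)) (hmem _)

end IsSU3

end TorsionDecomposition

/-! ### Coordinate frames and vector fields in the preferred charts. -/

section Charts

variable {k : ℕ} {M : Type*} [TopologicalSpace M] [ChartedSpace (EuclideanSpace ℝ (Fin k)) M]

/-- The range of the model is the whole space, so derivatives within it are derivatives; the
identities for inverse charts are applied in the relative form. -/
theorem coordFrame_eq (m : M) (x : EuclideanSpace ℝ (Fin k)) : coordFrame m x =
    mfderivWithin 𝓘(ℝ, EuclideanSpace ℝ (Fin k)) (𝓡 k) (extChartAt (𝓡 k) m).symm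
      (Set.range (𝓡 k)) x := by
  rw [ModelWithCorners.range_eq_univ, mfderivWithin_univ]; rfl

theorem chart_symm_self (m : M) :
    (extChartAt (𝓡 k) m).symm (extChartAt (𝓡 k) m m) = m :=
  extChartAt_to_inv (I := 𝓡 k) m

variable [IsManifold (𝓡 k) ∞ M]

theorem coordFrame_self (m : M) : (coordFrame m (extChartAt (𝓡 k) m m) :
    EuclideanSpace ℝ (Fin k) →L[ℝ] EuclideanSpace ℝ (Fin k)) = ContinuousLinearMap.id ℝ _ := by
  have : IsManifold (𝓡 k) 1 M := .of_le (n := ∞) (by simp)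
  rw [coordFrame_eq]
  exact mfderivWithin_range_extChartAt_symm

theorem coordFrame_self_apply (m : M) (v : EuclideanSpace ℝ (Fin k)) :
    (coordFrame m (extChartAt (𝓡 k) m m) v : EuclideanSpace ℝ (Fin k)) = v :=
  DFunLike.congr_fun (coordFrame_self m) v

/-- The derivative of the preferred chart at `m`. -/
def chartDeriv (m : M) (q : M) : TangentSpace (𝓡 k) q →L[ℝ] EuclideanSpace ℝ (Fin k) :=
  mfderiv (𝓡 k) 𝓘(ℝ, EuclideanSpace ℝ (Fin k)) (extChartAt (𝓡 k) m) q

theorem chartDeriv_coordFrame (m : M) {x : EuclideanSpace ℝ (Fin k)}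
    (hx : x ∈ (extChartAt (𝓡 k) m).target) (v : EuclideanSpace ℝ (Fin k)) :
    chartDeriv m ((extChartAt (𝓡 k) m).symm x) (coordFrame m x v) = v := by
  have : IsManifold (𝓡 k) 1 M := .of_le (n := ∞) (by simp)
  rw [coordFrame_eq]
  exact DFunLike.congr_fun (mfderiv_extChartAt_comp_mfderivWithin_extChartAt_symm hx) v

theorem coordFrame_chartDeriv (m : M) {x : EuclideanSpace ℝ (Fin k)}
    (hx : x ∈ (extChartAt (𝓡 k) m).target)
    (v : TangentSpace (𝓡 k) ((extChartAt (𝓡 k) m).symm x)) :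
    coordFrame m x (chartDeriv m ((extChartAt (𝓡 k) m).symm x) v) = v := by
  have : IsManifold (𝓡 k) 1 M := .of_le (n := ∞) (by simp)
  rw [coordFrame_eq]
  exact DFunLike.congr_fun (mfderivWithin_extChartAt_symm_comp_mfderiv_extChartAt hx) v

/-- The link between smooth sections of the tangent bundle and smooth components in a chart. -/
theorem trivializationAt_eq_chartDeriv {p q : M} (hq : q ∈ (chartAt (EuclideanSpace ℝ (Fin k)) p).source)
    (v : TangentSpace (𝓡 k) q) : (trivializationAt (EuclideanSpace ℝ (Fin k))
      (TangentSpace (𝓡 k)) p (⟨q, v⟩ : TangentBundle (𝓡 k) M)).2 = chartDeriv p q v := by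
  have : IsManifold (𝓡 k) 1 M := .of_le (n := ∞) (by simp)
  rw [chartDeriv, ← TangentBundle.continuousLinearMapAt_trivializationAt hq,
    Trivialization.continuousLinearMapAt_apply_of_mem]
  exact hq

/-- In the trivialization at `m` the coordinate field has the constant components `v`. -/
theorem contMDiffAt_coordFrame (m : M) (v : EuclideanSpace ℝ (Fin k)) :
    ContMDiffAt 𝓘(ℝ, EuclideanSpace ℝ (Fin k)) (𝓡 k).tangent ∞
      (fun x => (⟨(extChartAt (𝓡 k) m).symm x, coordFrame m x v⟩ : TangentBundle (𝓡 k) M))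
      (extChartAt (𝓡 k) m m) := by
  have : IsManifold (𝓡 k) 1 M := .of_le (n := ∞) (by simp)
  rw [contMDiffAt_totalSpace]
  refine ⟨(contMDiffOn_extChartAt_symm m).contMDiffAt (extChartAt_target_mem_nhds m), ?_⟩
  refine (contMDiffAt_const (c := v)).congr_of_eventuallyEq ?_
  filter_upwards [extChartAt_target_mem_nhds (I := 𝓡 k) m] with x hx
  have hs := (extChartAt (𝓡 k) m).map_target hx
  rw [extChartAt_source] at hs
  simp only [chart_symm_self]
  exact (trivializationAt_eq_chartDeriv hs _).trans (chartDeriv_coordFrame m hx v)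

/-- The components of a vector field in the preferred chart are differentiable. -/
theorem contMDiffAt_chartDeriv {E : Type*} [NormedAddCommGroup E] [NormedSpace ℝ E]
    {H : Type*} [TopologicalSpace H] {J : ModelWithCorners ℝ E H} {N : Type*} [TopologicalSpace N]
    [ChartedSpace H N] {f : N → M} {n : ∀ q, TangentSpace (𝓡 k) (f q)}
    {q : N} (h : ContMDiffAt J (𝓡 k).tangent ∞
      (fun q => (⟨f q, n q⟩ : TangentBundle (𝓡 k) M)) q) :
    ContMDiffAt J 𝓘(ℝ, EuclideanSpace ℝ (Fin k)) ∞ (fun q' => chartDeriv (f q) (f q') (n q')) q := by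
  have : IsManifold (𝓡 k) 1 M := .of_le (n := ∞) (by simp)
  rw [contMDiffAt_totalSpace] at h
  refine h.2.congr_of_eventuallyEq ?_
  filter_upwards [h.1.continuousAt.preimage_mem_nhds (extChartAt_source_mem_nhds (I := 𝓡 k) (f q))]
    with q' hq'
  rw [Set.mem_preimage, extChartAt_source] at hq'
  exact (trivializationAt_eq_chartDeriv hq' _).symm

end Charts

/-! ### Coordinate expressions of the metric and of `φ` as differentiable maps. -/

section SmoothTensors

set_option maxSynthPendingDepth 3

section TensorToCLM

variable {E : Type*} [NormedAddCommGroup E] [NormedSpace ℝ E] [FiniteDimensional ℝ E]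

/-- The continuous linear map associated with a bilinear form. -/
def bilinToCLM : (E →ₗ[ℝ] E →ₗ[ℝ] ℝ) →ₗ[ℝ] (E →L[ℝ] E →L[ℝ] ℝ) :=
  (LinearMap.toContinuousLinearMap : (E →ₗ[ℝ] (E →L[ℝ] ℝ)) ≃ₗ[ℝ] _).toLinearMap ∘ₗ
    LinearMap.llcomp ℝ E (E →ₗ[ℝ] ℝ) (E →L[ℝ] ℝ)
      (LinearMap.toContinuousLinearMap : (E →ₗ[ℝ] ℝ) ≃ₗ[ℝ] _).toLinearMap

/-- The continuous linear map associated with a trilinear form. -/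
def trilinToCLM (b : Tensor₃ E) : E →L[ℝ] E →L[ℝ] E →L[ℝ] ℝ :=
  LinearMap.toContinuousLinearMap (bilinToCLM ∘ₗ b)

@[simp] theorem trilinToCLM_apply (b : Tensor₃ E) (x y z : E) :
    trilinToCLM b x y z = b x y z := rfl

end TensorToCLM

section ScalarProducts

/-- A bilinear form from a function that is linear in each variable. -/
def bilinMk {V : Type*} [AddCommGroup V] [Module ℝ V] (f : V → V → ℝ)
    (h₁ : ∀ y, IsLinearMap ℝ fun x => f x y) (h₂ : ∀ x, IsLinearMap ℝ fun y => f x y) :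
    V →ₗ[ℝ] V →ₗ[ℝ] ℝ where
  toFun x := (h₂ x).mk'
  map_add' a b := by ext y; exact (h₁ y).1 a b
  map_smul' c a := by ext y; exact (h₁ y).2 c a

end ScalarProducts

namespace G2Structure

variable {N : Type*} [TopologicalSpace N] [ChartedSpace (EuclideanSpace ℝ (Fin 7)) N]
  [IsManifold (𝓡 7) ∞ N] (G : G2Structure N)

/-- The metric at a point, as a bilinear form. -/
def gLin (p : N) : TangentSpace (𝓡 7) p →ₗ[ℝ] TangentSpace (𝓡 7) p →ₗ[ℝ] ℝ :=
  bilinMk (G.g p) (fun y => ⟨fun a b => by simp [g], fun c a => by simp [g]⟩)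
    (fun y => ⟨fun a b => by simp [g], fun c a => by simp [g]⟩)

theorem gLin_apply (p : N) (x y : TangentSpace (𝓡 7) p) : G.gLin p x y = G.g p x y := rfl

theorem isScalarProduct (p : N) : IsScalarProduct 7 (G.gLin p) where
  finrank := finrank_euclideanSpace_fin (𝕜 := ℝ) (n := 7)
  finite := inferInstanceAs (FiniteDimensional ℝ (EuclideanSpace ℝ (Fin 7)))
  symm := G.metric.symm p
  pos := G.metric.pos p

/-- The fundamental form at a point, as a trilinear form. -/
def φLin (p : N) : Tensor₃ (TangentSpace (𝓡 7) p) := cayleyForm (G.gLin p) (G.cayleyFrame p)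

theorem φLin_apply (p : N) (x y z : TangentSpace (𝓡 7) p) : G.φLin p x y z = G.φ p x y z :=
  ((G.exists_cayleyFrame p).choose_spec.2 x y z).symm

/-- The dual four-form at a point, as a four-linear form. -/
def starLin (p : N) : Tensor₄ (TangentSpace (𝓡 7) p) := cayleyStar (G.gLin p) (G.cayleyFrame p)

theorem starLin_apply (p : N) (x y z w : TangentSpace (𝓡 7) p) :
    G.starLin p x y z w = G.starφ p x y z w := rfl

theorem isG2 (p : N) : IsG2 (G.gLin p) (G.φLin p) (G.starLin p) :=
  isG2_of_frame (G.isScalarProduct p) (G.exists_cayleyFrame p).choose_spec.1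

/-- The components of the metric in the preferred chart at `p`. -/
def metricRep (p : N) (y : EuclideanSpace ℝ (Fin 7)) :
    EuclideanSpace ℝ (Fin 7) →L[ℝ] EuclideanSpace ℝ (Fin 7) →L[ℝ] ℝ :=
  bilinToCLM ((G.gLin ((extChartAt (𝓡 7) p).symm y)).compl₁₂ (coordFrame p y).toLinearMap
    (coordFrame p y).toLinearMap)

theorem metricRep_apply (p : N) (y u v : EuclideanSpace ℝ (Fin 7)) : G.metricRep p y u v =
    G.g ((extChartAt (𝓡 7) p).symm y) (coordFrame p y u) (coordFrame p y v) := rfl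

/-- The components of the fundamental form in the preferred chart at `p`. -/
def formRep (p : N) (y : EuclideanSpace ℝ (Fin 7)) : EuclideanSpace ℝ (Fin 7) →L[ℝ]
    EuclideanSpace ℝ (Fin 7) →L[ℝ] EuclideanSpace ℝ (Fin 7) →L[ℝ] ℝ :=
  trilinToCLM ((G.φLin ((extChartAt (𝓡 7) p).symm y)).comap (coordFrame p y).toLinearMap)

theorem formRep_apply (p : N) (y u v w : EuclideanSpace ℝ (Fin 7)) : G.formRep p y u v w =
    G.φ ((extChartAt (𝓡 7) p).symm y) (coordFrame p y u) (coordFrame p y v) (coordFrame p y w) := by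
  rw [formRep, trilinToCLM_apply, Tensor₃.comap_apply]
  exact G.φLin_apply _ _ _ _

/-- A space of linear maps on a finite-dimensional space is a power of the target, so
differentiability can be tested on single vectors. -/
theorem _root_.differentiableAt_clm {D E F : Type*} [NormedAddCommGroup D] [NormedSpace ℝ D]
    [NormedAddCommGroup E] [NormedSpace ℝ E] [FiniteDimensional ℝ E] [NormedAddCommGroup F]
    [NormedSpace ℝ F] {f : D → E →L[ℝ] F} {x : D}
    (h : ∀ v, DifferentiableAt ℝ (fun y => f y v) x) : DifferentiableAt ℝ f x := by
  let d := Module.finrank ℝ E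
  have hd : d = Module.finrank ℝ (Fin d → ℝ) := (Module.finrank_fin_fun ℝ).symm
  let e₁ := ContinuousLinearEquiv.ofFinrankEq hd
  let e₂ := (e₁.arrowCongr (1 : F ≃L[ℝ] F)).trans (ContinuousLinearEquiv.piRing (Fin d))
  rw [← Function.id_comp f, ← e₂.symm_comp_self]
  refine e₂.symm.differentiableAt.comp x (differentiableAt_pi.2 fun i => ?_)
  exact h (e₁.symm (Pi.single i 1))

theorem differentiableAt_formRep (p : N) :
    DifferentiableAt ℝ (G.formRep p) (extChartAt (𝓡 7) p p) := by
  refine differentiableAt_clm fun u => differentiableAt_clm fun v => differentiableAt_clm fun w => ?_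
  simp only [formRep_apply]
  exact ((G.φ_smooth p u v w).contDiffAt (extChartAt_target_mem_nhds p)).differentiableAt (by simp)

/-- The smooth section `metric` is evaluated on two smooth coordinate fields. -/
theorem differentiableAt_metricRep (p : N) :
    DifferentiableAt ℝ (G.metricRep p) (extChartAt (𝓡 7) p p) := by
  refine differentiableAt_clm fun u => differentiableAt_clm fun v => ?_
  simp only [metricRep_apply]
  have hb : ContMDiffAt 𝓘(ℝ, EuclideanSpace ℝ (Fin 7)) (𝓡 7) ∞ (extChartAt (𝓡 7) p).symm
      (extChartAt (𝓡 7) p p) :=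
    (contMDiffOn_extChartAt_symm p).contMDiffAt (extChartAt_target_mem_nhds p)
  have h := ContMDiffAt.clm_bundle_apply₂ (F₁ := EuclideanSpace ℝ (Fin 7))
    (F₂ := EuclideanSpace ℝ (Fin 7)) (F₃ := ℝ) (E₃ := Bundle.Trivial N ℝ)
    (G.metric.contMDiff.contMDiffAt.comp _ hb) (contMDiffAt_coordFrame p u)
    (contMDiffAt_coordFrame p v)
  rw [contMDiffAt_totalSpace] at h
  exact h.2.contDiffAt.differentiableAt (by simp)

end G2Structure

section Congruence

variable {k : ℕ} {M : Type*} [TopologicalSpace M] [ChartedSpace (EuclideanSpace ℝ (Fin k)) M]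

/-- The base points are equal only propositionally, so the tangent spaces are different types;
vectors are compared in the common model space. -/
theorem tensor₂_congr (T : ∀ q : M, TangentSpace (𝓡 k) q → TangentSpace (𝓡 k) q → ℝ) {q q' : M}
    (h : q = q') {u v u' v' : EuclideanSpace ℝ (Fin k)} (hu : u = u') (hv : v = v') :
    T q u v = T q' u' v' := by
  subst h hu hv; rfl

theorem tensor₃_congr (T : ∀ q : M, TangentSpace (𝓡 k) q → TangentSpace (𝓡 k) q →
    TangentSpace (𝓡 k) q → ℝ) {q q' : M} (h : q = q')
    {u v w u' v' w' : EuclideanSpace ℝ (Fin k)} (hu : u = u') (hv : v = v') (hw : w = w') :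
    T q u v w = T q' u' v' w' := by
  subst h hu hv hw; rfl

theorem partial₂_eq {T : ∀ q : M, TangentSpace (𝓡 k) q → TangentSpace (𝓡 k) q → ℝ} {m : M}
    {v w : EuclideanSpace ℝ (Fin k)} {f : EuclideanSpace ℝ (Fin k) → ℝ}
    {f' : EuclideanSpace ℝ (Fin k) →L[ℝ] ℝ} (hf : HasFDerivAt f f' (extChartAt (𝓡 k) m m))
    (h : ∀ᶠ x in 𝓝 (extChartAt (𝓡 k) m m),
      T ((extChartAt (𝓡 k) m).symm x) (coordFrame m x v) (coordFrame m x w) = f x)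
    (u : EuclideanSpace ℝ (Fin k)) : partial₂ T m u v w = f' u :=
  DFunLike.congr_fun (hf.congr_of_eventuallyEq h).fderiv u

theorem partial₃_eq {T : ∀ q : M, TangentSpace (𝓡 k) q → TangentSpace (𝓡 k) q →
    TangentSpace (𝓡 k) q → ℝ} {m : M}
    {v w z : EuclideanSpace ℝ (Fin k)} {f : EuclideanSpace ℝ (Fin k) → ℝ}
    {f' : EuclideanSpace ℝ (Fin k) →L[ℝ] ℝ} (hf : HasFDerivAt f f' (extChartAt (𝓡 k) m m))
    (h : ∀ᶠ x in 𝓝 (extChartAt (𝓡 k) m m), T ((extChartAt (𝓡 k) m).symm x) (coordFrame m x v)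
      (coordFrame m x w) (coordFrame m x z) = f x)
    (u : EuclideanSpace ℝ (Fin k)) : partial₃ T m u v w z = f' u :=
  DFunLike.congr_fun (hf.congr_of_eventuallyEq h).fderiv u

variable [IsManifold (𝓡 k) ∞ M]

theorem chartDeriv_self (m : M) (v : TangentSpace (𝓡 k) m) : chartDeriv m m v = v := by
  have : IsManifold (𝓡 k) 1 M := .of_le (n := ∞) (by simp)
  have h := mfderiv_extChartAt_self (I := 𝓡 k) (x := m)
  rw [chartDeriv, h]
  rfl

theorem coordFrame_chartDeriv_of_mem {m q : M} (hq : q ∈ (extChartAt (𝓡 k) m).source)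
    (v : TangentSpace (𝓡 k) q) :
    (coordFrame m (extChartAt (𝓡 k) m q) (chartDeriv m q v) : EuclideanSpace ℝ (Fin k)) = v := by
  have : IsManifold (𝓡 k) 1 M := .of_le (n := ∞) (by simp)
  rw [coordFrame_eq]
  exact DFunLike.congr_fun (mfderivWithin_extChartAt_symm_comp_mfderiv_extChartAt' hq) v

end Congruence

namespace G2Structure

variable {N : Type*} [TopologicalSpace N] [ChartedSpace (EuclideanSpace ℝ (Fin 7)) N]
  [IsManifold (𝓡 7) ∞ N] (G : G2Structure N)

theorem metricRep_self (p : N) (u v : EuclideanSpace ℝ (Fin 7)) :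
    G.metricRep p (extChartAt (𝓡 7) p p) u v = G.g p u v :=
  (G.metricRep_apply p _ u v).trans <| tensor₂_congr G.g (chart_symm_self p)
    (coordFrame_self_apply p u) (coordFrame_self_apply p v)

theorem formRep_self (p : N) (u v w : EuclideanSpace ℝ (Fin 7)) :
    G.formRep p (extChartAt (𝓡 7) p p) u v w = G.φ p u v w :=
  (G.formRep_apply p _ u v w).trans <| tensor₃_congr G.φ (chart_symm_self p)
    (coordFrame_self_apply p u) (coordFrame_self_apply p v) (coordFrame_self_apply p w)

theorem partial₂_metric (p : N) (u v w : EuclideanSpace ℝ (Fin 7)) : partial₂ G.g p u v w =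
    fderiv ℝ (G.metricRep p) (extChartAt (𝓡 7) p p) u v w := by
  have h := (((G.differentiableAt_metricRep p).hasFDerivAt.clm_apply
    (hasFDerivAt_const v _)).clm_apply (hasFDerivAt_const w _))
  exact (partial₂_eq h (.of_forall fun y => (G.metricRep_apply p y v w).symm) u).trans (by simp)

theorem partial₃_form (p : N) (u v w z : EuclideanSpace ℝ (Fin 7)) : partial₃ G.φ p u v w z =
    fderiv ℝ (G.formRep p) (extChartAt (𝓡 7) p p) u v w z := by
  have h := ((((G.differentiableAt_formRep p).hasFDerivAt.clm_apply
    (hasFDerivAt_const v _)).clm_apply (hasFDerivAt_const w _)).clm_apply (hasFDerivAt_const z _))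
  exact (partial₃_eq h (.of_forall fun y => (G.formRep_apply p y v w z).symm) u).trans (by simp)

end G2Structure

/-! ### The immersion and its unit normal in charts. -/

namespace Hypersurface

variable {N : Type*} [TopologicalSpace N] [ChartedSpace (EuclideanSpace ℝ (Fin 7)) N]
  [IsManifold (𝓡 7) ∞ N] {G : G2Structure N} {M : Type*} [TopologicalSpace M]
  [ChartedSpace (EuclideanSpace ℝ (Fin 6)) M] [IsManifold (𝓡 6) ∞ M] (X : Hypersurface G M)

/-- The immersion in the preferred charts at `m` and `ι m`. -/
abbrev immersionRep (m : M) : EuclideanSpace ℝ (Fin 6) → EuclideanSpace ℝ (Fin 7) :=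
  writtenInExtChartAt (𝓡 6) (𝓡 7) m X.ι

/-- The unit normal vector field in the preferred charts at `m` and `ι m`. -/
def normalRep (m : M) (x : EuclideanSpace ℝ (Fin 6)) : EuclideanSpace ℝ (Fin 7) :=
  chartDeriv (X.ι m) (X.ι ((extChartAt (𝓡 6) m).symm x)) (X.n ((extChartAt (𝓡 6) m).symm x))

theorem immersionRep_apply (m : M) (x : EuclideanSpace ℝ (Fin 6)) : X.immersionRep m x =
    extChartAt (𝓡 7) (X.ι m) (X.ι ((extChartAt (𝓡 6) m).symm x)) := rfl

theorem immersionRep_self (m : M) : X.immersionRep m (extChartAt (𝓡 6) m m) =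
    extChartAt (𝓡 7) (X.ι m) (X.ι m) := by
  rw [immersionRep_apply, chart_symm_self]

theorem contDiffAt_immersionRep (m : M) :
    ContDiffAt ℝ ∞ (X.immersionRep m) (extChartAt (𝓡 6) m m) := by
  have h := (contMDiffAt_iff.1 (X.ι_smooth m)).2
  rw [ModelWithCorners.range_eq_univ, contDiffWithinAt_univ] at h
  exact h

theorem differentiableAt_normalRep (m : M) :
    DifferentiableAt ℝ (X.normalRep m) (extChartAt (𝓡 6) m m) := by
  have h₁ := contMDiffAt_chartDeriv (X.n_smooth m)
  have h₂ : ContMDiffAt 𝓘(ℝ, EuclideanSpace ℝ (Fin 6)) (𝓡 6) ∞ (extChartAt (𝓡 6) m).symm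
      (extChartAt (𝓡 6) m m) :=
    (contMDiffOn_extChartAt_symm m).contMDiffAt (extChartAt_target_mem_nhds m)
  have h₃ := ContMDiffAt.comp_of_eq (x := extChartAt (𝓡 6) m m) h₁ h₂ (chart_symm_self m)
  exact h₃.contDiffAt.differentiableAt (by simp)

theorem eventually_mem_chart (m : M) : ∀ᶠ x in 𝓝 (extChartAt (𝓡 6) m m),
    x ∈ (extChartAt (𝓡 6) m).target ∧
      X.ι ((extChartAt (𝓡 6) m).symm x) ∈ (extChartAt (𝓡 7) (X.ι m)).source := by
  have hc : ContinuousAt (fun x => X.ι ((extChartAt (𝓡 6) m).symm x)) (extChartAt (𝓡 6) m m) :=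
    ContinuousAt.comp (x := extChartAt (𝓡 6) m m) X.ι_smooth.continuous.continuousAt
      (continuousAt_extChartAt_symm m)
  have hs : (extChartAt (𝓡 7) (X.ι m)).source ∈
      𝓝 (X.ι ((extChartAt (𝓡 6) m).symm (extChartAt (𝓡 6) m m))) := by
    rw [chart_symm_self]
    exact extChartAt_source_mem_nhds (I := 𝓡 7) (X.ι m)
  filter_upwards [extChartAt_target_mem_nhds (I := 𝓡 6) m, hc.preimage_mem_nhds hs] with x h₁ h₂
  exact ⟨h₁, h₂⟩

/-- The chain rule for the two factorisations of `ι` through the charts. It is needed on a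
neighbourhood because the identity is differentiated later. -/
theorem push_coordFrame (m : M) : ∀ᶠ x in 𝓝 (extChartAt (𝓡 6) m m), ∀ u,
    (X.push ((extChartAt (𝓡 6) m).symm x) (coordFrame m x u) : EuclideanSpace ℝ (Fin 7)) =
      coordFrame (X.ι m) (X.immersionRep m x) (fderiv ℝ (X.immersionRep m) x u) := by
  filter_upwards [(X.eventually_mem_chart m).eventually_nhds,
    ((X.contDiffAt_immersionRep m).of_le (m := 1) (by simp)).eventually (by simp)] with x hx hd u
  obtain ⟨hx₁, hx₂⟩ := hx.self_of_nhds
  have h₁ : MDifferentiableAt 𝓘(ℝ, EuclideanSpace ℝ (Fin 6)) (𝓡 6) (extChartAt (𝓡 6) m).symm x :=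
    ((contMDiffOn_extChartAt_symm (n := ∞) m).contMDiffAt
      ((isOpen_extChartAt_target m).mem_nhds hx₁)).mdifferentiableAt (by simp)
  have hF : X.immersionRep m x ∈ (extChartAt (𝓡 7) (X.ι m)).target :=
    (extChartAt (𝓡 7) (X.ι m)).map_source hx₂
  have h₂ : MDifferentiableAt 𝓘(ℝ, EuclideanSpace ℝ (Fin 7)) (𝓡 7)
      (extChartAt (𝓡 7) (X.ι m)).symm (X.immersionRep m x) :=
    ((contMDiffOn_extChartAt_symm (n := ∞) (X.ι m)).contMDiffAt
      ((isOpen_extChartAt_target (X.ι m)).mem_nhds hF)).mdifferentiableAt (by simp)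
  have h₃ : MDifferentiableAt 𝓘(ℝ, EuclideanSpace ℝ (Fin 6)) 𝓘(ℝ, EuclideanSpace ℝ (Fin 7))
      (X.immersionRep m) x := (hd.differentiableAt (by simp)).mdifferentiableAt
  have h₄ : MDifferentiableAt (𝓡 6) (𝓡 7) X.ι ((extChartAt (𝓡 6) m).symm x) :=
    X.ι_smooth.mdifferentiableAt (by simp)
  have hev : (X.ι ∘ (extChartAt (𝓡 6) m).symm) =ᶠ[𝓝 x]
      ((extChartAt (𝓡 7) (X.ι m)).symm ∘ X.immersionRep m) := by
    filter_upwards [hx] with x' hx'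
    exact ((extChartAt (𝓡 7) (X.ι m)).left_inv hx'.2).symm
  have h₅ := hev.mfderiv_eq (I := 𝓘(ℝ, EuclideanSpace ℝ (Fin 6))) (I' := 𝓡 7)
  rw [mfderiv_comp x h₄ h₁, mfderiv_comp x h₂ h₃, mfderiv_eq_fderiv] at h₅
  exact DFunLike.congr_fun h₅ u

theorem chart_symm_immersionRep (m : M) : ∀ᶠ x in 𝓝 (extChartAt (𝓡 6) m m),
    X.ι ((extChartAt (𝓡 6) m).symm x) =
      (extChartAt (𝓡 7) (X.ι m)).symm (X.immersionRep m x) := by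
  filter_upwards [X.eventually_mem_chart m] with x hx
  exact ((extChartAt (𝓡 7) (X.ι m)).left_inv hx.2).symm

theorem normal_eq (m : M) : ∀ᶠ x in 𝓝 (extChartAt (𝓡 6) m m),
    (X.n ((extChartAt (𝓡 6) m).symm x) : EuclideanSpace ℝ (Fin 7)) =
      coordFrame (X.ι m) (X.immersionRep m x) (X.normalRep m x) := by
  filter_upwards [X.eventually_mem_chart m] with x hx
  exact (coordFrame_chartDeriv_of_mem hx.2 _).symm

theorem normalRep_self (m : M) : X.normalRep m (extChartAt (𝓡 6) m m) = X.n m := by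
  have h : ∀ q, q = m → (chartDeriv (X.ι m) (X.ι q) (X.n q) : EuclideanSpace ℝ (Fin 7)) =
      X.n m := by
    rintro _ rfl
    exact chartDeriv_self _ _
  exact h _ (chart_symm_self m)

end Hypersurface

/-! ### Christoffel symbols and the Koszul formula. -/

section Christoffel

variable {k : ℕ} {M : Type*} [TopologicalSpace M] [ChartedSpace (EuclideanSpace ℝ (Fin k)) M]
  {g : ∀ m : M, TangentSpace (𝓡 k) m → TangentSpace (𝓡 k) m → ℝ} {m : M}
  {gL : TangentSpace (𝓡 k) m →ₗ[ℝ] TangentSpace (𝓡 k) m →ₗ[ℝ] ℝ}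
  {P : Tensor₃ (TangentSpace (𝓡 k) m)}

/-- The data needed to compute the Levi-Civita connection at a point: the metric and the
derivatives of its components. -/
structure IsMetricAt (g : ∀ m : M, TangentSpace (𝓡 k) m → TangentSpace (𝓡 k) m → ℝ) (m : M)
    (gL : TangentSpace (𝓡 k) m →ₗ[ℝ] TangentSpace (𝓡 k) m →ₗ[ℝ] ℝ)
    (P : Tensor₃ (TangentSpace (𝓡 k) m)) : Prop extends IsScalarProduct k gL where
  metric_eq : ∀ x y, g m x y = gL x y
  partial_eq : ∀ u v w, partial₂ g m u v w = P u v w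
  partial_symm : ∀ u v w, P u v w = P u w v

namespace IsMetricAt

/-- `christoffel` is a frame expansion; as the Koszul expression is linear in `w`, it may be tested
against any vector. -/
theorem christoffel_spec (h : IsMetricAt g m gL P) (u v w : TangentSpace (𝓡 k) m) :
    gL (christoffel g m u v) w = 1 / 2 * (P u v w + P v u w - P w u v) := by
  have hg : g m = fun x y => gL x y := by ext x y; exact h.metric_eq x y
  have hl : ∀ w, (1 / 2 : ℝ) * (partial₂ g m u v w + partial₂ g m v u w - partial₂ g m w u v) =
      ((1 / 2 : ℝ) • (P u v + P v u - (P.flip u).flip v)) w := fun w => by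
    simp [h.partial_eq]
  rw [christoffel, hg]
  simp only [hl]
  rw [h.sharp_spec]
  simp

theorem christoffel_symm (h : IsMetricAt g m gL P) (u v : TangentSpace (𝓡 k) m) :
    christoffel g m u v = christoffel g m v u :=
  h.eq_of_inner_left fun w => by
    rw [h.christoffel_spec, h.christoffel_spec, h.partial_symm w u v]; ring

/-- The coordinate form of `∇g = 0`. -/
theorem partial_eq_christoffel (h : IsMetricAt g m gL P) (u v w : TangentSpace (𝓡 k) m) :
    P u v w = gL (christoffel g m u v) w + gL v (christoffel g m u w) := by
  rw [h.symm v, h.christoffel_spec, h.christoffel_spec, h.partial_symm v u w, h.partial_symm w u v,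
    h.partial_symm u w v]
  ring

theorem christoffel_add (h : IsMetricAt g m gL P) (u u' v : TangentSpace (𝓡 k) m) :
    christoffel g m (u + u') v = christoffel g m u v + christoffel g m u' v :=
  h.eq_of_inner_left fun w => by
    simp only [h.christoffel_spec, map_add, LinearMap.add_apply]; ring

theorem christoffel_smul (h : IsMetricAt g m gL P) (c : ℝ) (u v : TangentSpace (𝓡 k) m) :
    christoffel g m (c • u) v = c • christoffel g m u v :=
  h.eq_of_inner_left fun w => by
    simp only [h.christoffel_spec, map_smul, LinearMap.smul_apply, smul_eq_mul]; ring

end IsMetricAt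

end Christoffel

namespace G2Structure

variable {N : Type*} [TopologicalSpace N] [ChartedSpace (EuclideanSpace ℝ (Fin 7)) N]
  [IsManifold (𝓡 7) ∞ N] (G : G2Structure N)

/-- The derivatives of the components of the metric, as a trilinear form. -/
def metricPartial (p : N) : Tensor₃ (TangentSpace (𝓡 7) p) :=
  Tensor₃.mk (V := EuclideanSpace ℝ (Fin 7))
    (fun u v w => fderiv ℝ (G.metricRep p) (extChartAt (𝓡 7) p p) u v w)
    (fun _ _ => ⟨by simp, by simp⟩) (fun _ _ => ⟨by simp, by simp⟩) (fun _ _ => ⟨by simp, by simp⟩)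

theorem isMetricAt (p : N) : IsMetricAt G.g p (G.gLin p) (G.metricPartial p) where
  toIsScalarProduct := G.isScalarProduct p
  metric_eq _ _ := rfl
  partial_eq := G.partial₂_metric p
  partial_symm u v w := by
    have h : ∀ u v w : EuclideanSpace ℝ (Fin 7), partial₂ G.g p u v w = partial₂ G.g p u w v := by
      intro u v w
      have : ∀ v w : EuclideanSpace ℝ (Fin 7), (fun x : EuclideanSpace ℝ (Fin 7) =>
          G.g ((extChartAt (𝓡 7) p).symm x) (coordFrame p x v) (coordFrame p x w)) =
          fun x => G.g ((extChartAt (𝓡 7) p).symm x) (coordFrame p x w) (coordFrame p x v) :=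
        fun v w => funext fun x => G.metric.symm _ _ _
      unfold partial₂
      rw [this]
    exact (G.partial₂_metric p u v w).symm.trans ((h u v w).trans (G.partial₂_metric p u w v))

end G2Structure

/-! ### Derivatives of ambient tensors along the hypersurface. -/

namespace Hypersurface

variable {N : Type*} [TopologicalSpace N] [ChartedSpace (EuclideanSpace ℝ (Fin 7)) N]
  [IsManifold (𝓡 7) ∞ N] {G : G2Structure N} {M : Type*} [TopologicalSpace M]
  [ChartedSpace (EuclideanSpace ℝ (Fin 6)) M] [IsManifold (𝓡 6) ∞ M] (X : Hypersurface G M)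

/-- The push-forward, as a linear map. -/
def pushLin (m : M) : TangentSpace (𝓡 6) m →ₗ[ℝ] TangentSpace (𝓡 7) (X.ι m) :=
  (mfderiv (𝓡 6) (𝓡 7) X.ι m).toLinearMap

theorem pushLin_apply (m : M) (x : TangentSpace (𝓡 6) m) : X.pushLin m x = X.push m x := rfl

theorem push_eq_fderiv (m : M) (u : EuclideanSpace ℝ (Fin 6)) :
    (X.push m u : EuclideanSpace ℝ (Fin 7)) =
      fderiv ℝ (X.immersionRep m) (extChartAt (𝓡 6) m m) u := by
  have h := (X.push_coordFrame m).self_of_nhds u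
  have h₁ : ∀ q, q = m → ∀ v w : EuclideanSpace ℝ (Fin 6), v = w →
      (X.push q v : EuclideanSpace ℝ (Fin 7)) = X.push m w := by
    rintro _ rfl _ _ rfl; rfl
  rw [h₁ _ (chart_symm_self m) _ _ (coordFrame_self_apply m u)] at h
  rw [h, X.immersionRep_self]
  exact coordFrame_self_apply _ _

theorem hasFDerivAt_immersionRep (m : M) : HasFDerivAt (X.immersionRep m)
    (fderiv ℝ (X.immersionRep m) (extChartAt (𝓡 6) m m)) (extChartAt (𝓡 6) m m) :=
  ((X.contDiffAt_immersionRep m).differentiableAt (by simp)).hasFDerivAt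

theorem hasFDerivAt_fderiv_immersionRep (m : M) : HasFDerivAt (fderiv ℝ (X.immersionRep m))
    (fderiv ℝ (fderiv ℝ (X.immersionRep m)) (extChartAt (𝓡 6) m m)) (extChartAt (𝓡 6) m m) :=
  (((X.contDiffAt_immersionRep m).fderiv_right (m := 1)
    (WithTop.coe_le_coe.2 (le_top : (1 + 1 : ℕ∞) ≤ ⊤))).differentiableAt
    (by simp)).hasFDerivAt

theorem hessian_symm (m : M) (u v : TangentSpace (𝓡 6) m) :
    X.hessian m u v = X.hessian m v u :=
  ((X.contDiffAt_immersionRep m).isSymmSndFDerivAt (by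
    rw [minSmoothness_of_isRCLikeNormedField]; exact WithTop.coe_le_coe.2 (le_top : (2 : ℕ∞) ≤ ⊤))) u v

theorem hasFDerivAt_push (m : M) (v : EuclideanSpace ℝ (Fin 6)) :
    HasFDerivAt (fun x => fderiv ℝ (X.immersionRep m) x v)
      ((fderiv ℝ (fderiv ℝ (X.immersionRep m)) (extChartAt (𝓡 6) m m)).flip v)
      (extChartAt (𝓡 6) m m) := by
  simpa using (X.hasFDerivAt_fderiv_immersionRep m).clm_apply (hasFDerivAt_const v _)

theorem hasFDerivAt_metricRep (m : M) : HasFDerivAt (fun x => G.metricRep (X.ι m) (X.immersionRep m x))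
    ((fderiv ℝ (G.metricRep (X.ι m)) (extChartAt (𝓡 7) (X.ι m) (X.ι m))).comp
      (fderiv ℝ (X.immersionRep m) (extChartAt (𝓡 6) m m))) (extChartAt (𝓡 6) m m) := by
  have h := (G.differentiableAt_metricRep (X.ι m)).hasFDerivAt
  rw [← X.immersionRep_self] at h ⊢
  exact h.comp _ (X.hasFDerivAt_immersionRep m)

theorem hasFDerivAt_formRep (m : M) : HasFDerivAt (fun x => G.formRep (X.ι m) (X.immersionRep m x))
    ((fderiv ℝ (G.formRep (X.ι m)) (extChartAt (𝓡 7) (X.ι m) (X.ι m))).comp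
      (fderiv ℝ (X.immersionRep m) (extChartAt (𝓡 6) m m))) (extChartAt (𝓡 6) m m) := by
  have h := (G.differentiableAt_formRep (X.ι m)).hasFDerivAt
  rw [← X.immersionRep_self] at h ⊢
  exact h.comp _ (X.hasFDerivAt_immersionRep m)

/-- The derivative of the metric along the hypersurface, for vector fields with given derivatives
in the chart. -/
theorem fderiv_metric (m : M) {a b : EuclideanSpace ℝ (Fin 6) → EuclideanSpace ℝ (Fin 7)}
    {a' b' : EuclideanSpace ℝ (Fin 6) →L[ℝ] EuclideanSpace ℝ (Fin 7)}
    (ha : HasFDerivAt a a' (extChartAt (𝓡 6) m m)) (hb : HasFDerivAt b b' (extChartAt (𝓡 6) m m)) :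
    ∃ L : EuclideanSpace ℝ (Fin 6) →L[ℝ] ℝ,
      HasFDerivAt (fun x => G.metricRep (X.ι m) (X.immersionRep m x) (a x) (b x)) L
        (extChartAt (𝓡 6) m m) ∧
      ∀ u : EuclideanSpace ℝ (Fin 6), L u = partial₂ G.g (X.ι m) (X.push m u)
          (a (extChartAt (𝓡 6) m m)) (b (extChartAt (𝓡 6) m m)) +
        G.g (X.ι m) (a' u) (b (extChartAt (𝓡 6) m m)) +
        G.g (X.ι m) (a (extChartAt (𝓡 6) m m)) (b' u) := by
  refine ⟨_, ((X.hasFDerivAt_metricRep m).clm_apply ha).clm_apply hb, fun u => ?_⟩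
  have h₁ := G.partial₂_metric (X.ι m) (X.push m u) (a (extChartAt (𝓡 6) m m))
    (b (extChartAt (𝓡 6) m m))
  have h₂ := X.push_eq_fderiv m u
  have h₃ := G.metricRep_self (X.ι m)
  rw [h₁, ← h₃, ← h₃, ← X.immersionRep_self, h₂]
  simp
  ring

/-- The derivative of the fundamental form along the hypersurface, for vector fields with given
derivatives in the chart. -/
theorem fderiv_form (m : M) {a b c : EuclideanSpace ℝ (Fin 6) → EuclideanSpace ℝ (Fin 7)}
    {a' b' c' : EuclideanSpace ℝ (Fin 6) →L[ℝ] EuclideanSpace ℝ (Fin 7)}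
    (ha : HasFDerivAt a a' (extChartAt (𝓡 6) m m)) (hb : HasFDerivAt b b' (extChartAt (𝓡 6) m m))
    (hc : HasFDerivAt c c' (extChartAt (𝓡 6) m m)) :
    ∃ L : EuclideanSpace ℝ (Fin 6) →L[ℝ] ℝ,
      HasFDerivAt (fun x => G.formRep (X.ι m) (X.immersionRep m x) (a x) (b x) (c x)) L
        (extChartAt (𝓡 6) m m) ∧
      ∀ u : EuclideanSpace ℝ (Fin 6), L u = partial₃ G.φ (X.ι m) (X.push m u)
          (a (extChartAt (𝓡 6) m m)) (b (extChartAt (𝓡 6) m m)) (c (extChartAt (𝓡 6) m m)) +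
        G.φ (X.ι m) (a' u) (b (extChartAt (𝓡 6) m m)) (c (extChartAt (𝓡 6) m m)) +
        G.φ (X.ι m) (a (extChartAt (𝓡 6) m m)) (b' u) (c (extChartAt (𝓡 6) m m)) +
        G.φ (X.ι m) (a (extChartAt (𝓡 6) m m)) (b (extChartAt (𝓡 6) m m)) (c' u) := by
  refine ⟨_, (((X.hasFDerivAt_formRep m).clm_apply ha).clm_apply hb).clm_apply hc, fun u => ?_⟩
  have h₁ := G.partial₃_form (X.ι m) (X.push m u) (a (extChartAt (𝓡 6) m m))
    (b (extChartAt (𝓡 6) m m)) (c (extChartAt (𝓡 6) m m))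
  have h₂ := X.push_eq_fderiv m u
  have h₃ := G.formRep_self (X.ι m)
  rw [h₁, ← h₃, ← h₃, ← h₃, ← X.immersionRep_self, h₂]
  simp
  ring

end Hypersurface

namespace Hypersurface

variable {N : Type*} [TopologicalSpace N] [ChartedSpace (EuclideanSpace ℝ (Fin 7)) N]
  [IsManifold (𝓡 7) ∞ N] {G : G2Structure N} {M : Type*} [TopologicalSpace M]
  [ChartedSpace (EuclideanSpace ℝ (Fin 6)) M] [IsManifold (𝓡 6) ∞ M] (X : Hypersurface G M)

/-- The induced metric, as a bilinear form. -/
def gLin (m : M) : TangentSpace (𝓡 6) m →ₗ[ℝ] TangentSpace (𝓡 6) m →ₗ[ℝ] ℝ :=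
  (G.gLin (X.ι m)).compl₁₂ (X.pushLin m) (X.pushLin m)

theorem isScalarProduct (m : M) : IsScalarProduct 6 (X.gLin m) where
  finrank := finrank_euclideanSpace_fin (𝕜 := ℝ) (n := 6)
  finite := inferInstanceAs (FiniteDimensional ℝ (EuclideanSpace ℝ (Fin 6)))
  symm _ _ := (G.isScalarProduct (X.ι m)).symm _ _
  pos _ hx := (G.isScalarProduct (X.ι m)).pos _ fun h =>
    hx (X.ι_immersion m (h.trans (map_zero (mfderiv (𝓡 6) (𝓡 7) X.ι m)).symm))

/-- The two-form `ι^*(n ⌟ φ)`. -/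
def pullNormalφ (m : M) : TangentSpace (𝓡 6) m →ₗ[ℝ] TangentSpace (𝓡 6) m →ₗ[ℝ] ℝ :=
  (G.φLin (X.ι m) (X.n m)).compl₁₂ (X.pushLin m) (X.pushLin m)

theorem pullNormalφ_apply (m : M) (x y : TangentSpace (𝓡 6) m) :
    X.pullNormalφ m x y = G.φ (X.ι m) (X.n m) (X.push m x) (X.push m y) :=
  G.φLin_apply _ _ _ _

theorem I_spec (m : M) (x y : TangentSpace (𝓡 6) m) :
    X.gLin m (X.I m x) y = X.pullNormalφ m x y := by
  rw [← (X.isScalarProduct m).sharp_spec (X.pullNormalφ m x) y]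
  simp only [pullNormalφ_apply]
  rfl

/-- The induced almost complex structure, as a linear map. -/
def ILin (m : M) : TangentSpace (𝓡 6) m →ₗ[ℝ] TangentSpace (𝓡 6) m where
  toFun := X.I m
  map_add' x y := (X.isScalarProduct m).eq_of_inner_left fun z => by
    simp only [map_add, LinearMap.add_apply, I_spec]
  map_smul' c x := (X.isScalarProduct m).eq_of_inner_left fun z => by
    simp only [map_smul, LinearMap.smul_apply, I_spec, RingHom.id_apply]

theorem ILin_apply (m : M) (x : TangentSpace (𝓡 6) m) : X.ILin m x = X.I m x := rfl

theorem isG2Hyperplane (m : M) : IsG2Hyperplane (G.gLin (X.ι m)) (G.φLin (X.ι m))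
    (G.starLin (X.ι m)) (X.gLin m) (X.pushLin m) (X.n m) (X.ILin m) where
  g2 := G.isG2 _
  scalarProduct := X.isScalarProduct m
  g_eq _ _ := rfl
  unit := X.n_unit m
  normal := X.n_normal m
  I_spec := X.I_spec m

theorem isSU3 (m : M) : IsSU3 (X.gLin m) (X.ILin m) ((G.φLin (X.ι m)).comap (X.pushLin m)) :=
  (X.isG2Hyperplane m).isSU3

/-- Near `m` the induced tensors become functions built from maps into fixed vector spaces, to which
the product rule applies. -/
theorem metric_coordFrame (m : M) (v w : EuclideanSpace ℝ (Fin 6)) :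
    ∀ᶠ x in 𝓝 (extChartAt (𝓡 6) m m),
      X.g ((extChartAt (𝓡 6) m).symm x) (coordFrame m x v) (coordFrame m x w) =
        G.metricRep (X.ι m) (X.immersionRep m x) (fderiv ℝ (X.immersionRep m) x v)
          (fderiv ℝ (X.immersionRep m) x w) := by
  filter_upwards [X.push_coordFrame m, X.chart_symm_immersionRep m] with x hx hs
  rw [G.metricRep_apply]
  exact tensor₂_congr G.g hs (hx v) (hx w)

theorem pullφ_coordFrame (m : M) (v w z : EuclideanSpace ℝ (Fin 6)) :
    ∀ᶠ x in 𝓝 (extChartAt (𝓡 6) m m), X.pullφ ((extChartAt (𝓡 6) m).symm x) (coordFrame m x v)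
        (coordFrame m x w) (coordFrame m x z) =
      G.formRep (X.ι m) (X.immersionRep m x) (fderiv ℝ (X.immersionRep m) x v)
          (fderiv ℝ (X.immersionRep m) x w) (fderiv ℝ (X.immersionRep m) x z) := by
  filter_upwards [X.push_coordFrame m, X.chart_symm_immersionRep m] with x hx hs
  rw [G.formRep_apply]
  exact tensor₃_congr G.φ hs (hx v) (hx w) (hx z)

theorem pullNormalφ_coordFrame (m : M) (v w : EuclideanSpace ℝ (Fin 6)) :
    ∀ᶠ x in 𝓝 (extChartAt (𝓡 6) m m),
      X.pullNormalφ ((extChartAt (𝓡 6) m).symm x) (coordFrame m x v) (coordFrame m x w) =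
        G.formRep (X.ι m) (X.immersionRep m x) (X.normalRep m x)
          (fderiv ℝ (X.immersionRep m) x v) (fderiv ℝ (X.immersionRep m) x w) := by
  filter_upwards [X.push_coordFrame m, X.chart_symm_immersionRep m, X.normal_eq m] with x hx hs hn
  rw [G.formRep_apply, pullNormalφ_apply]
  exact tensor₃_congr G.φ hs hn (hx v) (hx w)

/-- The derivative of this relation gives the tangential part of the derivative of `n`; that of the
next one gives the normal part. -/
theorem metric_normal_coordFrame (m : M) (w : EuclideanSpace ℝ (Fin 6)) :
    ∀ᶠ x in 𝓝 (extChartAt (𝓡 6) m m), G.metricRep (X.ι m) (X.immersionRep m x) (X.normalRep m x)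
          (fderiv ℝ (X.immersionRep m) x w) = 0 := by
  filter_upwards [X.push_coordFrame m, X.chart_symm_immersionRep m, X.normal_eq m] with x hx hs hn
  rw [G.metricRep_apply]
  exact (tensor₂_congr G.g hs hn (hx w)).symm.trans (X.n_normal _ _)

theorem metric_normal_normal (m : M) : ∀ᶠ x in 𝓝 (extChartAt (𝓡 6) m m),
    G.metricRep (X.ι m) (X.immersionRep m x) (X.normalRep m x) (X.normalRep m x) = 1 := by
  filter_upwards [X.chart_symm_immersionRep m, X.normal_eq m] with x hs hn
  rw [G.metricRep_apply]
  exact (tensor₂_congr G.g hs hn hn).symm.trans (X.n_unit _)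

theorem partial₂_g (m : M) (u v w : EuclideanSpace ℝ (Fin 6)) : partial₂ X.g m u v w =
    partial₂ G.g (X.ι m) (X.push m u) (X.push m v) (X.push m w) +
      G.g (X.ι m) (X.hessian m u v) (X.push m w) + G.g (X.ι m) (X.push m v) (X.hessian m u w) := by
  obtain ⟨L, hL, hL'⟩ := X.fderiv_metric m (X.hasFDerivAt_push m v) (X.hasFDerivAt_push m w)
  refine (partial₂_eq hL (X.metric_coordFrame m v w) u).trans ?_
  rw [hL' u, ← push_eq_fderiv, ← push_eq_fderiv]
  rfl

theorem partial₂_pullNormalφ (m : M) (u v w : EuclideanSpace ℝ (Fin 6)) :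
    partial₂ (fun m x y => X.pullNormalφ m x y) m u v w =
    partial₃ G.φ (X.ι m) (X.push m u) (X.n m) (X.push m v) (X.push m w) +
      G.φ (X.ι m) (fderiv ℝ (X.normalRep m) (extChartAt (𝓡 6) m m) u) (X.push m v) (X.push m w) +
      G.φ (X.ι m) (X.n m) (X.hessian m u v) (X.push m w) +
      G.φ (X.ι m) (X.n m) (X.push m v) (X.hessian m u w) := by
  obtain ⟨L, hL, hL'⟩ := X.fderiv_form m (X.differentiableAt_normalRep m).hasFDerivAt
    (X.hasFDerivAt_push m v) (X.hasFDerivAt_push m w)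
  refine (partial₂_eq hL (X.pullNormalφ_coordFrame m v w) u).trans ?_
  rw [hL' u, ← push_eq_fderiv, ← push_eq_fderiv, X.normalRep_self]
  rfl

theorem partial₃_pullφ (m : M) (u v w z : EuclideanSpace ℝ (Fin 6)) :
    partial₃ X.pullφ m u v w z =
    partial₃ G.φ (X.ι m) (X.push m u) (X.push m v) (X.push m w) (X.push m z) +
      G.φ (X.ι m) (X.hessian m u v) (X.push m w) (X.push m z) +
      G.φ (X.ι m) (X.push m v) (X.hessian m u w) (X.push m z) +
      G.φ (X.ι m) (X.push m v) (X.push m w) (X.hessian m u z) := by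
  obtain ⟨L, hL, hL'⟩ := X.fderiv_form m (X.hasFDerivAt_push m v) (X.hasFDerivAt_push m w)
    (X.hasFDerivAt_push m z)
  refine (partial₃_eq hL (X.pullφ_coordFrame m v w z) u).trans ?_
  rw [hL' u, ← push_eq_fderiv, ← push_eq_fderiv, ← push_eq_fderiv]
  rfl

/-- The derivative of the unit normal vector field in the charts. -/
def normalDeriv (m : M) (u : TangentSpace (𝓡 6) m) : TangentSpace (𝓡 7) (X.ι m) :=
  fderiv ℝ (X.normalRep m) (extChartAt (𝓡 6) m m) u

theorem partial_metric_normal (m : M) (u w : EuclideanSpace ℝ (Fin 6)) :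
    partial₂ G.g (X.ι m) (X.push m u) (X.n m) (X.push m w) +
      G.g (X.ι m) (X.normalDeriv m u) (X.push m w) +
      G.g (X.ι m) (X.n m) (X.hessian m u w) = 0 := by
  obtain ⟨L, hL, hL'⟩ := X.fderiv_metric m (X.differentiableAt_normalRep m).hasFDerivAt
    (X.hasFDerivAt_push m w)
  have h := hL' u
  rw [← push_eq_fderiv, X.normalRep_self] at h
  refine h.symm.trans ?_
  have h₀ : HasFDerivAt (fun x => G.metricRep (X.ι m) (X.immersionRep m x) (X.normalRep m x)
      (fderiv ℝ (X.immersionRep m) x w)) (0 : EuclideanSpace ℝ (Fin 6) →L[ℝ] ℝ)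
      (extChartAt (𝓡 6) m m) :=
    (hasFDerivAt_const (0 : ℝ) _).congr_of_eventuallyEq (X.metric_normal_coordFrame m w)
  rw [hL.unique h₀]; rfl

theorem partial_metric_normal_normal (m : M) (u : EuclideanSpace ℝ (Fin 6)) :
    partial₂ G.g (X.ι m) (X.push m u) (X.n m) (X.n m) +
      G.g (X.ι m) (X.normalDeriv m u) (X.n m) +
      G.g (X.ι m) (X.n m) (X.normalDeriv m u) = 0 := by
  obtain ⟨L, hL, hL'⟩ := X.fderiv_metric m (X.differentiableAt_normalRep m).hasFDerivAt
    (X.differentiableAt_normalRep m).hasFDerivAt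
  have h := hL' u
  rw [X.normalRep_self] at h
  refine h.symm.trans ?_
  have h₀ : HasFDerivAt (fun x => G.metricRep (X.ι m) (X.immersionRep m x) (X.normalRep m x)
      (X.normalRep m x)) (0 : EuclideanSpace ℝ (Fin 6) →L[ℝ] ℝ) (extChartAt (𝓡 6) m m) :=
    (hasFDerivAt_const (1 : ℝ) _).congr_of_eventuallyEq (X.metric_normal_normal m)
  rw [hL.unique h₀]; rfl

end Hypersurface

theorem IsG2Hyperplane.eq_of_inner {V₇ V₆ : Type*} [AddCommGroup V₇] [Module ℝ V₇]
    [AddCommGroup V₆] [Module ℝ V₆] {g₇ : V₇ →ₗ[ℝ] V₇ →ₗ[ℝ] ℝ} {φ : Tensor₃ V₇} {σ : Tensor₄ V₇}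
    {g : V₆ →ₗ[ℝ] V₆ →ₗ[ℝ] ℝ} {j : V₆ →ₗ[ℝ] V₇} {n : V₇} {I : V₆ →ₗ[ℝ] V₆}
    (h : IsG2Hyperplane g₇ φ σ g j n I) {a b : V₇} (hn : g₇ a n = g₇ b n)
    (hj : ∀ y, g₇ a (j y) = g₇ b (j y)) : a = b := by
  have he := h.frame_cons h.scalarProduct.orthonormalFrame_spec
  rw [← h.g2.sum_frame he a, ← h.g2.sum_frame he b]
  refine Finset.sum_congr rfl fun i _ => ?_
  congr 1
  refine Fin.cases ?_ (fun i => ?_) i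
  · simpa [h.g2.symm n] using hn
  · simpa [h.g2.symm (j _)] using hj _

/-! ### The Gauss and Weingarten formulas. -/

namespace Hypersurface

variable {N : Type*} [TopologicalSpace N] [ChartedSpace (EuclideanSpace ℝ (Fin 7)) N]
  [IsManifold (𝓡 7) ∞ N] {G : G2Structure N} {M : Type*} [TopologicalSpace M]
  [ChartedSpace (EuclideanSpace ℝ (Fin 6)) M] [IsManifold (𝓡 6) ∞ M] (X : Hypersurface G M)

/-- The second derivative of the immersion in the charts, as a bilinear map. -/
def hessianLin (m : M) : TangentSpace (𝓡 6) m →ₗ[ℝ] TangentSpace (𝓡 6) m →ₗ[ℝ]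
    TangentSpace (𝓡 7) (X.ι m) :=
  (LinearMap.mk₂ ℝ (fun u v : EuclideanSpace ℝ (Fin 6) =>
      fderiv ℝ (fderiv ℝ (X.immersionRep m)) (extChartAt (𝓡 6) m m) u v)
    (fun u u' v => by rw [map_add]; rfl) (fun c u v => by rw [map_smul]; rfl)
    (fun u v v' => by rw [map_add]) (fun c u v => by rw [map_smul]) :
    EuclideanSpace ℝ (Fin 6) →ₗ[ℝ] EuclideanSpace ℝ (Fin 6) →ₗ[ℝ] EuclideanSpace ℝ (Fin 7))

theorem hessianLin_apply (m : M) (u v : TangentSpace (𝓡 6) m) :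
    X.hessianLin m u v = X.hessian m u v := rfl

/-- The derivatives of the components of the induced metric, as a trilinear form. -/
def metricPartial (m : M) : Tensor₃ (TangentSpace (𝓡 6) m) :=
  Tensor₃.mk (fun u v w => (G.metricPartial (X.ι m)).comap (X.pushLin m) u v w +
      G.gLin (X.ι m) (X.hessianLin m u v) (X.pushLin m w) +
      G.gLin (X.ι m) (X.pushLin m v) (X.hessianLin m u w))
    (fun _ _ => ⟨fun _ _ => by simp only [map_add, LinearMap.add_apply]; ring,
      fun _ _ => by simp only [map_smul, LinearMap.smul_apply, smul_add]⟩)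
    (fun _ _ => ⟨fun _ _ => by simp only [map_add, LinearMap.add_apply]; ring,
      fun _ _ => by simp only [map_smul, LinearMap.smul_apply, smul_add]⟩)
    (fun _ _ => ⟨fun _ _ => by simp only [map_add]; ring,
      fun _ _ => by simp only [map_smul, smul_add]⟩)

theorem metricPartial_apply (m : M) (u v w : TangentSpace (𝓡 6) m) : X.metricPartial m u v w =
    G.metricPartial (X.ι m) (X.push m u) (X.push m v) (X.push m w) +
      G.gLin (X.ι m) (X.hessian m u v) (X.push m w) +
      G.gLin (X.ι m) (X.push m v) (X.hessian m u w) := rfl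

theorem isMetricAt (m : M) : IsMetricAt X.g m (X.gLin m) (X.metricPartial m) where
  toIsScalarProduct := X.isScalarProduct m
  metric_eq _ _ := rfl
  partial_eq u v w := by
    refine (X.partial₂_g m u v w).trans ?_
    rw [metricPartial_apply, ← (G.isMetricAt (X.ι m)).partial_eq]
    rfl
  partial_symm u v w := by
    rw [metricPartial_apply, metricPartial_apply, (G.isMetricAt (X.ι m)).partial_symm,
      (G.isScalarProduct (X.ι m)).symm (X.hessian m u v),
      (G.isScalarProduct (X.ι m)).symm (X.hessian m u w)]
    ring

theorem hessian_eq (m : M) (u v : TangentSpace (𝓡 6) m) : X.hessian m u v =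
    X.shapeTensor m u v - christoffel G.g (X.ι m) (X.push m u) (X.push m v) +
      X.pushLin m (christoffel X.g m u v) := by
  rw [shapeTensor, pushLin_apply]; abel

/-- In the Koszul formula for the induced metric, the Hessian and the ambient Christoffel symbol
combine into the tangential part of the ambient derivative; the remaining Hessian terms cancel by
symmetry. -/
theorem shapeTensor_tangent (m : M) (u v w : TangentSpace (𝓡 6) m) :
    G.gLin (X.ι m) (X.shapeTensor m u v) (X.push m w) = 0 := by
  have h₁ := (X.isMetricAt m).christoffel_spec u v w
  have h₂ := (G.isMetricAt (X.ι m)).christoffel_spec (X.push m u) (X.push m v) (X.push m w)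
  have h₃ : G.gLin (X.ι m) (X.push m (christoffel X.g m u v)) (X.push m w) =
      X.gLin m (christoffel X.g m u v) w := rfl
  have hs := (G.isScalarProduct (X.ι m)).symm
  simp only [metricPartial_apply] at h₁
  rw [shapeTensor, map_sub, map_add, LinearMap.sub_apply, LinearMap.add_apply, h₂, h₃, h₁,
    X.hessian_symm m v u, X.hessian_symm m w u, X.hessian_symm m w v, hs (X.push m u), hs (X.push m v)]
  ring

theorem shapeTensor_eq (m : M) (u v : TangentSpace (𝓡 6) m) :
    X.shapeTensor m u v = X.B m u v • X.n m := by
  have h := X.isG2Hyperplane m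
  refine h.eq_of_inner ?_ fun y => ?_
  · rw [map_smul, LinearMap.smul_apply, h.unit, smul_eq_mul, mul_one]; rfl
  · rw [map_smul, LinearMap.smul_apply, h.normal, smul_zero]
    exact X.shapeTensor_tangent m u v y

theorem shapeTensor_symm (m : M) (u v : TangentSpace (𝓡 6) m) :
    X.shapeTensor m u v = X.shapeTensor m v u := by
  rw [shapeTensor, shapeTensor, X.hessian_symm, (X.isMetricAt m).christoffel_symm,
    (G.isMetricAt (X.ι m)).christoffel_symm]

theorem B_symm (m : M) (u v : TangentSpace (𝓡 6) m) : X.B m u v = X.B m v u := by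
  rw [B, B, shapeTensor_symm]

theorem shapeTensor_add (m : M) (u u' v : TangentSpace (𝓡 6) m) :
    X.shapeTensor m (u + u') v = X.shapeTensor m u v + X.shapeTensor m u' v := by
  simp only [shapeTensor, ← hessianLin_apply, ← pushLin_apply, map_add, LinearMap.add_apply,
    (X.isMetricAt m).christoffel_add, (G.isMetricAt (X.ι m)).christoffel_add]
  abel

theorem shapeTensor_smul (m : M) (c : ℝ) (u v : TangentSpace (𝓡 6) m) :
    X.shapeTensor m (c • u) v = c • X.shapeTensor m u v := by
  simp only [shapeTensor, ← hessianLin_apply, ← pushLin_apply, map_smul, LinearMap.smul_apply,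
    (X.isMetricAt m).christoffel_smul, (G.isMetricAt (X.ι m)).christoffel_smul, smul_add, smul_sub]

/-- The second fundamental form, as a bilinear form. -/
def BLin (m : M) : TangentSpace (𝓡 6) m →ₗ[ℝ] TangentSpace (𝓡 6) m →ₗ[ℝ] ℝ :=
  have h (v) : IsLinearMap ℝ fun u => X.B m u v :=
    ⟨fun u u' => by simp only [B, shapeTensor_add, ← G.gLin_apply, map_add, LinearMap.add_apply],
      fun c u => by simp only [B, shapeTensor_smul, ← G.gLin_apply, map_smul, LinearMap.smul_apply]⟩
  bilinMk (X.B m) h fun u => by simpa only [X.B_symm m u] using h u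

theorem BLin_apply (m : M) (u v : TangentSpace (𝓡 6) m) : X.BLin m u v = X.B m u v := rfl

/-- The shape operator. -/
def shapeOp (m : M) : TangentSpace (𝓡 6) m →ₗ[ℝ] TangentSpace (𝓡 6) m :=
  ((X.isScalarProduct m).exists_raise (X.BLin m)).choose

theorem shapeOp_spec (m : M) (u v : TangentSpace (𝓡 6) m) :
    X.gLin m (X.shapeOp m u) v = X.B m u v :=
  ((X.isScalarProduct m).exists_raise (X.BLin m)).choose_spec u v

/-- The Levi-Civita derivative of the unit normal vector field. -/
theorem normalDeriv_eq (m : M) (u : TangentSpace (𝓡 6) m) : X.normalDeriv m u =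
    -X.pushLin m (X.shapeOp m u) - christoffel G.g (X.ι m) (X.push m u) (X.n m) := by
  have h := X.isG2Hyperplane m
  have hs := (G.isScalarProduct (X.ι m)).symm
  have hG := G.isMetricAt (X.ι m)
  refine h.eq_of_inner ?_ fun w => ?_
  -- The normal component comes from differentiating `⟨n, n⟩ = 1`, the tangential one from `⟨n, ι_*
  -- w⟩ = 0`.
  · have h₁ := X.partial_metric_normal_normal m u
    rw [hG.partial_eq, hG.partial_eq_christoffel, ← G.gLin_apply, ← G.gLin_apply, hs (X.n m),
      hs (X.n m)] at h₁
    rw [map_sub, LinearMap.sub_apply, map_neg, LinearMap.neg_apply, hs (X.pushLin m _), h.normal]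
    linarith
  · have h₁ := X.partial_metric_normal m u w
    rw [hG.partial_eq, hG.partial_eq_christoffel, ← G.gLin_apply, ← G.gLin_apply, X.hessian_eq,
      map_add, map_sub, h.normal, hs (X.n m) (X.shapeTensor m u w)] at h₁
    rw [map_sub, LinearMap.sub_apply, map_neg, LinearMap.neg_apply, ← h.g_eq, X.shapeOp_spec, B,
      ← G.gLin_apply, X.pushLin_apply]
    linarith

/-- By `hessian_eq` each second derivative of `ι` is `B n` plus Christoffel terms. The latter turn
the ambient partial derivative into `∇̄φ` and cancel those of `∇`; the terms with `B` remain. -/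
theorem nabla₃_pullφ (m : M) (u v w z : TangentSpace (𝓡 6) m) : nabla₃ X.g X.pullφ m u v w z =
    G.nablaφ (X.ι m) (X.push m u) (X.push m v) (X.push m w) (X.push m z) +
      X.B m u v * G.φ (X.ι m) (X.n m) (X.push m w) (X.push m z) +
      X.B m u w * G.φ (X.ι m) (X.push m v) (X.n m) (X.push m z) +
      X.B m u z * G.φ (X.ι m) (X.push m v) (X.push m w) (X.n m) := by
  rw [nabla₃, G2Structure.nablaφ, nabla₃]
  rw [show partial₃ X.pullφ m u v w z = _ from X.partial₃_pullφ m u v w z]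
  simp only [pullφ, X.hessian_eq, X.shapeTensor_eq, ← G.φLin_apply, map_add, map_sub, map_smul,
    LinearMap.add_apply, LinearMap.sub_apply, LinearMap.smul_apply, smul_eq_mul, pushLin_apply]
  ring

/-- The slot of `n` is differentiated by the Weingarten formula; the terms with `B` vanish since `n`
would occur twice. -/
theorem nabla₂_pullNormalφ (m : M) (u v w : TangentSpace (𝓡 6) m) :
    nabla₂ X.g (fun m x y => X.pullNormalφ m x y) m u v w =
      G.nablaφ (X.ι m) (X.push m u) (X.n m) (X.push m v) (X.push m w) -
        G.φ (X.ι m) (X.push m (X.shapeOp m u)) (X.push m v) (X.push m w) := by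
  have h := (X.isG2Hyperplane m).g2
  rw [nabla₂, G2Structure.nablaφ, nabla₃]
  rw [show partial₂ (fun m x y => X.pullNormalφ m x y) m u v w = _ from
    X.partial₂_pullNormalφ m u v w]
  rw [show fderiv ℝ (X.normalRep m) (extChartAt (𝓡 6) m m) u = _ from X.normalDeriv_eq m u]
  simp only [pullNormalφ_apply, X.hessian_eq, X.shapeTensor_eq, ← G.φLin_apply, map_add, map_sub,
    map_smul, map_neg, LinearMap.neg_apply,
    LinearMap.add_apply, LinearMap.sub_apply, LinearMap.smul_apply, smul_eq_mul, pushLin_apply,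
    h.φ_self₁₂]
  have h₁ : G.φLin (X.ι m) (X.n m) (X.push m v) (X.n m) = 0 := by
    rw [h.φ_swap₂₃, h.φ_self₁₂, neg_zero]
  rw [h₁]
  ring

end Hypersurface

/-! ### Differentiability of the almost complex structure and Leibniz rules. -/

/-- A vector field that is given by a differentiable field of nondegenerate bilinear forms and a
differentiable field of linear forms is differentiable. -/
theorem differentiableAt_of_bilin {D E : Type*} [NormedAddCommGroup D] [NormedSpace ℝ D]
    [NormedAddCommGroup E] [NormedSpace ℝ E] [FiniteDimensional ℝ E]
    {b : D → E →L[ℝ] E →L[ℝ] ℝ} {f : D → E →L[ℝ] ℝ} {a : D → E} {x : D}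
    (hb : DifferentiableAt ℝ b x) (hf : DifferentiableAt ℝ f x)
    (hpos : ∀ v, v ≠ 0 → 0 < b x v v) (h : ∀ᶠ y in 𝓝 x, b y (a y) = f y) :
    DifferentiableAt ℝ a x := by
  have : CompleteSpace E := FiniteDimensional.complete ℝ E
  have hinj : Function.Injective (b x).toLinearMap := by
    rw [← LinearMap.ker_eq_bot, LinearMap.ker_eq_bot']
    intro v hv
    by_contra hne
    have h₁ := hpos v hne
    rw [show b x v = 0 from hv] at h₁
    exact lt_irrefl _ h₁
  have hdim : Module.finrank ℝ E = Module.finrank ℝ (E →L[ℝ] ℝ) := by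
    rw [← (LinearMap.toContinuousLinearMap : (E →ₗ[ℝ] ℝ) ≃ₗ[ℝ] (E →L[ℝ] ℝ)).finrank_eq]
    exact (Subspace.dual_finrank_eq (K := ℝ) (V := E)).symm
  -- By positivity `b x` is an isomorphism onto the dual. Inversion is smooth there and isomorphisms
  -- form an open set, so near `x` the vector `a y` is the inverse of `b y` applied to `f y`.
  let e : E ≃L[ℝ] (E →L[ℝ] ℝ) :=
    (LinearMap.linearEquivOfInjective (b x).toLinearMap hinj hdim).toContinuousLinearEquiv
  have he : (e : E →L[ℝ] (E →L[ℝ] ℝ)) = b x := by ext v w; rfl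
  have h₁ : DifferentiableAt ℝ (fun y => (b y).inverse) x := by
    have h₂ : DifferentiableAt ℝ (ContinuousLinearMap.inverse : (E →L[ℝ] (E →L[ℝ] ℝ)) → _) (b x) := by
      rw [← he]
      exact (contDiffAt_map_inverse (n := 1) e).differentiableAt (by simp)
    exact h₂.comp x hb
  refine (h₁.clm_apply hf).congr_of_eventuallyEq ?_
  have h₃ : ∀ᶠ y in 𝓝 x, b y ∈ Set.range ((↑) : (E ≃L[ℝ] (E →L[ℝ] ℝ)) → E →L[ℝ] (E →L[ℝ] ℝ)) := by
    refine hb.continuousAt.preimage_mem_nhds ?_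
    rw [← he]
    exact e.nhds
  filter_upwards [h, h₃] with y hy ⟨e', he'⟩
  rw [← hy, ← he', ContinuousLinearMap.inverse_equiv]
  exact (e'.symm_apply_apply _).symm

theorem exists_hasFDerivAt_trilin {D E : Type*} [NormedAddCommGroup D] [NormedSpace ℝ D]
    [NormedAddCommGroup E] [NormedSpace ℝ E] {t : D → E →L[ℝ] E →L[ℝ] E →L[ℝ] ℝ}
    {t' : D →L[ℝ] E →L[ℝ] E →L[ℝ] E →L[ℝ] ℝ} {x : D} (ht : HasFDerivAt t t' x) {f k : D → ℝ}
    {f' k' : D →L[ℝ] ℝ} (hf : HasFDerivAt f f' x) (hk : HasFDerivAt k k' x) {a : D → E}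
    {a' : D →L[ℝ] E} (ha : HasFDerivAt a a' x) (v w z : E) :
    ∃ L : D →L[ℝ] ℝ, HasFDerivAt (fun y => f y * t y v w z + k y * t y (a y) w z) L x ∧
      ∀ u, L u = f' u * t x v w z + f x * t' u v w z +
        (k' u * t x (a x) w z + k x * (t' u (a x) w z + t x (a' u) w z)) := by
  have h₁ := ((ht.clm_apply (hasFDerivAt_const v x)).clm_apply
    (hasFDerivAt_const w x)).clm_apply (hasFDerivAt_const z x)
  have h₂ := ((ht.clm_apply ha).clm_apply (hasFDerivAt_const w x)).clm_apply
    (hasFDerivAt_const z x)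
  refine ⟨_, (hf.mul h₁).add (hk.mul h₂), fun u => ?_⟩
  simp
  ring

theorem hasFDerivAt_of_mdifferentiableAt {M : Type*} [TopologicalSpace M]
    [ChartedSpace (EuclideanSpace ℝ (Fin 6)) M] {θ : M → ℝ} {m : M}
    (hθ : MDifferentiableAt (𝓡 6) 𝓘(ℝ, ℝ) θ m) :
    HasFDerivAt (fun x => θ ((extChartAt (𝓡 6) m).symm x))
      (mfderiv (𝓡 6) 𝓘(ℝ, ℝ) θ m : EuclideanSpace ℝ (Fin 6) →L[ℝ] ℝ) (extChartAt (𝓡 6) m m) := by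
  have h := hθ.hasMFDerivAt.2
  refine hasFDerivWithinAt_univ.1 ?_
  rw [← ModelWithCorners.range_eq_univ (𝓡 6)]
  exact h

namespace Hypersurface

variable {N : Type*} [TopologicalSpace N] [ChartedSpace (EuclideanSpace ℝ (Fin 7)) N]
  [IsManifold (𝓡 7) ∞ N] {G : G2Structure N} {M : Type*} [TopologicalSpace M]
  [ChartedSpace (EuclideanSpace ℝ (Fin 6)) M] [IsManifold (𝓡 6) ∞ M] (X : Hypersurface G M)

/-- The components of the induced metric in the preferred chart at `m`. -/
def gRep (m : M) (x : EuclideanSpace ℝ (Fin 6)) :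
    EuclideanSpace ℝ (Fin 6) →L[ℝ] EuclideanSpace ℝ (Fin 6) →L[ℝ] ℝ :=
  bilinToCLM ((X.gLin ((extChartAt (𝓡 6) m).symm x)).compl₁₂ (coordFrame m x).toLinearMap
    (coordFrame m x).toLinearMap)

theorem gRep_apply (m : M) (x v w : EuclideanSpace ℝ (Fin 6)) : X.gRep m x v w =
    X.g ((extChartAt (𝓡 6) m).symm x) (coordFrame m x v) (coordFrame m x w) := rfl

/-- The components of `ι^*(n ⌟ φ)` in the preferred chart at `m`. -/
def normalφRep (m : M) (x : EuclideanSpace ℝ (Fin 6)) :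
    EuclideanSpace ℝ (Fin 6) →L[ℝ] EuclideanSpace ℝ (Fin 6) →L[ℝ] ℝ :=
  bilinToCLM ((X.pullNormalφ ((extChartAt (𝓡 6) m).symm x)).compl₁₂ (coordFrame m x).toLinearMap
    (coordFrame m x).toLinearMap)

theorem normalφRep_apply (m : M) (x v w : EuclideanSpace ℝ (Fin 6)) : X.normalφRep m x v w =
    X.pullNormalφ ((extChartAt (𝓡 6) m).symm x) (coordFrame m x v) (coordFrame m x w) := rfl

/-- The three-form `ι^*φ`, as a trilinear form. -/
def pullφLin (m : M) : Tensor₃ (TangentSpace (𝓡 6) m) :=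
  (G.φLin (X.ι m)).comap (X.pushLin m)

theorem pullφLin_apply (m : M) (x y z : TangentSpace (𝓡 6) m) :
    X.pullφLin m x y z = X.pullφ m x y z := G.φLin_apply _ _ _ _

/-- The components of `ι^*φ` in the preferred chart at `m`. -/
def pullφRep (m : M) (x : EuclideanSpace ℝ (Fin 6)) : EuclideanSpace ℝ (Fin 6) →L[ℝ]
    EuclideanSpace ℝ (Fin 6) →L[ℝ] EuclideanSpace ℝ (Fin 6) →L[ℝ] ℝ :=
  trilinToCLM ((X.pullφLin ((extChartAt (𝓡 6) m).symm x)).comap (coordFrame m x).toLinearMap)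

theorem pullφRep_apply (m : M) (x v w z : EuclideanSpace ℝ (Fin 6)) : X.pullφRep m x v w z =
    X.pullφ ((extChartAt (𝓡 6) m).symm x) (coordFrame m x v) (coordFrame m x w)
      (coordFrame m x z) := by
  rw [pullφRep, trilinToCLM_apply, Tensor₃.comap_apply]
  exact X.pullφLin_apply _ _ _ _

/-- The components of the almost complex structure in the preferred chart at `m`. -/
def IRep (m : M) (v x : EuclideanSpace ℝ (Fin 6)) : EuclideanSpace ℝ (Fin 6) :=
  (coordFrame m x).inverse (X.I ((extChartAt (𝓡 6) m).symm x) (coordFrame m x v))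

theorem _root_.coordFrame_inverse {k : ℕ} {M : Type*} [TopologicalSpace M]
    [ChartedSpace (EuclideanSpace ℝ (Fin k)) M] [IsManifold (𝓡 k) ∞ M] (m : M)
    {x : EuclideanSpace ℝ (Fin k)} (hx : x ∈ (extChartAt (𝓡 k) m).target)
    (v : TangentSpace (𝓡 k) ((extChartAt (𝓡 k) m).symm x)) :
    coordFrame m x ((coordFrame m x).inverse v) = v := by
  have h : (coordFrame m x).inverse = chartDeriv m ((extChartAt (𝓡 k) m).symm x) :=
    ContinuousLinearMap.inverse_eq (ContinuousLinearMap.ext (coordFrame_chartDeriv m hx))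
      (ContinuousLinearMap.ext (chartDeriv_coordFrame m hx))
  rw [h, coordFrame_chartDeriv m hx]

theorem coordFrame_IRep (m : M) (v : EuclideanSpace ℝ (Fin 6)) :
    ∀ᶠ x in 𝓝 (extChartAt (𝓡 6) m m), coordFrame m x (X.IRep m v x) =
      X.I ((extChartAt (𝓡 6) m).symm x) (coordFrame m x v) := by
  filter_upwards [extChartAt_target_mem_nhds (I := 𝓡 6) m] with x hx
  exact coordFrame_inverse m hx _

/-- `I` is only given implicitly by `⟨I v, w⟩ = φ(n, v, w)`. Solving this relation in coordinates
shows that `I` is differentiable, and differentiating it computes `∇I`. -/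
theorem gRep_IRep (m : M) (v : EuclideanSpace ℝ (Fin 6)) :
    ∀ᶠ x in 𝓝 (extChartAt (𝓡 6) m m), X.gRep m x (X.IRep m v x) = X.normalφRep m x v := by
  filter_upwards [X.coordFrame_IRep m v] with x hx
  ext w
  rw [gRep_apply, normalφRep_apply, hx]
  exact X.I_spec _ _ _

theorem differentiableAt_gRep (m : M) :
    DifferentiableAt ℝ (X.gRep m) (extChartAt (𝓡 6) m m) :=
  differentiableAt_clm fun v => differentiableAt_clm fun w => by
    obtain ⟨L, hL, -⟩ := X.fderiv_metric m (X.hasFDerivAt_push m v) (X.hasFDerivAt_push m w)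
    exact (hL.congr_of_eventuallyEq (X.metric_coordFrame m v w)).differentiableAt

theorem differentiableAt_normalφRep (m : M) :
    DifferentiableAt ℝ (X.normalφRep m) (extChartAt (𝓡 6) m m) :=
  differentiableAt_clm fun v => differentiableAt_clm fun w => by
    obtain ⟨L, hL, -⟩ := X.fderiv_form m (X.differentiableAt_normalRep m).hasFDerivAt
      (X.hasFDerivAt_push m v) (X.hasFDerivAt_push m w)
    exact (hL.congr_of_eventuallyEq (X.pullNormalφ_coordFrame m v w)).differentiableAt

theorem differentiableAt_pullφRep (m : M) :
    DifferentiableAt ℝ (X.pullφRep m) (extChartAt (𝓡 6) m m) :=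
  differentiableAt_clm fun v => differentiableAt_clm fun w => differentiableAt_clm fun z => by
    obtain ⟨L, hL, -⟩ := X.fderiv_form m (X.hasFDerivAt_push m v)
      (X.hasFDerivAt_push m w) (X.hasFDerivAt_push m z)
    refine (hL.congr_of_eventuallyEq ?_).differentiableAt
    filter_upwards [X.pullφ_coordFrame m v w z] with x hx
    rw [pullφRep_apply, hx]

theorem gRep_self (m : M) (v w : EuclideanSpace ℝ (Fin 6)) :
    X.gRep m (extChartAt (𝓡 6) m m) v w = X.g m v w :=
  tensor₂_congr X.g (chart_symm_self m) (coordFrame_self_apply m v) (coordFrame_self_apply m w)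

theorem pullφRep_self (m : M) (v w z : EuclideanSpace ℝ (Fin 6)) :
    X.pullφRep m (extChartAt (𝓡 6) m m) v w z = X.pullφ m v w z :=
  (X.pullφRep_apply m _ v w z).trans <| tensor₃_congr X.pullφ (chart_symm_self m)
    (coordFrame_self_apply m v) (coordFrame_self_apply m w) (coordFrame_self_apply m z)

theorem IRep_self (m : M) (v : EuclideanSpace ℝ (Fin 6)) :
    X.IRep m v (extChartAt (𝓡 6) m m) = X.I m v := by
  have h₁ := (X.coordFrame_IRep m v).self_of_nhds
  have h₂ : ∀ q, q = m → ∀ v w : EuclideanSpace ℝ (Fin 6), v = w →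
      (X.I q v : EuclideanSpace ℝ (Fin 6)) = X.I m w := by
    rintro _ rfl _ _ rfl; rfl
  exact (coordFrame_self_apply m _).symm.trans
    (h₁.trans (h₂ _ (chart_symm_self m) _ _ (coordFrame_self_apply m v)))

theorem differentiableAt_IRep (m : M) (v : EuclideanSpace ℝ (Fin 6)) :
    DifferentiableAt ℝ (X.IRep m v) (extChartAt (𝓡 6) m m) := by
  refine differentiableAt_of_bilin (X.differentiableAt_gRep m)
    ((X.differentiableAt_normalφRep m).clm_apply (differentiableAt_const v)) (fun w hw => ?_)
    (X.gRep_IRep m v)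
  rw [gRep_self]
  exact (X.isScalarProduct m).pos w hw

theorem fderiv_gRep (m : M) (u v w : EuclideanSpace ℝ (Fin 6)) :
    fderiv ℝ (X.gRep m) (extChartAt (𝓡 6) m m) u v w = X.metricPartial m u v w := by
  have h := (((X.differentiableAt_gRep m).hasFDerivAt.clm_apply
    (hasFDerivAt_const v _)).clm_apply (hasFDerivAt_const w _))
  have h₁ := partial₂_eq (T := X.g) h (.of_forall fun y => (X.gRep_apply m y v w).symm) u
  refine .trans ?_ (h₁.symm.trans ((X.isMetricAt m).partial_eq u v w))
  simp

theorem fderiv_normalφRep (m : M) (u v w : EuclideanSpace ℝ (Fin 6)) :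
    fderiv ℝ (X.normalφRep m) (extChartAt (𝓡 6) m m) u v w =
      partial₂ (fun m x y => X.pullNormalφ m x y) m u v w := by
  have h := (((X.differentiableAt_normalφRep m).hasFDerivAt.clm_apply
    (hasFDerivAt_const v _)).clm_apply (hasFDerivAt_const w _))
  have h₁ := partial₂_eq (T := fun m x y => X.pullNormalφ m x y) h
    (.of_forall fun y => (X.normalφRep_apply m y v w).symm) u
  refine .trans ?_ h₁.symm
  simp

theorem fderiv_pullφRep (m : M) (u v w z : EuclideanSpace ℝ (Fin 6)) :
    fderiv ℝ (X.pullφRep m) (extChartAt (𝓡 6) m m) u v w z = partial₃ X.pullφ m u v w z := by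
  have h := (((X.differentiableAt_pullφRep m).hasFDerivAt.clm_apply
    (hasFDerivAt_const v _)).clm_apply (hasFDerivAt_const w _)).clm_apply (hasFDerivAt_const z _)
  have h₁ := partial₃_eq (T := X.pullφ) h (.of_forall fun y => (X.pullφRep_apply m y v w z).symm) u
  refine .trans ?_ h₁.symm
  simp

theorem partialEnd_spec (m : M) (u v w : EuclideanSpace ℝ (Fin 6)) :
    partial₂ (fun m x y => X.pullNormalφ m x y) m u v w =
      X.metricPartial m u (X.I m v) w + X.gLin m (partialEnd X.I m u v) w := by
  have h₁ := ((X.differentiableAt_gRep m).hasFDerivAt.clm_apply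
    (X.differentiableAt_IRep m v).hasFDerivAt)
  have h₂ := (X.differentiableAt_normalφRep m).hasFDerivAt.clm_apply (hasFDerivAt_const v _)
  have h₃ := (h₁.congr_of_eventuallyEq ((X.gRep_IRep m v).mono fun _ h => h.symm)).unique h₂
  have h₄ := DFunLike.congr_fun (DFunLike.congr_fun h₃ u) w
  have h₅ : fderiv ℝ (X.gRep m) (extChartAt (𝓡 6) m m) u (X.IRep m v (extChartAt (𝓡 6) m m)) w +
      X.gRep m (extChartAt (𝓡 6) m m) (fderiv ℝ (X.IRep m v) (extChartAt (𝓡 6) m m) u) w =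
      fderiv ℝ (X.normalφRep m) (extChartAt (𝓡 6) m m) u v w := by
    simpa [add_comm] using h₄
  rw [fderiv_gRep, fderiv_normalφRep, gRep_self, IRep_self] at h₅
  exact h₅.symm

/-- The metric is parallel, so `∇` of `⟨I v, w⟩ = φ(n, v, w)` falls on `I` alone. -/
theorem nablaEnd_spec (m : M) (u v w : TangentSpace (𝓡 6) m) :
    X.gLin m (nablaEnd X.g X.I m u v) w =
      nabla₂ X.g (fun m x y => X.pullNormalφ m x y) m u v w := by
  have h := X.isMetricAt m
  rw [nabla₂, show partial₂ (fun m x y => X.pullNormalφ m x y) m u v w = _ from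
    X.partialEnd_spec m u v w, nablaEnd, h.partial_eq_christoffel, map_sub, map_add,
    LinearMap.sub_apply, LinearMap.add_apply, X.I_spec, X.I_spec]
  ring

theorem partial₃_combination (m : M) {a b : M → ℝ} {a' b' : EuclideanSpace ℝ (Fin 6) →L[ℝ] ℝ}
    (ha : HasFDerivAt (fun x => a ((extChartAt (𝓡 6) m).symm x)) a' (extChartAt (𝓡 6) m m))
    (hb : HasFDerivAt (fun x => b ((extChartAt (𝓡 6) m).symm x)) b' (extChartAt (𝓡 6) m m))
    (u v w z : EuclideanSpace ℝ (Fin 6)) :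
    partial₃ (fun m x y z => a m * X.pullφ m x y z + b m * X.pullφ m (X.I m x) y z) m u v w z =
      a' u * X.pullφ m v w z + a m * partial₃ X.pullφ m u v w z +
      (b' u * X.pullφ m (X.I m v) w z + b m * (partial₃ X.pullφ m u (X.I m v) w z +
        X.pullφ m (partialEnd X.I m u v) w z)) := by
  obtain ⟨L, hL, hL'⟩ := exists_hasFDerivAt_trilin (X.differentiableAt_pullφRep m).hasFDerivAt
    ha hb (X.differentiableAt_IRep m v).hasFDerivAt v w z
  have h₃ := partial₃_eq (T := fun m x y z => a m * X.pullφ m x y z + b m * X.pullφ m (X.I m x) y z)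
    hL (v := v) (w := w) (z := z) (by
      filter_upwards [X.coordFrame_IRep m v] with x hx
      have h₁ := X.pullφRep_apply m x v w z
      have h₂ := X.pullφRep_apply m x (X.IRep m v x) w z
      rw [hx] at h₂
      exact congrArg₂ (fun s t => a _ * s + b _ * t) h₁.symm h₂.symm) u
  have h₅ := hL' u
  rw [fderiv_pullφRep, fderiv_pullφRep, pullφRep_self, pullφRep_self, pullφRep_self, IRep_self,
    chart_symm_self] at h₅
  exact h₃.trans h₅

/-- A Leibniz rule for the shape shared by `ψ₊` and `ψ₋`, with functions of `θ` as coefficients. -/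
theorem nabla₃_combination (m : M) {a b : M → ℝ} {a' b' : EuclideanSpace ℝ (Fin 6) →L[ℝ] ℝ}
    (ha : HasFDerivAt (fun x => a ((extChartAt (𝓡 6) m).symm x)) a' (extChartAt (𝓡 6) m m))
    (hb : HasFDerivAt (fun x => b ((extChartAt (𝓡 6) m).symm x)) b' (extChartAt (𝓡 6) m m))
    (u v w z : TangentSpace (𝓡 6) m) :
    nabla₃ X.g (fun m x y z => a m * X.pullφ m x y z + b m * X.pullφ m (X.I m x) y z) m u v w z =
      a' u * X.pullφ m v w z + a m * nabla₃ X.g X.pullφ m u v w z +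
      b' u * X.pullφ m (X.I m v) w z + b m * (nabla₃ X.g X.pullφ m u (X.I m v) w z +
        X.pullφ m (nablaEnd X.g X.I m u v) w z) := by
  have h₄ := X.partial₃_combination m ha hb u v w z
  rw [nabla₃, nabla₃, nabla₃, nablaEnd]
  refine (congrArg (fun s : ℝ => s - _ - _ - _) h₄).trans ?_
  simp only [← pullφLin_apply, ← ILin_apply, map_add, map_sub, LinearMap.add_apply,
    LinearMap.sub_apply]
  ring

end Hypersurface

end SmoothTensors

/-! ### Actions of `ξ` and `η` on the volume form, and `∇̄φ` on the hyperplane. -/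

section PointwiseDerivatives

variable {V : Type*} [AddCommGroup V] [Module ℝ V]

namespace IsSU3

variable {g : V →ₗ[ℝ] V →ₗ[ℝ] ℝ} {I : V →ₗ[ℝ] V} {ψ : Tensor₃ V}

/-- The three-form at the cross product of two vectors. -/
theorem ψ_cross (h : IsSU3 g I ψ) {x a b : V} {c : ℝ} (hx : ∀ y, g x y = c * ψ a b y) (w z : V) :
    ψ x w z = c * (g a w * g b z - g a z * g b w - g (I a) w * g (I b) z +
      g (I a) z * g (I b) w) := by
  have he := h.orthonormalFrame_spec
  rw [← h.contraction _ he, Finset.mul_sum]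
  refine (h.sum_inner_mul he ((ψ.flip w).flip z) x).symm.trans ?_
  refine Finset.sum_congr rfl fun i _ => ?_
  rw [hx, h.cycle (orthonormalFrame 6 (fun x y => g x y) i) a b]
  simp only [LinearMap.flip_apply]
  ring

theorem inner_I_left (h : IsSU3 g I ψ) (x y : V) : g (I x) y = -g (I y) x := by
  rw [← h.I_skew, h.symm]

/-- The action of a skew-symmetric endomorphism given by a cross product on the three-form. -/
theorem derivationAction_cross (h : IsSU3 g I ψ) {ξ : V → V} {a : V}
    (hξ : ∀ v y, g (ξ v) y = -(1 / 2) * ψ a v y) (v w z : V) :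
    derivationAction ξ (fun x y z => ψ x y z) v w z =
      g (I a) v * g (I w) z + g (I a) w * g (I z) v + g (I a) z * g (I v) w := by
  rw [derivationAction, h.ψ_cross (hξ v), h.swap₁₂ v (ξ w), h.ψ_cross (hξ w), ← h.cycle (ξ z),
    h.ψ_cross (hξ z), h.symm w v, h.symm z v, h.symm z w, h.inner_I_left z w, h.inner_I_left z v,
    h.inner_I_left w v]
  ring

/-- The action of a multiple of the complex structure on the three-form. -/
theorem derivationAction_I (h : IsSU3 g I ψ) (c : ℝ) (v w z : V) :
    derivationAction (fun v => c • I v) (fun x y z => ψ x y z) v w z = -3 * c * ψ (I v) w z := by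
  simp only [derivationAction, map_smul, LinearMap.smul_apply, smul_eq_mul, ← h.I_slide₂,
    ← h.I_slide]
  ring

end IsSU3

namespace IsG2Hyperplane

variable {V₇ V₆ : Type*} [AddCommGroup V₇] [Module ℝ V₇] [AddCommGroup V₆]
    [Module ℝ V₆] {g₇ : V₇ →ₗ[ℝ] V₇ →ₗ[ℝ] ℝ} {φ : Tensor₃ V₇} {σ : Tensor₄ V₇}
    {g : V₆ →ₗ[ℝ] V₆ →ₗ[ℝ] ℝ} {j : V₆ →ₗ[ℝ] V₇} {n : V₇} {I : V₆ →ₗ[ℝ] V₆}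

/-- The tangential part of an endomorphism. -/
theorem exists_tangent (h : IsG2Hyperplane g₇ φ σ g j n I) (L : V₇ →ₗ[ℝ] V₇) :
    ∃ Λ : V₆ →ₗ[ℝ] V₆, (∀ u v, g (Λ u) v = g₇ (L (j u)) (j v)) ∧
      ∀ u, L (j u) = j (Λ u) + g₇ (L (j u)) n • n := by
  obtain ⟨Λ, hΛ⟩ := h.scalarProduct.exists_raise (g₇.compl₁₂ (L.comp j) j)
  refine ⟨Λ, hΛ, fun u => h.eq_of_inner ?_ fun y => ?_⟩
  · simp [h.unit, h.g2.symm _ n, h.normal]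
  · rw [map_add, LinearMap.add_apply, ← h.g_eq, hΛ]
    simp [h.normal]

/-- The tangential part of `L u` meets `σ` as `-½ ω ∧ ω`, the normal part as `n ⌟ σ`. -/
theorem σ_apply (h : IsG2Hyperplane g₇ φ σ g j n I) {L : V₇ →ₗ[ℝ] V₇} {Λ : V₆ →ₗ[ℝ] V₆}
    (hΛ : ∀ u, L (j u) = j (Λ u) + g₇ (L (j u)) n • n) (u v w z : V₆) :
    σ (L (j u)) (j v) (j w) (j z) = -(g (I (Λ u)) v * g (I w) z + g (I (Λ u)) w * g (I z) v
      + g (I (Λ u)) z * g (I v) w) - g₇ (L (j u)) n * φ (j (I v)) (j w) (j z) := by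
  have h₁ : σ (L (j u)) (j v) (j w) (j z) = σ (j (Λ u)) (j v) (j w) (j z) +
      g₇ (L (j u)) n * σ n (j v) (j w) (j z) := by
    conv_lhs => rw [hΛ u]
    rw [map_add σ, map_smul σ]
    rfl
  rw [h₁, h.σ_tangent, h.σ_normal]
  ring

/-- With `n` in the second slot only the tangential part of `L u` survives. -/
theorem σ_apply_normal (h : IsG2Hyperplane g₇ φ σ g j n I) {L : V₇ →ₗ[ℝ] V₇} {Λ : V₆ →ₗ[ℝ] V₆}
    (hΛ : ∀ u, L (j u) = j (Λ u) + g₇ (L (j u)) n • n) (u v w : V₆) :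
    σ (L (j u)) n (j v) (j w) = φ (j (I (Λ u))) (j v) (j w) := by
  have h₁ : σ (L (j u)) n (j v) (j w) = σ (j (Λ u)) n (j v) (j w) +
      g₇ (L (j u)) n * σ n n (j v) (j w) := by
    conv_lhs => rw [hΛ u]
    rw [map_add σ, map_smul σ]
    rfl
  rw [h₁, h.g2.σ_self₁₂, h.g2.σ_swap₁₂, h.σ_normal]
  ring

end IsG2Hyperplane

end PointwiseDerivatives

/-! ### The intrinsic torsion of the induced structure. -/

section Torsion

set_option maxSynthPendingDepth 3

theorem partial₂_neg {k : ℕ} {M : Type*} [TopologicalSpace M]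
    [ChartedSpace (EuclideanSpace ℝ (Fin k)) M]
    (T : ∀ m : M, TangentSpace (𝓡 k) m → TangentSpace (𝓡 k) m → ℝ) (m : M)
    (u v w : TangentSpace (𝓡 k) m) :
    partial₂ (fun m x y => -T m x y) m u v w = -partial₂ T m u v w := by
  unfold partial₂
  exact DFunLike.congr_fun (fderiv_neg (𝕜 := ℝ) (f := fun x : EuclideanSpace ℝ (Fin k) =>
    T ((extChartAt (𝓡 k) m).symm x) (coordFrame m x v) (coordFrame m x w))
    (x := extChartAt (𝓡 k) m m)) u

namespace Hypersurface

variable {N : Type*} [TopologicalSpace N] [ChartedSpace (EuclideanSpace ℝ (Fin 7)) N]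
  [IsManifold (𝓡 7) ∞ N] {G : G2Structure N} {M : Type*} [TopologicalSpace M]
  [ChartedSpace (EuclideanSpace ℝ (Fin 6)) M] [IsManifold (𝓡 6) ∞ M] (X : Hypersurface G M)

/-- The conventions `ω(x, y) = ⟨x, I y⟩` and `⟨I x, y⟩ = φ(n, x, y)` give `ω = -ι^*(n ⌟ φ)`. -/
theorem nablaω_eq_neg (θ : M → ℝ) (m : M) (u v w : TangentSpace (𝓡 6) m) :
    (X.su3 θ).nablaω m u v w = -nabla₂ X.g (fun m x y => X.pullNormalφ m x y) m u v w := by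
  have h : (X.su3 θ).kaehlerForm = fun m x y => -X.pullNormalφ m x y := by
    ext m x y
    rw [← X.I_spec, ← X.ILin_apply, ← (X.isSU3 m).I_skew]
    rfl
  rw [SU3Tensors.nablaω, h]
  change nabla₂ X.g _ m u v w = _
  rw [nabla₂, partial₂_neg, nabla₂]
  ring

theorem ψp_eq (θ : M → ℝ) : (X.su3 θ).ψp = fun m x y z =>
    Real.cos (θ m) * X.pullφ m x y z + Real.sin (θ m) * X.pullφ m (X.I m x) y z := by
  ext m x y z
  have h := (X.isG2Hyperplane m).σ_normal x y z
  rw [G.starLin_apply, G.φLin_apply] at h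
  change _ * _ - _ * G.starφ (X.ι m) (X.n m) (X.pushLin m x) (X.pushLin m y) (X.pushLin m z) = _
  rw [h, pullφ, pullφ, ILin_apply]
  simp only [pushLin_apply]
  ring

theorem ψm_eq (θ : M → ℝ) : (X.su3 θ).ψm = fun m x y z =>
    Real.sin (θ m) * X.pullφ m x y z + -Real.cos (θ m) * X.pullφ m (X.I m x) y z := by
  ext m x y z
  have h := (X.isG2Hyperplane m).σ_normal x y z
  rw [G.starLin_apply, G.φLin_apply] at h
  change _ * _ + _ * G.starφ (X.ι m) (X.n m) (X.pushLin m x) (X.pushLin m y) (X.pushLin m z) = _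
  rw [h, pullφ, pullφ, ILin_apply]
  simp only [pushLin_apply]
  ring

section TypeX

variable {m : M} {L : TangentSpace (𝓡 7) (X.ι m) →ₗ[ℝ] TangentSpace (𝓡 7) (X.ι m)}
  {Λ : TangentSpace (𝓡 6) m →ₗ[ℝ] TangentSpace (𝓡 6) m}

/-- The endomorphism that determines `∇ω` by means of `ι^*φ`. -/
def torsionOp (m : M) (Λ : TangentSpace (𝓡 6) m →ₗ[ℝ] TangentSpace (𝓡 6) m) :
    TangentSpace (𝓡 6) m →ₗ[ℝ] TangentSpace (𝓡 6) m :=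
  X.shapeOp m - (X.ILin m).comp Λ

/-- The Weingarten term contributes the shape operator and `∇̄φ` contracted with `n` contributes `I
Λ`. -/
theorem nabla₂_pullNormalφ_eq
    (hL : ∀ w x y z, G.nablaφ (X.ι m) w x y z = G.starφ (X.ι m) (L w) x y z)
    (hΛ : ∀ u, L (X.pushLin m u) =
      X.pushLin m (Λ u) + G.gLin (X.ι m) (L (X.pushLin m u)) (X.n m) • X.n m)
    (u v w : TangentSpace (𝓡 6) m) : nabla₂ X.g (fun m x y => X.pullNormalφ m x y) m u v w =
      -X.pullφLin m (X.torsionOp m Λ u) v w := by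
  have h := X.isG2Hyperplane m
  rw [X.nabla₂_pullNormalφ, hL, ← G.starLin_apply]
  have h₁ := h.σ_apply_normal hΛ u v w
  simp only [pushLin_apply] at h₁
  rw [h₁, ← G.φLin_apply, torsionOp, LinearMap.sub_apply, map_sub, LinearMap.sub_apply,
    LinearMap.sub_apply]
  change _ - X.pullφLin m (X.shapeOp m u) v w = _
  change X.pullφLin m (X.ILin m (Λ u)) v w - _ = _
  rw [LinearMap.comp_apply]
  ring

/-- `ξ_u` is thus a cross product with a fixed vector, whose action on the three-form is given by
`derivationAction_cross`. -/
theorem ξ_spec (hL : ∀ w x y z, G.nablaφ (X.ι m) w x y z = G.starφ (X.ι m) (L w) x y z)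
    (hΛ : ∀ u, L (X.pushLin m u) =
      X.pushLin m (Λ u) + G.gLin (X.ι m) (L (X.pushLin m u)) (X.n m) • X.n m)
    (θ : M → ℝ) (u v y : TangentSpace (𝓡 6) m) : X.gLin m ((X.su3 θ).ξ m u v) y =
      -(1 / 2) * X.pullφLin m (X.ILin m (X.torsionOp m Λ u)) v y := by
  have h := X.isSU3 m
  change X.gLin m (-(1 / 2 : ℝ) • X.ILin m (nablaEnd X.g X.I m u v)) y = _
  have h₁ : X.gLin m (X.ILin m (nablaEnd X.g X.I m u v)) y =
      X.pullφLin m (X.ILin m (X.torsionOp m Λ u)) v y := by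
    rw [← neg_neg (X.gLin m _ y), ← h.I_skew, X.nablaEnd_spec, X.nabla₂_pullNormalφ_eq hL hΛ,
      neg_neg, pullφLin, ← h.I_slide₂, ← h.I_slide]
  rw [map_smul, LinearMap.smul_apply, h₁, smul_eq_mul]

/-- The form `ι^*φ` is rotated by the minimal connection of the almost Hermitian structure. -/
theorem nabla₃_pullφ_add
    (hL : ∀ w x y z, G.nablaφ (X.ι m) w x y z = G.starφ (X.ι m) (L w) x y z)
    (hΛ : ∀ u, L (X.pushLin m u) =
      X.pushLin m (Λ u) + G.gLin (X.ι m) (L (X.pushLin m u)) (X.n m) • X.n m)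
    (θ : M → ℝ) (u v w z : TangentSpace (𝓡 6) m) :
    nabla₃ X.g X.pullφ m u v w z +
        derivationAction ((X.su3 θ).ξ m u) (fun x y z => X.pullφLin m x y z) v w z =
      -(G.gLin (X.ι m) (L (X.pushLin m u)) (X.n m) * X.pullφLin m (X.ILin m v) w z) := by
  have h := X.isG2Hyperplane m
  have hs := X.isSU3 m
  have h₁ := h.σ_apply hΛ u v w z
  have h₂ := hs.derivationAction_cross (X.ξ_spec hL hΛ θ u) v w z
  have h₃ : ∀ x y, G.φLin (X.ι m) (X.n m) (X.pushLin m x) (X.pushLin m y) =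
      X.gLin m (X.ILin m x) y := fun x y => (h.I_spec x y).symm
  -- After this substitution the terms in `B` and `Λ` from `ξ` cancel those from `∇ι^*φ`; the normal
  -- part of `L u` is left.
  have h₄ : ∀ x, X.gLin m (X.ILin m (X.ILin m (X.torsionOp m Λ u))) x =
      -X.B m u x + X.gLin m (X.ILin m (Λ u)) x := fun x => by
    rw [hs.I_sq, torsionOp, LinearMap.sub_apply, LinearMap.comp_apply, neg_sub, map_sub,
      LinearMap.sub_apply, X.shapeOp_spec]
    ring
  change derivationAction _ (fun x y z => X.pullφLin m x y z) v w z = _ at h₂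
  rw [h₂, X.nabla₃_pullφ, hL, ← G.starLin_apply]
  simp only [h₄, ← G.φLin_apply, ← pushLin_apply]
  rw [h₁, h.g2.φ_swap₁₂ (X.pushLin m v) (X.n m), h.g2.φ_cycle (X.pushLin m v) (X.pushLin m w),
    h.g2.φ_cycle (X.pushLin m w) (X.n m), h₃, h₃, h₃, hs.inner_I_left v z]
  change _ - _ * X.pullφLin m (X.ILin m v) w z + _ + _ + _ + _ = _
  ring

/-- This is `(∇ + ξ) I = 0`; it holds because `ξ_u = -½ I (∇_u I)` anticommutes with `I`. -/
theorem nablaEnd_eq_commutator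
    (hL : ∀ w x y z, G.nablaφ (X.ι m) w x y z = G.starφ (X.ι m) (L w) x y z)
    (hΛ : ∀ u, L (X.pushLin m u) =
      X.pushLin m (Λ u) + G.gLin (X.ι m) (L (X.pushLin m u)) (X.n m) • X.n m)
    (θ : M → ℝ) (u v : TangentSpace (𝓡 6) m) : nablaEnd X.g X.I m u v =
      X.ILin m ((X.su3 θ).ξ m u v) - (X.su3 θ).ξ m u (X.ILin m v) := by
  have h := X.isSU3 m
  refine h.eq_of_inner_left fun y => ?_
  have h₁ : ∀ a b, X.gLin m (X.ILin m a) b = -X.gLin m a (X.ILin m b) := fun a b => by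
    rw [h.I_skew, neg_neg]
  rw [map_sub, LinearMap.sub_apply, h₁, X.ξ_spec hL hΛ, X.ξ_spec hL hΛ, X.nablaEnd_spec,
    X.nabla₂_pullNormalφ_eq hL hΛ, pullφLin, ← h.I_slide₂, ← h.I_slide, h.I_sq, map_neg]
  simp only [LinearMap.neg_apply]
  ring

end TypeX

end Hypersurface

end Torsion

theorem IsSU3.exists_ψ_ne_zero {V : Type*} [AddCommGroup V] [Module ℝ V] {g : V →ₗ[ℝ] V →ₗ[ℝ] ℝ}
    {I : V →ₗ[ℝ] V} {ψ : Tensor₃ V} (h : IsSU3 g I ψ) : ∃ x y z, ψ x y z ≠ 0 := by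
  by_contra! h₀
  have he := h.orthonormalFrame_spec
  have h₁ := he 0 0
  rw [h.eq_of_ψ_eq (a := orthonormalFrame 6 (fun x y => g x y) 0) (b := 0) fun y z => by
    rw [h₀, h₀]] at h₁
  simp at h₁

/-! ### The one-form `η` and the pointwise criterion for the types. -/

section Torsion

set_option maxSynthPendingDepth 3

namespace Hypersurface

variable {N : Type*} [TopologicalSpace N] [ChartedSpace (EuclideanSpace ℝ (Fin 7)) N]
  [IsManifold (𝓡 7) ∞ N] {G : G2Structure N} {M : Type*} [TopologicalSpace M]
  [ChartedSpace (EuclideanSpace ℝ (Fin 6)) M] [IsManifold (𝓡 6) ∞ M] (X : Hypersurface G M)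

/-- The real part of the complex volume form, as a trilinear form. -/
def ψpLin (θ : M → ℝ) (m : M) : Tensor₃ (TangentSpace (𝓡 6) m) :=
  Real.cos (θ m) • X.pullφLin m + Real.sin (θ m) • (X.pullφLin m).comp (X.ILin m)

theorem ψpLin_apply (θ : M → ℝ) (m : M) (x y z : TangentSpace (𝓡 6) m) :
    X.ψpLin θ m x y z = (X.su3 θ).ψp m x y z := by
  rw [X.ψp_eq]
  simp only [← pullφLin_apply, ← ILin_apply]
  rfl

/-- The imaginary part of the complex volume form, as a trilinear form. -/
def ψmLin (θ : M → ℝ) (m : M) : Tensor₃ (TangentSpace (𝓡 6) m) :=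
  Real.sin (θ m) • X.pullφLin m + -Real.cos (θ m) • (X.pullφLin m).comp (X.ILin m)

theorem ψmLin_apply (θ : M → ℝ) (m : M) (x y z : TangentSpace (𝓡 6) m) :
    X.ψmLin θ m x y z = (X.su3 θ).ψm m x y z := by
  rw [X.ψm_eq]
  simp only [← pullφLin_apply, ← ILin_apply]
  rfl

theorem isSU3_ψp (θ : M → ℝ) (m : M) : IsSU3 (X.gLin m) (X.ILin m) (X.ψpLin θ m) :=
  (X.isSU3 m).rotate (by linarith [Real.sin_sq_add_cos_sq (θ m)])

theorem isSU3_ψm (θ : M → ℝ) (m : M) : IsSU3 (X.gLin m) (X.ILin m) (X.ψmLin θ m) :=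
  (X.isSU3 m).rotate (by linarith [Real.sin_sq_add_cos_sq (θ m)])

theorem ψmLin_I (θ : M → ℝ) (m : M) (x y z : TangentSpace (𝓡 6) m) :
    X.ψmLin θ m (X.ILin m x) y z = X.ψpLin θ m x y z := by
  change Real.sin (θ m) * X.pullφLin m _ y z + -Real.cos (θ m) * X.pullφLin m (X.ILin m _) y z =
    Real.cos (θ m) * X.pullφLin m _ y z + Real.sin (θ m) * X.pullφLin m (X.ILin m _) y z
  rw [(X.isSU3 m).I_sq, map_neg]
  simp only [LinearMap.neg_apply]
  ring

theorem ψpLin_I (θ : M → ℝ) (m : M) (x y z : TangentSpace (𝓡 6) m) :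
    X.ψpLin θ m (X.ILin m x) y z = -X.ψmLin θ m x y z := by
  rw [← ψmLin_I, (X.isSU3 m).I_sq, map_neg]
  rfl

/-- The differential of a function. -/
def differential (θ : M → ℝ) (m : M) : TangentSpace (𝓡 6) m →ₗ[ℝ] ℝ :=
  (mfderiv (𝓡 6) 𝓘(ℝ, ℝ) θ m : EuclideanSpace ℝ (Fin 6) →L[ℝ] ℝ).toLinearMap

variable {m : M} {L : TangentSpace (𝓡 7) (X.ι m) →ₗ[ℝ] TangentSpace (𝓡 7) (X.ι m)}
  {Λ : TangentSpace (𝓡 6) m →ₗ[ℝ] TangentSpace (𝓡 6) m}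

/-- As `∇ + ξ` annihilates `I`, the formula for `ι^*φ` carries over to `ι^*φ(I ·, ·, ·)`; the
derivatives of the coefficients are added. -/
theorem nabla₃_combination_add
    (hL : ∀ w x y z, G.nablaφ (X.ι m) w x y z = G.starφ (X.ι m) (L w) x y z)
    (hΛ : ∀ u, L (X.pushLin m u) =
      X.pushLin m (Λ u) + G.gLin (X.ι m) (L (X.pushLin m u)) (X.n m) • X.n m)
    (θ : M → ℝ) {a b : M → ℝ} {a' b' : EuclideanSpace ℝ (Fin 6) →L[ℝ] ℝ}
    (ha : HasFDerivAt (fun x => a ((extChartAt (𝓡 6) m).symm x)) a' (extChartAt (𝓡 6) m m))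
    (hb : HasFDerivAt (fun x => b ((extChartAt (𝓡 6) m).symm x)) b' (extChartAt (𝓡 6) m m))
    (u v w z : TangentSpace (𝓡 6) m) :
    nabla₃ X.g (fun m x y z => a m * X.pullφ m x y z + b m * X.pullφ m (X.I m x) y z) m u v w z +
        derivationAction ((X.su3 θ).ξ m u)
          (fun x y z => a m * X.pullφ m x y z + b m * X.pullφ m (X.I m x) y z) v w z =
      (a' u + b m * G.gLin (X.ι m) (L (X.pushLin m u)) (X.n m)) * X.pullφLin m v w z +
      (b' u - a m * G.gLin (X.ι m) (L (X.pushLin m u)) (X.n m)) *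
        X.pullφLin m (X.ILin m v) w z := by
  have h₁ := X.nabla₃_pullφ_add hL hΛ θ u v w z
  have h₂ := X.nabla₃_pullφ_add hL hΛ θ u (X.ILin m v) w z
  rw [(X.isSU3 m).I_sq] at h₂
  rw [X.nabla₃_combination m ha hb, X.nablaEnd_eq_commutator hL hΛ θ]
  simp only [derivationAction, ← pullφLin_apply, ← ILin_apply, map_sub, LinearMap.sub_apply,
    map_neg, LinearMap.neg_apply] at h₁ h₂ ⊢
  linear_combination a m * h₁ + b m * h₂

/-- The `𝒲₅`-part of the intrinsic torsion. -/
theorem isEta_iff (hL : ∀ w x y z, G.nablaφ (X.ι m) w x y z = G.starφ (X.ι m) (L w) x y z)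
    (hΛ : ∀ u, L (X.pushLin m u) =
      X.pushLin m (Λ u) + G.gLin (X.ι m) (L (X.pushLin m u)) (X.n m) • X.n m)
    {θ : M → ℝ} (hθ : MDifferentiableAt (𝓡 6) 𝓘(ℝ, ℝ) θ m) (η : TangentSpace (𝓡 6) m →ₗ[ℝ] ℝ) :
    (X.su3 θ).IsEta m η ↔ ∀ x : TangentSpace (𝓡 6) m, 3 * η (X.ILin m x) =
      G.gLin (X.ι m) (L (X.pushLin m x)) (X.n m) - differential θ m x := by
  have hθ' := hasFDerivAt_of_mdifferentiableAt hθ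
  have hp := X.nabla₃_combination_add hL hΛ θ (a := fun m => Real.cos (θ m))
    (b := fun m => Real.sin (θ m)) hθ'.cos hθ'.sin
  have hm := X.nabla₃_combination_add hL hΛ θ (a := fun m => Real.sin (θ m))
    (b := fun m => -Real.cos (θ m)) hθ'.sin hθ'.cos.neg
  -- The obstruction for `ψ₊` is a multiple of `ψ₋`, that for `ψ₋` minus the same multiple of `ψ₊`;
  -- both vanish by one scalar equation for each `x`. The factor `3` counts the slots on which `I`
  -- acts.
  have key : ∀ x y z w : TangentSpace (𝓡 6) m,
      nabla₃ (X.su3 θ).g (X.su3 θ).ψp m x y z w +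
          derivationAction ((X.su3 θ).etaEnd m η x) ((X.su3 θ).ψp m) y z w +
          derivationAction ((X.su3 θ).ξ m x) ((X.su3 θ).ψp m) y z w =
        (G.gLin (X.ι m) (L (X.pushLin m x)) (X.n m) - differential θ m x -
          3 * η (X.ILin m x)) * X.ψmLin θ m y z w ∧
      nabla₃ (X.su3 θ).g (X.su3 θ).ψm m x y z w +
          derivationAction ((X.su3 θ).etaEnd m η x) ((X.su3 θ).ψm m) y z w +
          derivationAction ((X.su3 θ).ξ m x) ((X.su3 θ).ψm m) y z w =
        -(G.gLin (X.ι m) (L (X.pushLin m x)) (X.n m) - differential θ m x -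
          3 * η (X.ILin m x)) * X.ψpLin θ m y z w := by
    intro x y z w
    have h₁ : derivationAction ((X.su3 θ).etaEnd m η x) ((X.su3 θ).ψp m) y z w =
        3 * η (X.ILin m x) * -X.ψmLin θ m y z w := by
      have := (X.isSU3_ψp θ m).derivationAction_I (-η (X.ILin m x)) y z w
      rw [ψpLin_I] at this
      simp only [ψpLin_apply] at this
      exact this.trans (by ring)
    have h₂ : derivationAction ((X.su3 θ).etaEnd m η x) ((X.su3 θ).ψm m) y z w =
        3 * η (X.ILin m x) * X.ψpLin θ m y z w := by
      have := (X.isSU3_ψm θ m).derivationAction_I (-η (X.ILin m x)) y z w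
      rw [ψmLin_I] at this
      simp only [ψmLin_apply] at this
      exact this.trans (by ring)
    have hp' := hp x y z w
    have hm' := hm x y z w
    rw [h₁, h₂]
    constructor
    · rw [X.ψp_eq]
      change nabla₃ X.g _ m x y z w + _ + _ = _
      rw [add_right_comm, hp', ψmLin]
      simp only [chart_symm_self]
      change (-Real.sin (θ m) * differential θ m x + _) * _ +
        (Real.cos (θ m) * differential θ m x - _) * _ + _ * -(Real.sin (θ m) *
          X.pullφLin m y z w + -Real.cos (θ m) * X.pullφLin m (X.ILin m y) z w) =
        _ * (Real.sin (θ m) *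
          X.pullφLin m y z w + -Real.cos (θ m) * X.pullφLin m (X.ILin m y) z w)
      ring
    · rw [X.ψm_eq]
      change nabla₃ X.g _ m x y z w + _ + _ = _
      rw [add_right_comm, hm', ψpLin]
      simp only [chart_symm_self]
      change (Real.cos (θ m) * differential θ m x + _) * _ +
        (-(-Real.sin (θ m) * differential θ m x) - _) * _ + _ * (Real.cos (θ m) *
          X.pullφLin m y z w + Real.sin (θ m) * X.pullφLin m (X.ILin m y) z w) =
        _ * (Real.cos (θ m) *
          X.pullφLin m y z w + Real.sin (θ m) * X.pullφLin m (X.ILin m y) z w)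
      ring
  constructor
  · intro h x
    obtain ⟨y, z, w, hne⟩ := (X.isSU3_ψm θ m).exists_ψ_ne_zero
    have := (key x y z w).1.symm.trans (h x y z w).1
    linarith [(mul_eq_zero.1 this).resolve_right hne]
  · intro h x y z w
    rw [(key x y z w).1, (key x y z w).2, h x]
    simp

/-- The bilinear form `r(∇ω)`. -/
def torsionForm (θ : M → ℝ) (m : M) (x y : TangentSpace (𝓡 6) m) : ℝ :=
  Real.cos (θ m) * X.B m x y - Real.sin (θ m) * X.pullRbar m x y +
    Real.sin (θ m) * X.B m x (X.I m y) + Real.cos (θ m) * X.pullRbar m x (X.I m y)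

theorem _root_.G2Structure.rbar_eq (G : G2Structure N) {p : N}
    {L : TangentSpace (𝓡 7) p →ₗ[ℝ] TangentSpace (𝓡 7) p}
    (hL : ∀ w x y z, G.nablaφ p w x y z = G.starφ p (L w) x y z) (x y : TangentSpace (𝓡 7) p) :
    G.rbar p x y = G.gLin p (L x) y := by
  have h₁ : G.nablaφ p x = fun a b c => G.starLin p (L x) a b c := by
    ext a b c; exact hL x a b c
  have h₂ := (G.isG2 p).formInner₃_σ (L x) y
  rw [G2Structure.rbar, h₁]
  change 1 / 4 * formInner₃ 7 (fun x y => G.gLin p x y) _ (fun a b c => G.starLin p y a b c) = _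
  rw [h₂]
  ring

/-- Characterisation of the types of the structures induced on a hypersurface. -/
theorem mem_type_iff (hL : ∀ w x y z, G.nablaφ (X.ι m) w x y z = G.starφ (X.ι m) (L w) x y z)
    (hLs : ∀ x y, G.gLin (X.ι m) (L x) y = G.gLin (X.ι m) (L y) x)
    {θ : M → ℝ} (hθ : MDifferentiableAt (𝓡 6) 𝓘(ℝ, ℝ) θ m) {C : Set TorsionClass} (hC : .W4 ∉ C) :
    (∃ τ ∈ ⨆ c ∈ C, torsionModule ((X.su3 θ).g m) ((X.su3 θ).I m) ((X.su3 θ).ψp m) c,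
      (∀ x y z, τ.1 x y z = (X.su3 θ).nablaω m x y z) ∧ (X.su3 θ).IsEta m τ.2) ↔
    (∀ d ∉ C, d ≠ .W5 → formComponent (X.g m) (X.I m) d (X.torsionForm θ m) = 0) ∧
      (.W5 ∉ C → ∀ x : TangentSpace (𝓡 6) m, differential θ m x =
        G.rbar (X.ι m) (X.push m x) (X.n m)) := by
  have h := X.isSU3_ψp θ m
  obtain ⟨Λ, hΛ', hΛ⟩ := (X.isG2Hyperplane m).exists_tangent L
  have hr : ∀ x, G.rbar (X.ι m) (X.push m x) (X.n m) =
      G.gLin (X.ι m) (L (X.pushLin m x)) (X.n m) := fun x => G.rbar_eq hL _ _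
  have h_rbar : ∀ x y, X.pullRbar m x y = X.gLin m (Λ x) y := fun x y =>
    (G.rbar_eq hL _ _).trans (hΛ' x y).symm
  -- Undoing the phase: `ψ₊(R u, ·, ·) = ι^*φ(torsionOp u, ·, ·)` by `cos² + sin² = 1`.
  let R : TangentSpace (𝓡 6) m →ₗ[ℝ] TangentSpace (𝓡 6) m :=
    Real.cos (θ m) • X.torsionOp m Λ - Real.sin (θ m) • (X.ILin m).comp (X.torsionOp m Λ)
  -- The solution of the equation in `isEta_iff`, obtained by replacing `x` with `I x`.
  let η : TangentSpace (𝓡 6) m →ₗ[ℝ] ℝ := -(1 / 3 : ℝ) •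
    (((G.gLin (X.ι m)).flip (X.n m)).comp (L.comp (X.pushLin m)) -
      differential θ m).comp (X.ILin m)
  have hη : ∀ x, η x = -(1 / 3) * (G.gLin (X.ι m) (L (X.pushLin m (X.ILin m x))) (X.n m) -
      differential θ m (X.ILin m x)) := fun x => rfl
  have hη' : ∀ x, η (X.ILin m x) = 1 / 3 * (G.gLin (X.ι m) (L (X.pushLin m x)) (X.n m) -
      differential θ m x) := fun x => by
    rw [hη, h.I_sq, map_neg, map_neg, map_neg, map_neg]
    simp only [LinearMap.neg_apply]
    ring
  have hRform : (fun x y => X.gLin m (R x) y) = X.torsionForm θ m := by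
    ext x y
    have h₁ : ∀ a b, X.gLin m (X.ILin m a) b = -X.gLin m a (X.ILin m b) := fun a b => by
      rw [h.I_skew, neg_neg]
    simp only [R, torsionOp, torsionForm, h_rbar, LinearMap.sub_apply, LinearMap.smul_apply,
      LinearMap.comp_apply, map_sub, map_smul, smul_eq_mul, h₁, h.I_sq, X.shapeOp_spec, map_neg,
      LinearMap.neg_apply, ← ILin_apply]
    ring
  have hω : ∀ x y z, (X.ψpLin θ m).comp R x y z = (X.su3 θ).nablaω m x y z := fun x y z => by
    rw [X.nablaω_eq_neg, X.nabla₂_pullNormalφ_eq hL hΛ, neg_neg]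
    have h₁ : ∀ v, X.ψpLin θ m v y z = Real.cos (θ m) * X.pullφLin m v y z +
      Real.sin (θ m) * X.pullφLin m (X.ILin m v) y z := fun v => rfl
    rw [LinearMap.comp_apply, h₁]
    simp only [R, LinearMap.sub_apply, LinearMap.smul_apply,
      LinearMap.comp_apply, map_sub, map_smul, smul_eq_mul, h.I_sq, map_neg, LinearMap.neg_apply]
    linear_combination X.pullφLin m (X.torsionOp m Λ x) y z * Real.sin_sq_add_cos_sq (θ m)
  -- The part of `R` anticommuting with `I` is symmetric because `B` and `ι^* r̄(φ)` are; this is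
  -- the absence of `𝒲₄`.
  have hsym : ∀ x y, X.gLin m (R x) y - X.gLin m (R (X.ILin m x)) (X.ILin m y) =
      X.gLin m (R y) x - X.gLin m (R (X.ILin m y)) (X.ILin m x) := fun x y => by
    have h₁ : ∀ x y, X.gLin m (R x) y = X.torsionForm θ m x y := fun x y =>
      congrFun (congrFun hRform x) y
    have h₂ : ∀ x y, X.gLin m (Λ x) y = X.gLin m (Λ y) x := fun x y => by rw [hΛ', hΛ', hLs]
    have hB : ∀ x y, X.BLin m x y = X.BLin m y x := X.B_symm m
    simp only [h₁, torsionForm, h_rbar, ← ILin_apply, ← BLin_apply, h.I_sq, map_neg]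
    rw [h₂ x y, h₂ x (X.ILin m y), h₂ (X.ILin m x) (X.ILin m y), h₂ (X.ILin m x) y, hB x y,
      hB x (X.ILin m y), hB (X.ILin m x) (X.ILin m y), hB (X.ILin m x) y]
    ring
  have hmem := h.mem_iSup_torsion_iff R η hsym hC
  have hψ : (fun x y z => X.ψpLin θ m x y z) = (X.su3 θ).ψp m := by
    ext x y z; exact X.ψpLin_apply θ m x y z
  have hmod : ∀ c, h.torsion c =
      torsionModule ((X.su3 θ).g m) ((X.su3 θ).I m) ((X.su3 θ).ψp m) c := fun c => by
    rw [← hψ]; rfl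
  simp only [hmod] at hmem
  have hcomp : (∀ d ∉ C, h.component d ((X.ψpLin θ m).comp R, η) = 0) ↔
      (∀ d ∉ C, d ≠ .W5 → formComponent (X.g m) (X.I m) d (X.torsionForm θ m) = 0) ∧
      (.W5 ∉ C → ∀ x : TangentSpace (𝓡 6) m, differential θ m x =
        G.rbar (X.ι m) (X.push m x) (X.n m)) := by
    have h₁ : ∀ d ≠ .W5, h.component d ((X.ψpLin θ m).comp R, η) =
        formComponent (X.g m) (X.I m) d (X.torsionForm θ m) := fun d hd => by
      rw [h.component_comp (R := R) (fun _ _ _ => rfl) η hd, hRform]; rfl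
    have h₂ : h.component .W5 ((X.ψpLin θ m).comp R, η) = 0 ↔
        ∀ x : TangentSpace (𝓡 6) m, differential θ m x =
          G.rbar (X.ι m) (X.push m x) (X.n m) := by
      constructor
      · intro h₃ x
        have h₄ : η (X.ILin m x) = 0 := congrFun (congrFun h₃ (X.ILin m x)) x
        rw [hη'] at h₄
        rw [hr]
        linarith
      · intro h₃
        ext x y
        change η x = 0
        rw [hη, h₃, hr, X.pushLin_apply]
        simp
    constructor
    · exact fun h₃ => ⟨fun d hd hd₅ => (h₁ d hd₅).symm.trans (h₃ d hd), fun hd => h₂.1 (h₃ _ hd)⟩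
    · rintro ⟨h₃, h₄⟩ d hd
      by_cases hd₅ : d = .W5
      · subst hd₅; exact h₂.2 (h₄ hd)
      · exact (h₁ d hd₅).trans (h₃ d hd hd₅)
  rw [← hcomp, ← hmem]
  have hEta := X.isEta_iff hL hΛ hθ
  constructor
  -- The pair is unique: `∇ω` fixes the tensor and `isEta_iff` the one-form, so existence of a
  -- suitable `τ` is membership of this one.
  · rintro ⟨⟨α, η'⟩, hτ, hα, hη₁⟩
    have h₁ : α = (X.ψpLin θ m).comp R := by
      ext x y z; exact (hα x y z).trans (hω x y z).symm
    have h₂ : η' = η := by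
      ext x
      have h₃ := (hEta η').1 hη₁ (X.ILin m x)
      have h₄ := hη' (X.ILin m x)
      rw [h.I_sq, map_neg] at h₃ h₄
      linarith
    rw [← h₁, ← h₂]
    exact hτ
  · intro hτ
    refine ⟨_, hτ, hω, (hEta η).2 fun x => ?_⟩
    rw [hη']
    ring

end Hypersurface

end Torsion

/-! ### Type `𝒳₃` as a symmetric trace-free endomorphism. -/

section TypeX

/-- A subspace meets the kernel of a linear map to a space of smaller dimension nontrivially. -/
theorem Submodule.inf_ker_ne_bot {K E F : Type*} [Field K] [AddCommGroup E] [Module K E]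
    [AddCommGroup F] [Module K F] [FiniteDimensional K F] (U : Submodule K E) (f : E →ₗ[K] F)
    (h : Module.finrank K F < Module.finrank K U) : U ⊓ LinearMap.ker f ≠ ⊥ := fun hb => by
  refine h.not_ge (LinearMap.finrank_le_finrank_of_injective (f := f.domRestrict U) ?_)
  rw [← LinearMap.ker_eq_bot, LinearMap.ker_eq_bot']
  rintro ⟨x, hx⟩ hfx
  have : x ∈ U ⊓ LinearMap.ker f := ⟨hx, hfx⟩
  rw [hb, Submodule.mem_bot] at this
  exact Subtype.ext this

variable {V : Type*} [AddCommGroup V] [Module ℝ V] {g : V →ₗ[ℝ] V →ₗ[ℝ] ℝ} {φ : Tensor₃ V}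
  {σ : Tensor₄ V}

namespace IsG2

/-- The four-form is invariant under `G₂`. -/
theorem σ_map (h : IsG2 g φ σ) {A : V →ₗ[ℝ] V} (hg : ∀ x y, g (A x) (A y) = g x y)
    (hφ : ∀ x y z, φ (A x) (A y) (A z) = φ x y z) (x y z w : V) :
    σ (A x) (A y) (A z) (A w) = σ x y z w := by
  have he := h.orthonormalFrame_spec
  have h₁ := h.contraction _ he x y z w
  have h₂ := h.contraction _ (he.map A hg) (A x) (A y) (A z) (A w)
  simp only [hφ, hg] at h₂
  linarith

theorem eq_of_σ_eq (h : IsG2 g φ σ) {a b : V} (hab : ∀ x y z, σ a x y z = σ b x y z) : a = b :=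
  h.eq_of_inner_left fun w => by
    have h₁ := h.sum_σ_mul_σ h.orthonormalFrame_spec a w
    have h₂ := h.sum_σ_mul_σ h.orthonormalFrame_spec b w
    simp only [hab] at h₁
    linarith

set_option maxSynthPendingDepth 3 in
/-- The four-tensor with a given endomorphism. -/
def tensorOfEnd (σ : Tensor₄ V) : (V →ₗ[ℝ] V) →ₗ[ℝ] Tensor₄ V where
  toFun L := σ.comp L
  map_add' _ _ := LinearMap.comp_add ..
  map_smul' _ _ := LinearMap.comp_smul ..

theorem tensorOfEnd_apply (σ : Tensor₄ V) (L : V →ₗ[ℝ] V) (w x y z : V) :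
    tensorOfEnd σ L w x y z = σ (L w) x y z := rfl

theorem tensorOfEnd_injective (h : IsG2 g φ σ) : Function.Injective (tensorOfEnd σ) :=
  fun L L' hL => LinearMap.ext fun w => h.eq_of_σ_eq fun x y z => by
    rw [← tensorOfEnd_apply, hL, tensorOfEnd_apply]

end IsG2

/-- The skew-symmetric part of an endomorphism, in an orthonormal frame. -/
def skewPart (g : V →ₗ[ℝ] V →ₗ[ℝ] ℝ) {k : ℕ} (e : Fin k → V) :
    (V →ₗ[ℝ] V) →ₗ[ℝ] ({p : Fin k × Fin k // p.1 < p.2} → ℝ) where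
  toFun L p := g (L (e p.1.1)) (e p.1.2) - g (L (e p.1.2)) (e p.1.1)
  map_add' L L' := by ext p; simp; ring
  map_smul' c L := by ext p; simp; ring

/-- The trace of an endomorphism, in an orthonormal frame. -/
def frameTrace (g : V →ₗ[ℝ] V →ₗ[ℝ] ℝ) {k : ℕ} (e : Fin k → V) : (V →ₗ[ℝ] V) →ₗ[ℝ] ℝ where
  toFun L := ∑ i, g (L (e i)) (e i)
  map_add' L L' := by simp [Finset.sum_add_distrib]
  map_smul' c L := by simp [Finset.mul_sum]

theorem IsScalarProduct.mem_ker_skewPart {k : ℕ} (hg : IsScalarProduct k g) {e : Fin k → V}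
    (he : IsONFrame g e) {L : V →ₗ[ℝ] V} :
    L ∈ LinearMap.ker (skewPart g e) ↔ ∀ x y, g (L x) y = g (L y) x := by
  constructor
  · intro h
    have h₁ : ∀ i j, g (L (e i)) (e j) = g (L (e j)) (e i) := fun i j => by
      rcases lt_trichotomy i j with hij | rfl | hij
      · exact sub_eq_zero.1 (congrFun h ⟨(i, j), hij⟩)
      · rfl
      · exact (sub_eq_zero.1 (congrFun h ⟨(j, i), hij⟩)).symm
    have h₂ : ∀ i y, g (L (e i)) y = g (L y) (e i) := fun i y => by
      rw [← hg.sum_inner_mul he (g (L (e i))) y]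
      refine .trans (Finset.sum_congr rfl fun j _ => ?_)
        (hg.sum_inner_mul he ((g.flip (e i)).comp L) y)
      rw [h₁]; rfl
    intro x y
    refine (hg.sum_inner_mul he ((g.flip y).comp L) x).symm.trans ?_
    rw [← hg.sum_inner_mul he (g (L y)) x]
    exact Finset.sum_congr rfl fun i _ => by rw [← h₂]; rfl
  · intro h
    ext p
    exact sub_eq_zero.2 (h _ _)

namespace G2Structure

variable {N : Type*} [TopologicalSpace N] [ChartedSpace (EuclideanSpace ℝ (Fin 7)) N]
  [IsManifold (𝓡 7) ∞ N] (G : G2Structure N)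

/-- An irreducible module in `𝒳` lies in the kernel of an equivariant map to a space of smaller
dimension. -/
theorem le_ker_of_irreducible {p : N} {W : Submodule ℝ (Tensor₄ (TangentSpace (𝓡 7) p))}
    (hX : ∀ α ∈ W, α ∈ G.spaceX p) (hW : G.IsG2Irreducible p W) {F : Type*} [AddCommGroup F]
    [Module ℝ F] [FiniteDimensional ℝ F] (hF : Module.finrank ℝ F < Module.finrank ℝ W)
    (f : (TangentSpace (𝓡 7) p →ₗ[ℝ] TangentSpace (𝓡 7) p) →ₗ[ℝ] F)
    (hf : ∀ A, G.IsG2Element p A → ∀ L L' : TangentSpace (𝓡 7) p →ₗ[ℝ] TangentSpace (𝓡 7) p,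
      f L = 0 → (∀ x, A (L' x) = L (A x)) → f L' = 0) :
    W ≤ (LinearMap.ker f).map (IsG2.tensorOfEnd (G.starLin p)) := by
  have h := G.isG2 p
  set T := IsG2.tensorOfEnd (G.starLin p) with hT
  have hinj : Function.Injective T := h.tensorOfEnd_injective
  have hmap : (W.comap T).map T = W := by
    rw [Submodule.map_comap_eq, inf_eq_right]
    intro α hα
    obtain ⟨L, hL⟩ := hX α hα
    refine ⟨L, ?_⟩
    ext w x y z
    exact (hL w x y z).symm
  have hdim : Module.finrank ℝ (W.comap T) = Module.finrank ℝ W := by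
    have := (LinearEquiv.finrank_eq (Submodule.equivMapOfInjective T hinj (W.comap T)))
    rw [hmap] at this
    exact this
  have hle : (W.comap T ⊓ LinearMap.ker f).map T ≤ W :=
    (Submodule.map_mono inf_le_left).trans hmap.le
  have hinv : G.IsG2Invariant p ((W.comap T ⊓ LinearMap.ker f).map T) := by
    rintro A hA _ ⟨L, ⟨hLW, hLf⟩, rfl⟩ β hβ
    -- `A` preserves `σ`, so it acts on tensors in `𝒳` by conjugating the endomorphism.
    let L' : TangentSpace (𝓡 7) p →ₗ[ℝ] TangentSpace (𝓡 7) p :=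
      A.symm.toLinearMap ∘ₗ L ∘ₗ A.toLinearMap
    have hL' : ∀ x, A (L' x) = L (A x) := fun x => A.apply_symm_apply _
    have hβ' : T L' = β := by
      ext w x y z
      rw [hβ, hT, IsG2.tensorOfEnd_apply, IsG2.tensorOfEnd_apply, ← hL']
      exact (h.σ_map (A := A.toLinearMap) hA.1 (fun x y z => by
        rw [G.φLin_apply, G.φLin_apply]; exact hA.2.2 x y z) _ _ _ _).symm
    exact ⟨L', ⟨by rw [SetLike.mem_coe, Submodule.mem_comap, hβ']; exact hW.1 A hA _ hLW β hβ,
      hf A hA L L' hLf hL'⟩, hβ'⟩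
  -- By irreducibility the kernel in `W` is zero or all of `W`; the dimension count rules out zero.
  rcases hW.2.2 _ hle hinv with h₁ | h₁
  · have h₂ := Submodule.map_injective_of_injective hinj (h₁.trans (Submodule.map_bot T).symm)
    exact absurd h₂ ((W.comap T).inf_ker_ne_bot f (hdim ▸ hF))
  · exact h₁ ▸ Submodule.map_mono inf_le_right

/-- The derivative of the fundamental form of a structure of type `𝒳₃` is given by a symmetric
endomorphism without trace. -/
theorem IsTypeX₃.exists_endomorphism (hG : G.IsTypeX₃) (p : N) :
    ∃ L : TangentSpace (𝓡 7) p →ₗ[ℝ] TangentSpace (𝓡 7) p,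
      (∀ w x y z, G.nablaφ p w x y z = G.starφ p (L w) x y z) ∧
      (∀ x y, G.gLin p (L x) y = G.gLin p (L y) x) ∧
      ∀ e : Fin 7 → TangentSpace (𝓡 7) p, IsONFrame (G.gLin p) e →
        ∑ i, G.gLin p (L (e i)) (e i) = 0 := by
  have h := G.isG2 p
  have he := h.orthonormalFrame_spec
  obtain ⟨α, hα, hα'⟩ := hG p
  set e := orthonormalFrame 7 fun x y => G.gLin p x y
  have h₁ : G.spaceX₃ p ≤ (LinearMap.ker (skewPart (G.gLin p) e)).map
      (IsG2.tensorOfEnd (G.starLin p)) :=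
    -- There are `21` pairs `i < j` in `Fin 7`, and `21 < 27`.
    sSup_le fun W ⟨hX, hW, hd⟩ => G.le_ker_of_irreducible hX hW (by
      rw [hd, Module.finrank_fintype_fun_eq_card]; decide) _ fun A hA L L' hL hL' => by
        have h₂ := (h.mem_ker_skewPart he).1 hL
        refine (h.mem_ker_skewPart he).2 fun x y => ?_
        have hi : ∀ x y, G.gLin p (A x) (A y) = G.gLin p x y := hA.1
        rw [← hi, ← hi (L' y), hL', hL', h₂]
  have h₂ : G.spaceX₃ p ≤ (LinearMap.ker (frameTrace (G.gLin p) e)).map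
      (IsG2.tensorOfEnd (G.starLin p)) :=
    sSup_le fun W ⟨hX, hW, hd⟩ => G.le_ker_of_irreducible hX hW (by
      rw [hd, Module.finrank_self]; norm_num) _ fun A hA L L' hL hL' => by
        have hi : ∀ x y, G.gLin p (A x) (A y) = G.gLin p x y := hA.1
        have h₃ := h.sum_diag_eq (he.map A.toLinearMap hi) he ((G.gLin p).comp L)
        change ∑ i, G.gLin p (L' (e i)) (e i) = 0
        refine .trans (Finset.sum_congr rfl fun i _ => ?_) (h₃.trans hL)
        rw [← hi, hL']; rfl
  obtain ⟨L, hL, hLα⟩ := h₁ hα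
  obtain ⟨L', hL', hLα'⟩ := h₂ hα
  -- The two inclusions provide separate preimages of the tensor, which agree by injectivity.
  obtain rfl : L = L' := h.tensorOfEnd_injective (hLα.trans hLα'.symm)
  refine ⟨L, fun w x y z => ?_, (h.mem_ker_skewPart he).1 hL, fun f hf => ?_⟩
  · rw [← hα', ← hLα]; rfl
  · exact (h.sum_diag_eq hf he ((G.gLin p).comp L)).trans hL'

end G2Structure

end TypeX

/-! ### The components of `r(∇ω)` in terms of `B` and `r̄(φ)`. -/

section Components

variable {V : Type*} [AddCommGroup V] [Module ℝ V]

namespace IsSU3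

variable {g : V →ₗ[ℝ] V →ₗ[ℝ] ℝ} {I : V →ₗ[ℝ] V} {ψ : Tensor₃ V}

/-- Passing from the frame `e` to `I e` changes the sign of the sum. -/
theorem sum_inner_I_eq_zero (h : IsSU3 g I ψ) {b : V →ₗ[ℝ] V →ₗ[ℝ] ℝ} (hb : ∀ x y, b x y = b y x)
    {e : Fin 6 → V} (he : IsONFrame g e) : ∑ i, b (e i) (I (e i)) = 0 := by
  have h₁ := h.sum_diag_eq (he.map I h.I_isom) he (b.compl₂ I)
  simp only [LinearMap.compl₂_apply, h.I_sq, map_neg, LinearMap.neg_apply, Finset.sum_neg_distrib,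
    hb (I _)] at h₁
  linarith

variable {B P : V →ₗ[ℝ] V →ₗ[ℝ] ℝ} {c s β ρ : ℝ}

/-- The components of the bilinear form `c B - s P + (s B + c P)(·, I ·)` built from two symmetric
forms. -/
theorem formComponent_eq_zero_iff (h : IsSU3 g I ψ) (hB : ∀ x y, B x y = B y x)
    (hP : ∀ x y, P x y = P y x) (hcs : s ^ 2 + c ^ 2 = 1)
    (hβ : ∑ i, B (orthonormalFrame 6 (fun x y => g x y) i)
      (orthonormalFrame 6 (fun x y => g x y) i) = β)
    (hρ : ∑ i, P (orthonormalFrame 6 (fun x y => g x y) i)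
      (orthonormalFrame 6 (fun x y => g x y) i) = -ρ)
    {f : V → V → ℝ} (hf : ∀ x y, f x y = c * B x y - s * P x y + s * B x (I y) + c * P x (I y)) :
    (formComponent (fun x y => g x y) (fun x => I x) .W1plus f = 0 ↔ s * ρ = -β * c) ∧
    (formComponent (fun x y => g x y) (fun x => I x) .W1minus f = 0 ↔ c * ρ = β * s) ∧
    (formComponent (fun x y => g x y) (fun x => I x) .W2plus f = 0 ↔
      ∀ x y, -3 * s * (P x y + P (I x) (I y)) + 3 * c * (B x y + B (I x) (I y)) =
        (β * c + s * ρ) * g x y) ∧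
    (formComponent (fun x y => g x y) (fun x => I x) .W2minus f = 0 ↔
      ∀ x y, 3 * c * (P x y + P (I x) (I y)) + 3 * s * (B x y + B (I x) (I y)) =
        (β * s - c * ρ) * g x y) ∧
    (formComponent (fun x y => g x y) (fun x => I x) .W3 f = 0 ↔
      ∀ x y, -P (I x) y + -P x (I y) = B x y - B (I x) (I y)) := by
  have he := h.orthonormalFrame_spec
  set e := orthonormalFrame 6 fun x y => g x y
  have hBI := h.sum_inner_I_eq_zero hB he
  have hPI := h.sum_inner_I_eq_zero hP he
  have h₁ : ∑ i, f (e i) (e i) = c * β + s * ρ := by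
    simp only [hf, Finset.sum_add_distrib, Finset.sum_sub_distrib, ← Finset.mul_sum, hβ, hρ, hBI,
      hPI]
    ring
  have h₂ : ∑ i, f (e i) (I (e i)) = -(s * β) + c * ρ := by
    simp only [hf, h.I_sq, map_neg, mul_neg, Finset.sum_add_distrib, Finset.sum_sub_distrib,
      Finset.sum_neg_distrib, ← Finset.mul_sum, hβ, hρ, hBI, hPI]
    ring
  have hx : ∃ x : V, x ≠ 0 := by
    obtain ⟨x, y, z, hne⟩ := h.exists_ψ_ne_zero
    exact ⟨x, fun h₀ => hne (by simp [h₀])⟩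
  obtain ⟨x₀, -⟩ := hx
  refine ⟨⟨fun h₃ => ?_, fun h₃ => ?_⟩, ⟨fun h₃ => ?_, fun h₃ => ?_⟩,
    ⟨fun h₃ x y => ?_, fun h₃ => ?_⟩, ⟨fun h₃ x y => ?_, fun h₃ => ?_⟩,
    ⟨fun h₃ x y => ?_, fun h₃ => ?_⟩⟩
  · have h₄ : ∑ i, f (e i) (e i) = 0 := congrFun (congrFun h₃ x₀) x₀
    linarith
  · ext x y
    change ∑ i, f (e i) (e i) = 0
    linarith
  · have h₄ : ∑ i, f (e i) (I (e i)) = 0 := congrFun (congrFun h₃ x₀) x₀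
    linarith
  · ext x y
    change ∑ i, f (e i) (I (e i)) = 0
    linarith
  · have h₄ : f x y + f (I x) (I y) + (f y x + f (I y) (I x)) - 2 / 3 * g x y * ∑ i, f (e i) (e i) = 0 :=
      congrFun (congrFun h₃ x) y
    rw [h₁] at h₄
    simp only [hf, h.I_sq, map_neg] at h₄
    rw [hB y x, hP y x, hB (I y) (I x), hP (I y) (I x), hB (I y) x, hP (I y) x, hB y (I x),
      hP y (I x)] at h₄
    linarith
  · ext x y
    change f x y + f (I x) (I y) + (f y x + f (I y) (I x)) - 2 / 3 * g x y * ∑ i, f (e i) (e i) = 0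
    have h₄ := h₃ x y
    rw [h₁]
    simp only [hf, h.I_sq, map_neg]
    rw [hB y x, hP y x, hB (I y) (I x), hP (I y) (I x), hB (I y) x, hP (I y) x, hB y (I x),
      hP y (I x)]
    linarith
  -- Evaluation at `(x, I y)` turns the skew `I`-invariant component into a symmetric form, as in
  -- the stated condition.
  · have h₄ : f x (I y) + f (I x) (I (I y)) - (f (I y) x + f (I (I y)) (I x)) -
        2 / 3 * g (I x) (I y) * ∑ i, f (e i) (I (e i)) = 0 := congrFun (congrFun h₃ x) (I y)
    rw [h₂] at h₄
    simp only [hf, h.I_sq, map_neg, LinearMap.neg_apply, h.I_isom] at h₄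
    rw [hB y x, hP y x, hB (I y) (I x), hP (I y) (I x), hB (I y) x, hP (I y) x, hB y (I x),
      hP y (I x)] at h₄
    linarith
  · ext x y
    change f x y + f (I x) (I y) - (f y x + f (I y) (I x)) - 2 / 3 * g (I x) y * ∑ i, f (e i) (I (e i)) = 0
    have h₄ := h₃ x (I y)
    rw [h₂]
    simp only [hf, h.I_sq, map_neg, h.I_skew] at h₄ ⊢
    rw [hB y x, hP y x, hB (I y) (I x), hP (I y) (I x), hB (I y) x, hP (I y) x, hB y (I x),
      hP y (I x)]
    linarith
  · have h₄ : f x y - f (I x) (I y) = 0 := congrFun (congrFun h₃ x) y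
    have h₅ : f x (I y) - f (I x) (I (I y)) = 0 := congrFun (congrFun h₃ x) (I y)
    simp only [hf, h.I_sq, map_neg] at h₄ h₅
    -- If `D` is the right side minus the left side of the condition, the component at `(x, y)` is
    -- `c D(x, y) + s D(x, I y)`, and at `(x, I y)` it is `c D(x, I y) - s D(x, y)`. Inverting this
    -- rotation removes `θ`.
    linear_combination -c * h₄ + s * h₅ + (B x y - B (I x) (I y) + P (I x) y + P x (I y)) * hcs
  · ext x y
    change f x y - f (I x) (I y) = 0
    have h₄ := h₃ x y
    have h₅ := h₃ x (I y)
    simp only [hf, h.I_sq, map_neg] at h₅ ⊢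
    linear_combination -c * h₄ - s * h₅

end IsSU3

end Components

/-! ### Mean curvature and the conditions for each type. -/

namespace Hypersurface

variable {N : Type*} [TopologicalSpace N] [ChartedSpace (EuclideanSpace ℝ (Fin 7)) N]
  [IsManifold (𝓡 7) ∞ N] {G : G2Structure N} {M : Type*} [TopologicalSpace M]
  [ChartedSpace (EuclideanSpace ℝ (Fin 6)) M] [IsManifold (𝓡 6) ∞ M] (X : Hypersurface G M)

theorem meanCurvature_eq_smul (m : M) : X.meanCurvature m = ((1 / 6 : ℝ) *
    ∑ i, X.B m (orthonormalFrame 6 (X.g m) i) (orthonormalFrame 6 (X.g m) i)) • X.n m := by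
  simp only [meanCurvature, X.shapeTensor_eq, ← Finset.sum_smul, smul_smul]

theorem h_eq (m : M) : X.h m = (1 / 6 : ℝ) *
    ∑ i, X.B m (orthonormalFrame 6 (X.g m) i) (orthonormalFrame 6 (X.g m) i) := by
  rw [h, meanCurvature_eq_smul, ← G.gLin_apply, map_smul, LinearMap.smul_apply,
    (X.isG2Hyperplane m).unit, smul_eq_mul, mul_one]

/-- The mean curvature vector is `h n`. -/
theorem isMinimal_iff : X.IsMinimal ↔ ∀ m, X.h m = 0 := by
  refine forall_congr' fun m => ?_
  have h₁ : X.meanCurvature m = X.h m • X.n m := by rw [X.meanCurvature_eq_smul, X.h_eq]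
  constructor
  · intro h₂
    rw [h, h₂, ← G.gLin_apply, map_zero, LinearMap.zero_apply]
  · intro h₂
    rw [h₁, h₂, zero_smul]

/-- The types of the structures induced on a hypersurface. -/
theorem isOfType_iff (hG : G.IsTypeX₃) {θ : M → ℝ} (hθ : ContMDiff (𝓡 6) 𝓘(ℝ, ℝ) ∞ θ)
    {C : Set TorsionClass} (hC : .W4 ∉ C) : (X.su3 θ).IsOfType C ↔ ∀ m,
      (.W1plus ∉ C → Real.sin (θ m) * X.rbarNormal m = -(6 * X.h m) * Real.cos (θ m)) ∧
      (.W1minus ∉ C → Real.cos (θ m) * X.rbarNormal m = 6 * X.h m * Real.sin (θ m)) ∧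
      (.W2plus ∉ C → ∀ x y, -3 * Real.sin (θ m) *
          (X.pullRbar m x y + actBoth (X.I m) (X.pullRbar m) x y) +
          3 * Real.cos (θ m) * (X.B m x y + actBoth (X.I m) (X.B m) x y) =
        (6 * X.h m * Real.cos (θ m) + Real.sin (θ m) * X.rbarNormal m) * X.g m x y) ∧
      (.W2minus ∉ C → ∀ x y, 3 * Real.cos (θ m) *
          (X.pullRbar m x y + actBoth (X.I m) (X.pullRbar m) x y) +
          3 * Real.sin (θ m) * (X.B m x y + actBoth (X.I m) (X.B m) x y) =
        (6 * X.h m * Real.sin (θ m) - Real.cos (θ m) * X.rbarNormal m) * X.g m x y) ∧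
      (.W3 ∉ C → ∀ x y, actFst (X.I m) (X.pullRbar m) x y + actSnd (X.I m) (X.pullRbar m) x y =
        X.B m x y - actBoth (X.I m) (X.B m) x y) ∧
      (.W5 ∉ C → ∀ x : TangentSpace (𝓡 6) m, mfderiv (𝓡 6) 𝓘(ℝ, ℝ) θ m x =
        G.rbar (X.ι m) (X.push m x) (X.n m)) := by
  refine forall_congr' fun m => ?_
  obtain ⟨L, hL, hLs, hLt⟩ := hG.exists_endomorphism G (X.ι m)
  refine (X.mem_type_iff hL hLs (hθ.mdifferentiableAt (by simp)) hC).trans ?_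
  have hS := X.isSU3 m
  have he := hS.orthonormalFrame_spec
  let P : TangentSpace (𝓡 6) m →ₗ[ℝ] TangentSpace (𝓡 6) m →ₗ[ℝ] ℝ :=
    (G.gLin (X.ι m)).compl₁₂ (L.comp (X.pushLin m)) (X.pushLin m)
  have hP : ∀ x y, P x y = X.pullRbar m x y := fun x y => (G.rbar_eq hL _ _).symm
  have hρ : ∑ i, P (orthonormalFrame 6 (fun x y => X.gLin m x y) i)
      (orthonormalFrame 6 (fun x y => X.gLin m x y) i) = -X.rbarNormal m := by
    -- `L` has trace zero in the frame completed by `n`, so its tangential trace is minus the normal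
    -- entry.
    have h₁ := hLt _ ((X.isG2Hyperplane m).frame_cons he)
    rw [Fin.sum_univ_succ] at h₁
    rw [rbarNormal, G.rbar_eq hL]
    exact eq_neg_of_add_eq_zero_right h₁
  have hβ : ∑ i, X.BLin m (orthonormalFrame 6 (fun x y => X.gLin m x y) i)
      (orthonormalFrame 6 (fun x y => X.gLin m x y) i) = 6 * X.h m := by
    rw [X.h_eq, ← mul_assoc]
    norm_num
    rfl
  obtain ⟨h₁, h₂, h₃, h₄, h₅⟩ := hS.formComponent_eq_zero_iff (B := X.BLin m) (P := P) (X.B_symm m)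
    (fun x y => hLs _ _) (Real.sin_sq_add_cos_sq (θ m)) hβ hρ (f := X.torsionForm θ m)
    (fun x y => by rw [hP, hP]; rfl)
  simp only [hP] at h₃ h₄ h₅
  constructor
  · rintro ⟨h, h'⟩
    exact ⟨fun hc => h₁.1 (h _ hc (by simp)), fun hc => h₂.1 (h _ hc (by simp)),
      fun hc => h₃.1 (h _ hc (by simp)), fun hc => h₄.1 (h _ hc (by simp)),
      fun hc => h₅.1 (h _ hc (by simp)), h'⟩
  · rintro ⟨k₁, k₂, k₃, k₄, k₅, k₆⟩
    refine ⟨fun d hd hd₅ => ?_, k₆⟩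
    cases d
    case W1plus => exact h₁.2 (k₁ hd)
    case W1minus => exact h₂.2 (k₂ hd)
    case W2plus => exact h₃.2 (k₃ hd)
    case W2minus => exact h₄.2 (k₄ hd)
    case W3 => exact h₅.2 (k₅ hd)
    case W4 => rfl
    case W5 => exact absurd rfl hd₅

end Hypersurface

end

/-! ### The classification. -/

theorem theorem4p9 {N : Type*} [TopologicalSpace N]
    [ChartedSpace (EuclideanSpace ℝ (Fin 7)) N] [IsManifold (𝓡 7) ∞ N]
    {M : Type*} [TopologicalSpace M]
    [ChartedSpace (EuclideanSpace ℝ (Fin 6)) M] [IsManifold (𝓡 6) ∞ M]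
    (G : G2Structure N) (hG : G.IsTypeX₃) (X : Hypersurface G M)
    (θ : M → ℝ) (hθ : ContMDiff (𝓡 6) 𝓘(ℝ, ℝ) ∞ θ) :
    -- every induced structure has no `𝒲₄`-component
    (X.su3 θ).IsOfType {.W1plus, .W1minus, .W2plus, .W2minus, .W3, .W5} ∧
    -- characterisation of `𝒲₁± + 𝒲₂± + 𝒲₃`
    ((X.su3 θ).IsOfType {.W1plus, .W1minus, .W2plus, .W2minus, .W3} ↔
      ∀ (m : M) (x : TangentSpace (𝓡 6) m),
        mfderiv (𝓡 6) 𝓘(ℝ, ℝ) θ m x = G.rbar (X.ι m) (X.push m x) (X.n m)) ∧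
    -- characterisation of `𝒲₁± + 𝒲₂± + 𝒲₅`
    ((X.su3 θ).IsOfType {.W1plus, .W1minus, .W2plus, .W2minus, .W5} ↔
      ∀ (m : M) (x y : TangentSpace (𝓡 6) m),
        actFst (X.I m) (X.pullRbar m) x y + actSnd (X.I m) (X.pullRbar m) x y =
          X.B m x y - actBoth (X.I m) (X.B m) x y) ∧
    -- characterisation of `𝒲₁± + 𝒲₂⁺ + 𝒲₃ + 𝒲₅`
    ((X.su3 θ).IsOfType {.W1plus, .W1minus, .W2plus, .W3, .W5} ↔
      ∀ (m : M) (x y : TangentSpace (𝓡 6) m),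
        3 * Real.cos (θ m) * (X.pullRbar m x y + actBoth (X.I m) (X.pullRbar m) x y)
          + 3 * Real.sin (θ m) * (X.B m x y + actBoth (X.I m) (X.B m) x y) =
        (6 * X.h m * Real.sin (θ m) - Real.cos (θ m) * X.rbarNormal m) * X.g m x y) ∧
    -- characterisation of `𝒲₁± + 𝒲₂⁻ + 𝒲₃ + 𝒲₅`
    ((X.su3 θ).IsOfType {.W1plus, .W1minus, .W2minus, .W3, .W5} ↔
      ∀ (m : M) (x y : TangentSpace (𝓡 6) m),
        -3 * Real.sin (θ m) * (X.pullRbar m x y + actBoth (X.I m) (X.pullRbar m) x y)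
          + 3 * Real.cos (θ m) * (X.B m x y + actBoth (X.I m) (X.B m) x y) =
        (6 * X.h m * Real.cos (θ m) + Real.sin (θ m) * X.rbarNormal m) * X.g m x y) ∧
    -- characterisation of `𝒲₁⁺ + 𝒲₂± + 𝒲₃ + 𝒲₅`
    ((X.su3 θ).IsOfType {.W1plus, .W2plus, .W2minus, .W3, .W5} ↔
      ∀ m : M, Real.cos (θ m) * X.rbarNormal m = 6 * X.h m * Real.sin (θ m)) ∧
    -- characterisation of `𝒲₁⁻ + 𝒲₂± + 𝒲₃ + 𝒲₅`
    ((X.su3 θ).IsOfType {.W1minus, .W2plus, .W2minus, .W3, .W5} ↔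
      ∀ m : M, Real.sin (θ m) * X.rbarNormal m = -6 * X.h m * Real.cos (θ m)) ∧
    -- characterisation of `𝒲₁± + 𝒲₃ + 𝒲₅`
    ((X.su3 θ).IsOfType {.W1plus, .W1minus, .W3, .W5} ↔
      (∀ (m : M) (x y : TangentSpace (𝓡 6) m),
        3 * (X.pullRbar m x y + actBoth (X.I m) (X.pullRbar m) x y) =
          -X.rbarNormal m * X.g m x y) ∧
      ∀ (m : M) (x y : TangentSpace (𝓡 6) m),
        X.B m x y + actBoth (X.I m) (X.B m) x y = 2 * X.h m * X.g m x y) ∧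
    -- characterisation of `𝒲₂± + 𝒲₃ + 𝒲₅`
    ((X.su3 θ).IsOfType {.W2plus, .W2minus, .W3, .W5} ↔
      (∀ m : M, X.rbarNormal m = 0) ∧ X.IsMinimal) := by
  -- One condition remains for each label missing from `C` apart from `𝒲₄`: none in the first
  -- statement, one in the next six, two in the last two.
  have key {C : Set TorsionClass} (hC : .W4 ∉ C) := X.isOfType_iff hG hθ hC
  refine ⟨?_, ?_, ?_, ?_, ?_, ?_, ?_, ?_, ?_⟩
  · rw [key (by simp)]; simp
  · rw [key (by simp)]; simp
  · rw [key (by simp)]; simp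
  · rw [key (by simp)]; simp
  · rw [key (by simp)]; simp
  · rw [key (by simp)]; simp
  · rw [key (by simp)]; simp
  · rw [key (by simp), ← forall_and]
    refine forall_congr' fun m => ?_
    have hcs := Real.sin_sq_add_cos_sq (θ m)
    simp only [Set.mem_insert_iff, Set.mem_singleton_iff, reduceCtorEq, or_true, or_false,
      not_true_eq_false, false_implies, not_false_eq_true, true_implies, true_and, and_true]
    rw [← forall_and, ← forall_and]
    refine forall_congr' fun x => ?_
    rw [← forall_and, ← forall_and]
    refine forall_congr' fun y => ⟨fun ⟨h₁, h₂⟩ => ⟨?_, ?_⟩, fun ⟨h₁, h₂⟩ => ⟨?_, ?_⟩⟩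
    -- The equations for `𝒲₂⁺` and `𝒲₂⁻` are the stated pair rotated through `θ`; here the rotation
    -- is inverted.
    · linear_combination -Real.sin (θ m) * h₁ + Real.cos (θ m) * h₂ -
        (3 * (X.pullRbar m x y + actBoth (X.I m) (X.pullRbar m) x y) +
          X.rbarNormal m * X.g m x y) * hcs
    · linear_combination (1 / 3) * Real.cos (θ m) * h₁ + (1 / 3) * Real.sin (θ m) * h₂ -
        (X.B m x y + actBoth (X.I m) (X.B m) x y - 2 * X.h m * X.g m x y) * hcs
    · linear_combination -Real.sin (θ m) * h₁ + 3 * Real.cos (θ m) * h₂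
    · linear_combination Real.cos (θ m) * h₁ + 3 * Real.sin (θ m) * h₂
  · rw [key (by simp), X.isMinimal_iff, ← forall_and]
    refine forall_congr' fun m => ?_
    have hcs := Real.sin_sq_add_cos_sq (θ m)
    simp only [Set.mem_insert_iff, Set.mem_singleton_iff, reduceCtorEq, or_true, or_false,
      not_true_eq_false, false_implies, not_false_eq_true, true_implies, and_true]
    refine ⟨fun ⟨h₁, h₂⟩ => ⟨?_, ?_⟩, fun ⟨h₁, h₂⟩ => ⟨?_, ?_⟩⟩
    -- The same inversion, for the pair `r̄(φ)(n, n)` and `6 h`.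
    · linear_combination Real.sin (θ m) * h₁ + Real.cos (θ m) * h₂ - X.rbarNormal m * hcs
    · linear_combination (1 / 6) * Real.cos (θ m) * h₁ - (1 / 6) * Real.sin (θ m) * h₂ -
        X.h m * hcs
    · rw [h₁, h₂]; ring
    · rw [h₁, h₂]; ring
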